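/- **Setting.** Let $G^*$ be a DAG on $n$ vertices $V$. Two DAGs are Markov equivalent if they have the same skeleton and the same v-structures ($u\to v\leftarrow w$ with $u,w$ distinct and non-adjacent). For $S\subseteq V$ let $G_S$ be $G$ with all arcs into vertices of $S$ removed. For a family $\mathcal I\subseteq 2^V$, the $\mathcal I$-essential graph $\mathcal E_{\mathcal I}(G^*)$ has the skeleton of $G^*$; an adjacency is oriented in it if it has the same direction in all DAGs $G$ such that $G$ is Markov equivalent to $G^*$ and $G_S$ is Markov equivalent to $G^*_S$ for every $S\in\mathcal I$, and is unoriented otherwise. Put $\mathcal E(G^*)=\mathcal E_{\emptyset}(G^*)$. An atomic intervention is a set $S$ with $|S|=1$, and $\nu_1(G^*)$ is the minimum size of a set $\mathcal I$ of atomic interventions with $\mathcal E_{\mathcal I}(G^*)=G^*$. Chain components of a partially directed graph are the connected components of its unoriented part. A $1/2$-clique separator of a connected undirected graph $H$ is a clique $K$ of $H$ such that every connected component of $H-K$ has at most $|V(H)|/2$ vertices. **Algorithm (separator-based search, $k=1$).** Input: $\mathcal E(G^*)$. Start with $\mathcal I=\emptyset$. While $\mathcal E_{\mathcal I}(G^*)$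 has an unoriented edge: choose a $1/2$-clique separator $K_H$ of each chain component $H$ of $\mathcal E_{\mathcal I}(G^*)$ with at least $2$ vertices, perform an atomic intervention on each vertex of $Q=\bigcup_H K_H$, and add these interventions to $\mathcal I$. **Theorem.** There is an absolute constant $C$ such that the following hold for all $n$ and every DAG $G^*$ on $n$ vertices. 1. Whichever $1/2$-clique separators are chosen, the algorithm never gets stuck (the separators that it needs exist), it terminates, it never intervenes twice on a vertex, and on termination $\mathcal E_{\mathcal I}(G^*)=G^*$ and the number $|\mathcal I|$ of interventions is at most $C\cdot\log n\cdot\nu_1(G^*)$. 2. The algorithm can be implemented deterministically and adaptively in polynomial time: there are one deterministic program and one polynomial $q$, not depending on $n$ or $G^*$, such that the program, given only $n$, $\mathcal E(G^*)$ and access to an oracle that, when an atomic intervention on $v$ is performed, reveals the orientations in $G^*$ of the edges at $v$, halts after at most $q(n)$ steps, its sequence of interventions is that of a complete run of the algorithm (so that $\mathcal E_{\mathcal I}(G^*)=G^*$ and at most $C\cdot\log n\cdot\nu_1(G^*)$ interventions are made), and it outputs $G^*$. (Programs are those of a random access machine with unit-cost addition, truncated subtraction, comparison and array access, without multiplication;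 an intervention costs $n+1$ steps.) -/

import Mathlib

/-! ### Directed acyclic graphs, partially directed graphs -/

/-- A directed acyclic graph on the vertex set `V`. -/
structure DAG (V : Type*) where
  arc : V → V → Prop
  acyclic : ∀ v, ¬ Relation.TransGen arc v v

/-- A partially directed graph: every pair of distinct vertices is joined by an unoriented edge,
by an arc in exactly one direction, or not at all. -/
@[ext]
structure PDGraph (V : Type*) where
  edges : SimpleGraph V
  arcs : V → V → Prop
  arcs_asymm : ∀ u v, arcs u v → ¬ arcs v u
  arcs_not_edge : ∀ u v, arcs u v → ¬ edges.Adj u v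

namespace DAG

variable {V : Type*}

theorem asymm (G : DAG V) {u v : V} (h : G.arc u v) : ¬ G.arc v u := fun h' =>
  G.acyclic u (Relation.TransGen.tail (Relation.TransGen.single h) h')

/-- Adjacency in the skeleton. -/
def skel (G : DAG V) (u v : V) : Prop := G.arc u v ∨ G.arc v u

/-- `u → v ← w` with distinct, non-adjacent `u` and `w`. -/
def VStructure (G : DAG V) (u v w : V) : Prop :=
  u ≠ w ∧ G.arc u v ∧ G.arc w v ∧ ¬ G.skel u w

/-- Markov equivalence: same skeleton and same v-structures. -/
def MarkovEquiv (G G' : DAG V) : Prop :=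
  (∀ u v, G.skel u v ↔ G'.skel u v) ∧ ∀ u v w, G.VStructure u v w ↔ G'.VStructure u v w

/-- The interventional graph `G_S`: all arcs into vertices of `S` are removed. -/
def interventional (G : DAG V) (S : Set V) : DAG V where
  arc u v := G.arc u v ∧ v ∉ S
  acyclic v h := G.acyclic v (Relation.TransGen.mono (r := fun u v => G.arc u v ∧ v ∉ S)
    (fun _ _ h => h.1) v v h)

/-- Equivalence with respect to the observational data and the interventions `S ∈ 𝓘`. -/
def InterventionEquiv (𝓘 : Set (Set V)) (G G' : DAG V) : Prop :=
  G.MarkovEquiv G' ∧ ∀ S ∈ 𝓘, (G.interventional S).MarkovEquiv (G'.interventional S)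

theorem InterventionEquiv.refl (𝓘 : Set (Set V)) (G : DAG V) : InterventionEquiv 𝓘 G G :=
  ⟨⟨fun _ _ => Iff.rfl, fun _ _ _ => Iff.rfl⟩,
    fun _ _ => ⟨fun _ _ => Iff.rfl, fun _ _ _ => Iff.rfl⟩⟩

/-- The `𝓘`-essential graph of `G`: an adjacency is oriented if all DAGs of the class of `G` agree
on its direction, and is an unoriented edge if both directions occur in the class. -/
def essential (𝓘 : Set (Set V)) (G : DAG V) : PDGraph V where
  edges :=
    { Adj := fun u v => (∃ G', InterventionEquiv 𝓘 G G' ∧ G'.arc u v) ∧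
        ∃ G', InterventionEquiv 𝓘 G G' ∧ G'.arc v u
      symm := ⟨fun _ _ h => ⟨h.2, h.1⟩⟩
      loopless := ⟨fun v h => by
        obtain ⟨⟨G', _, h⟩, _⟩ := h
        exact G'.asymm h h⟩ }
  arcs u v := ∀ G', InterventionEquiv 𝓘 G G' → G'.arc u v
  arcs_asymm _ _ h h' :=
    G.asymm (h G (InterventionEquiv.refl 𝓘 G)) (h' G (InterventionEquiv.refl 𝓘 G))
  arcs_not_edge u v h := by
    rintro ⟨_, G', hG', ha⟩
    exact G'.asymm ha (h G' hG')

/-- A DAG as a fully oriented partially directed graph. -/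
def toPDGraph (G : DAG V) : PDGraph V where
  edges := ⊥
  arcs := G.arc
  arcs_asymm _ _ h := G.asymm h
  arcs_not_edge _ _ _ h := h

/-- `𝓘` is a verifying set for `G`. -/
def IsVerifying (𝓘 : Set (Set V)) (G : DAG V) : Prop := G.essential 𝓘 = G.toPDGraph

/-- `ν₁(G)`: the minimum size of a verifying set of `G` that consists of atomic interventions. -/
noncomputable def nu1 [Finite V] (G : DAG V) : ℕ :=
  sInf {m | ∃ 𝓘 : Set (Set V), (∀ S ∈ 𝓘, S.ncard = 1) ∧ IsVerifying 𝓘 G ∧ 𝓘.ncard = m}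

end DAG

/-! ### The separator-based search algorithm with atomic interventions -/

section Search

variable {V : Type*}

/-- The atomic intervention set that consists of the singletons of the listed vertices. -/
def atomicSet (l : List V) : Set (Set V) := {S | ∃ v ∈ l, S = {v}}

/-- The set `K` is a `1/2`-clique separator of the subgraph of `U` induced by `H`: it is a clique,
and each connected component that is left after its removal has at most `|H| / 2` vertices. -/
def IsHalfCliqueSeparator (U : SimpleGraph V) (H K : Set V) : Prop :=
  K ⊆ H ∧ U.IsClique K ∧
    ∀ D : (U.induce (H \ K)).ConnectedComponent, 2 * D.supp.ncard ≤ H.ncard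

/-- One iteration of the loop of the search algorithm, on the ground truth `G`. The list `l` holds
the vertices intervened on so far, in order. The loop is entered if `E_𝓘(G)` has an unoriented
edge. A `1/2`-clique separator `K H` is chosen for each chain component `H` with at least two
vertices, and each vertex of the union of these separators is intervened on, once. -/
def SearchStep (G : DAG V) (l l' : List V) : Prop :=
  (G.essential (atomicSet l)).edges ≠ ⊥ ∧
  ∃ K : (G.essential (atomicSet l)).edges.ConnectedComponent → Set V,
    (∀ H, 2 ≤ H.supp.ncard →
      IsHalfCliqueSeparator (G.essential (atomicSet l)).edges H.supp (K H)) ∧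
    ∃ batch : List V, batch.Nodup ∧
      (∀ v, v ∈ batch ↔ ∃ H, 2 ≤ H.supp.ncard ∧ v ∈ K H) ∧ l' = l ++ batch

/-- The search algorithm, started with no intervention, can get to the sequence `l`. -/
def SearchReaches (G : DAG V) (l : List V) : Prop :=
  Relation.ReflTransGen (SearchStep G) [] l

/-- The exit condition of the loop: no unoriented edge is left. -/
def SearchDone (G : DAG V) (l : List V) : Prop :=
  (G.essential (atomicSet l)).edges = ⊥

end Search

/-! ### A machine model with a step count and an intervention oracle

A program is a finite deterministic imperative program over natural numbers. Its memory consists of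
two-dimensional arrays of natural numbers; the names of arrays are literals of the program, indices
are computed. Arithmetic consists of addition and truncated subtraction, at unit cost (there is no
multiplication). -/

/-- Expressions. -/
inductive RExpr where
  | const (k : ℕ)
  | cell (a : ℕ) (i j : RExpr)
  | add (e f : RExpr)
  | sub (e f : RExpr)
  | lt (e f : RExpr)

/-- The memory: array name, row, column. -/
abbrev RMem := ℕ → ℕ → ℕ → ℕ

namespace RExpr

/-- The value of an expression; comparison yields `1` (true) or `0` (false). -/
def eval (m : RMem) : RExpr → ℕ
  | const k => k
  | cell a i j => m a (i.eval m) (j.eval m)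
  | add e f => e.eval m + f.eval m
  | sub e f => e.eval m - f.eval m
  | lt e f => if e.eval m < f.eval m then 1 else 0

/-- The number of steps that an evaluation takes: one per operation. -/
def cost : RExpr → ℕ
  | const _ => 1
  | cell _ i j => i.cost + j.cost + 1
  | add e f => e.cost + f.cost + 1
  | sub e f => e.cost + f.cost + 1
  | lt e f => e.cost + f.cost + 1

end RExpr

/-- Programs. -/
inductive RProg where
  | skip
  | store (a : ℕ) (i j e : RExpr)
  | seq (c d : RProg)
  | cond (e : RExpr) (c d : RProg)
  | loop (e : RExpr) (c : RProg)
  | intervene (e : RExpr)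

/-- A state: the memory, and the vertices intervened on so far, in order. The second component only
records what has been done; a program cannot read it. -/
structure RState (n : ℕ) where
  mem : RMem
  log : List (Fin n)

/-- Write `x` into the cell `(i, j)` of array `a`. -/
def RMem.write (m : RMem) (a i j x : ℕ) : RMem :=
  fun a' i' j' => if a' = a ∧ i' = i ∧ j' = j then x else m a' i' j'

open Classical in
/-- The outcome of the atomic intervention on `v`: it reveals the orientation in `G` of the edges
that are cut by `{v}`, that is, of the edges at `v`. For each vertex `u` the cells `(u, v)` and
`(v, u)` of array `2` are set to `1` or `0` as the corresponding arc is present or not. -/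
noncomputable def RMem.reveal {n : ℕ} (G : DAG (Fin n)) (v : Fin n) (m : RMem) : RMem :=
  fun a i j =>
    if h : a = 2 ∧ i < n ∧ j < n ∧ (i = v ∨ j = v) then
      if G.arc ⟨i, h.2.1⟩ ⟨j, h.2.2.1⟩ then 1 else 0
    else m a i j

/-- `RExec G c s t s'`: with the ground truth `G` behind the intervention oracle, the program `c`
started in the state `s` halts after exactly `t` steps in the state `s'`. An intervention counts
one step plus one for each vertex, and is possible only if its argument is the number of a vertex;
otherwise the program gets stuck and does not halt. -/
inductive RExec {n : ℕ} (G : DAG (Fin n)) : RProg → RState n → ℕ → RState n → Prop where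
  | skip (s : RState n) : RExec G .skip s 1 s
  | store (a : ℕ) (i j e : RExpr) (s : RState n) :
      RExec G (.store a i j e) s (i.cost + j.cost + e.cost + 1)
        ⟨s.mem.write a (i.eval s.mem) (j.eval s.mem) (e.eval s.mem), s.log⟩
  | seq (c d : RProg) (s s₁ s₂ : RState n) (t₁ t₂ : ℕ) :
      RExec G c s t₁ s₁ → RExec G d s₁ t₂ s₂ → RExec G (.seq c d) s (t₁ + t₂ + 1) s₂
  | cond_true (e : RExpr) (c d : RProg) (s s' : RState n) (t : ℕ) :
      e.eval s.mem ≠ 0 → RExec G c s t s' → RExec G (.cond e c d) s (e.cost + t + 1) s'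
  | cond_false (e : RExpr) (c d : RProg) (s s' : RState n) (t : ℕ) :
      e.eval s.mem = 0 → RExec G d s t s' → RExec G (.cond e c d) s (e.cost + t + 1) s'
  | loop_true (e : RExpr) (c : RProg) (s s₁ s₂ : RState n) (t₁ t₂ : ℕ) :
      e.eval s.mem ≠ 0 → RExec G c s t₁ s₁ → RExec G (.loop e c) s₁ t₂ s₂ →
      RExec G (.loop e c) s (e.cost + t₁ + t₂ + 1) s₂
  | loop_false (e : RExpr) (c : RProg) (s : RState n) :
      e.eval s.mem = 0 → RExec G (.loop e c) s (e.cost + 1) s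
  | intervene (e : RExpr) (s : RState n) (v : Fin n) :
      e.eval s.mem = v →
      RExec G (.intervene e) s (e.cost + n + 1) ⟨s.mem.reveal G v, s.log ++ [v]⟩

/-- Programs are deterministic: the number of steps and the final state are determined. -/
theorem RExec.deterministic {n : ℕ} {G : DAG (Fin n)} {c : RProg} {s s₁ : RState n} {t₁ : ℕ}
    (h₁ : RExec G c s t₁ s₁) :
    ∀ {t₂ : ℕ} {s₂ : RState n}, RExec G c s t₂ s₂ → t₁ = t₂ ∧ s₁ = s₂ := by
  induction h₁ with
  | skip s => intro t₂ s₂ h; cases h; exact ⟨rfl, rfl⟩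
  | store a i j e s => intro t₂ s₂ h; cases h; exact ⟨rfl, rfl⟩
  | seq c d s s₁ s₂ t₁ t₂ _ _ ih₁ ih₂ =>
    intro t s' h
    cases h with
    | seq _ _ _ r₁ _ _ _ k₁ k₂ =>
      obtain ⟨rfl, rfl⟩ := ih₁ k₁
      obtain ⟨rfl, rfl⟩ := ih₂ k₂
      exact ⟨rfl, rfl⟩
  | cond_true e c d s s' t he _ ih =>
    intro t s' h
    cases h with
    | cond_true _ _ _ _ _ _ _ k => obtain ⟨rfl, rfl⟩ := ih k; exact ⟨rfl, rfl⟩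
    | cond_false _ _ _ _ _ _ he' _ => exact absurd he' he
  | cond_false e c d s s' t he _ ih =>
    intro t s' h
    cases h with
    | cond_true _ _ _ _ _ _ he' _ => exact absurd he he'
    | cond_false _ _ _ _ _ _ _ k => obtain ⟨rfl, rfl⟩ := ih k; exact ⟨rfl, rfl⟩
  | loop_true e c s s₁ s₂ t₁ t₂ he _ _ ih₁ ih₂ =>
    intro t s' h
    cases h with
    | loop_true _ _ _ _ _ _ _ _ k₁ k₂ =>
      obtain ⟨rfl, rfl⟩ := ih₁ k₁
      obtain ⟨rfl, rfl⟩ := ih₂ k₂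
      exact ⟨rfl, rfl⟩
    | loop_false _ _ _ he' => exact absurd he' he
  | loop_false e c s he =>
    intro t s' h
    cases h with
    | loop_true _ _ _ _ _ _ _ he' _ _ => exact absurd he he'
    | loop_false _ _ _ _ => exact ⟨rfl, rfl⟩
  | intervene e s v hv =>
    intro t s' h
    cases h with
    | intervene _ _ w hw =>
      obtain rfl : v = w := Fin.ext (hv.symm.trans hw)
      exact ⟨rfl, rfl⟩

open Classical in
/-- The initial state on the input `P`: array `0` holds the matrix of `P`, whose entry `(u, v)` is
`1` if `P` has the arc `u → v` or the unoriented edge `u - v`, and `0` otherwise; the cell `(0, 0)`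
of array `1` holds the number of vertices; all other cells are `0`. -/
noncomputable def RState.init {n : ℕ} (P : PDGraph (Fin n)) : RState n where
  mem := fun a i j =>
    if a = 0 then
      if h : i < n ∧ j < n then
        if P.arcs ⟨i, h.1⟩ ⟨j, h.2⟩ ∨ P.edges.Adj ⟨i, h.1⟩ ⟨j, h.2⟩ then 1 else 0
      else 0
    else if a = 1 ∧ i = 0 ∧ j = 0 then n
    else 0
  log := []

open Classical in
/-- Array `3` of the state holds the adjacency matrix of the DAG `G`. -/
def RState.Outputs {n : ℕ} (s : RState n) (G : DAG (Fin n)) : Prop :=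
  ∀ u v : Fin n, s.mem 3 u v = if G.arc u v then 1 else 0

/-!
The proof rests on a description of interventional essential graphs. An intervention adds to Markov
equivalence the directions of the edges that it cuts (`interventionEquiv_iff`), and the arcs of the
essential graph are the closure of the compelled observational arcs and the cut arcs under Meek's
rules (`essential_empty_arcs_iff`, `essential_arcs_iff`). Soundness of the rules is direct. For
completeness, a closed set of arcs has the chain property: all vertices of an undirected component
have the same parents outside of it (`Meek.chainClosed`, `InterventionMeek.chainClosed`). So a
component can be reoriented on its own (`exists_reorientation`), in any way that is acyclic and has
no v-structure. The true orientation of the component is of this kind, a moral orientation in the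
terms of `IsMoral`, and in a moral orientation every edge can be reversed without losing this
property (`IsMoral.exists_reversal`): the last parents form a tree, adjacency is intersection of
certain subtrees, and the tree can be rooted anew. Hence no undirected edge is compelled.

A moral orientation also yields the separators. Walking down from a source of a component to the
last vertex `w` with more than half of the component among its descendants, the clique of `w` and
its parents is a `1/2`-clique separator (`IsMoral.isHalfCliqueSeparator`), so that the search never
gets stuck. After an iteration, each chain component lies in a piece left by one of the chosen
separators, and has at most half the size (`SearchStep.halves`); thus there are at most `log₂ n`
iterations.

Each iteration costs at most `3 * nu1` interventions. An edge whose ends have the same other parents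
within the unoriented part can be turned around alone, so that every verifying family cuts it
(`cut_of_covered`). On the way up from the last vertex of a clique `K` through last parents, such
edges occur at every number of parents below `|K|` (`IsMoral.exists_covered_edge`). Those at the
even numbers are disjoint, which forces about `|K| / 2` targets in the component of `K`, and the
components of one iteration are disjoint (`clique_le`, `SearchStep.length_le`). Together this gives
the bound with `C = 3 / log 2`.

The polynomial time program is written in a small total language of matrix programs, in which a
matrix is assigned entrywise by a term with counting quantifiers, loops run `n` times, and one
command intervenes on a marked set of vertices. Its compilation to the machine is correct and
polynomial (`Cmd.halts`). In this language, closure under Meek's first two rules is saturation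
(`denote_saturate`); a moral orientation of the unoriented part is found by repeated elimination of
simplicial vertices (`denote_orientationCmd`), which needs no access to the true orientation; and
centroids are found by counting descendants. One round of the program is one iteration of the
search (`denote_roundCmd`), and after `n` rounds the closure is the ground truth.
-/

/-! ### Interventional equivalence and local reorientation -/

namespace DAG

variable {V : Type*}

/-- The number of ancestors is a topological numbering. -/
theorem exists_rank [Finite V] (G : DAG V) : ∃ r : V → ℤ, ∀ u v, G.arc u v → r u < r v := by
  refine ⟨fun v => ({u | Relation.TransGen G.arc u v} : Set V).ncard, fun u v h => ?_⟩
  have : ({w | Relation.TransGen G.arc w u} : Set V).ncard <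
      ({w | Relation.TransGen G.arc w v} : Set V).ncard := by
    apply Set.ncard_lt_ncard _ (Set.toFinite _)
    refine ⟨fun w hw => Relation.TransGen.tail hw h, fun hs => ?_⟩
    exact G.acyclic u (hs (Relation.TransGen.single h))
  exact Int.ofNat_lt.2 this

theorem arc_ne (G : DAG V) {u v : V} (h : G.arc u v) : u ≠ v := by
  rintro rfl
  exact G.asymm h h

theorem not_three_cycle (G : DAG V) {u v w : V} (h : G.arc u v) (h' : G.arc v w) :
    ¬ G.arc w u := fun h'' =>
  G.acyclic u (((Relation.TransGen.single h).tail h').tail h'')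

theorem skel_symm (G : DAG V) {u v : V} (h : G.skel u v) : G.skel v u := Or.symm h

/-- The edge `u - v` is cut by a target of the family `𝓘`: the target contains exactly one of the
two ends. -/
def Cut (𝓘 : Set (Set V)) (u v : V) : Prop :=
  ∃ S ∈ 𝓘, (u ∈ S ∧ v ∉ S) ∨ (u ∉ S ∧ v ∈ S)

theorem cut_symm {𝓘 : Set (Set V)} {u v : V} (h : Cut 𝓘 u v) : Cut 𝓘 v u := by
  obtain ⟨S, hS, h⟩ := h
  exact ⟨S, hS, by tauto⟩

theorem cut_atomicSet_iff {l : List V} {u v : V} (h : u ≠ v) :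
    Cut (atomicSet l) u v ↔ u ∈ l ∨ v ∈ l := by
  constructor
  · rintro ⟨_, ⟨w, hw, rfl⟩, h | h⟩
    · exact Or.inl (by rw [Set.mem_singleton_iff.1 h.1]; exact hw)
    · exact Or.inr (by rw [Set.mem_singleton_iff.1 h.2]; exact hw)
  · rintro (h' | h')
    · exact ⟨{u}, ⟨u, h', rfl⟩, Or.inl ⟨rfl, fun h'' => h h''.symm⟩⟩
    · exact ⟨{v}, ⟨v, h', rfl⟩, Or.inr ⟨h, rfl⟩⟩

/-- Interventions add to Markov equivalence exactly the orientations of the edges that they cut. -/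
theorem interventionEquiv_iff {𝓘 : Set (Set V)} {G G' : DAG V} :
    InterventionEquiv 𝓘 G G' ↔
      G.MarkovEquiv G' ∧ ∀ u v, Cut 𝓘 u v → G.arc u v → G'.arc u v := by
  constructor
  · rintro ⟨hM, hI⟩
    refine ⟨hM, ?_⟩
    rintro u v ⟨S, hS, hc⟩ h
    have hs := (hI S hS).1 u v
    have hs' := (hM.1 u v).1 (Or.inl h)
    have ha := G.asymm h
    simp only [skel, interventional] at hs hs'
    tauto
  · rintro ⟨hM, hC⟩
    refine ⟨hM, fun S hS => ?_⟩
    have hC' : ∀ u v, ((u ∈ S ∧ v ∉ S) ∨ (u ∉ S ∧ v ∈ S)) → (G.arc u v ↔ G'.arc u v) := by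
      intro u v hc
      refine ⟨hC u v ⟨S, hS, hc⟩, fun h => ?_⟩
      rcases (hM.1 u v).2 (Or.inl h) with h' | h'
      · exact h'
      · exact absurd (hC v u ⟨S, hS, by tauto⟩ h') (G'.asymm h)
    have hsk : ∀ u v, (G.interventional S).skel u v ↔ (G'.interventional S).skel u v := by
      intro u v
      have h1 := hM.1 u v
      have h2 := hC' u v
      have h3 := hC' v u
      simp only [skel, interventional] at h1 ⊢
      by_cases hu : u ∈ S <;> by_cases hv : v ∈ S <;> simp_all
    refine ⟨hsk, ?_⟩
    -- The argument is symmetric in the two graphs.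
    have key : ∀ {A B : DAG V}, A.MarkovEquiv B →
        (∀ u v, ((u ∈ S ∧ v ∉ S) ∨ (u ∉ S ∧ v ∈ S)) → (A.arc u v ↔ B.arc u v)) →
        (∀ u v, (A.interventional S).skel u v ↔ (B.interventional S).skel u v) →
        ∀ u v w, (A.interventional S).VStructure u v w → (B.interventional S).VStructure u v w := by
      intro A B hM hC hsk
      -- An edge `u → v` stays in `B` whenever some other parent of `v` is not joined to `u`.
      have aux : ∀ u v w, (A.interventional S).VStructure u v w → B.arc u v := by
        rintro u v w ⟨hne, ⟨huv, hvS⟩, ⟨hwv, -⟩, hns⟩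
        by_cases hu : u ∈ S
        · exact (hC u v (Or.inl ⟨hu, hvS⟩)).1 huv
        by_cases hadj : A.skel u w
        · by_cases hw : w ∈ S
          · have huw : A.arc u w := by
              rcases hadj with h | h
              · exact h
              · exact absurd (Or.inr ⟨h, hu⟩) hns
            have h1 := (hC u w (Or.inr ⟨hu, hw⟩)).1 huw
            have h2 := (hC w v (Or.inl ⟨hw, hvS⟩)).1 hwv
            rcases (hM.1 u v).1 (Or.inl huv) with h | h
            · exact h
            · exact absurd h (B.not_three_cycle h1 h2)
          · exact absurd (by simpa [skel, interventional, hu, hw] using hadj) hns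
        · exact ((hM.2 u v w).1 ⟨hne, huv, hwv, hadj⟩).2.1
      rintro u v w h
      have h1 := aux u v w h
      have h2 := aux w v u ⟨h.1.symm, h.2.2.1, h.2.1, fun h' => h.2.2.2 (skel_symm _ h')⟩
      exact ⟨h.1, ⟨h1, h.2.1.2⟩, ⟨h2, h.2.2.1.2⟩, fun h' => h.2.2.2 ((hsk u w).2 h')⟩
    intro u v w
    exact ⟨key hM hC' hsk u v w, key ⟨fun u v => (hM.1 u v).symm, fun u v w => (hM.2 u v w).symm⟩
      (fun u v h => (hC' u v h).symm) (fun u v => (hsk u v).symm) u v w⟩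

/-- A set `H` of vertices that have the same parents outside `H` can be reoriented on its own: if
neither the old nor the new acyclic orientation of `H` has a v-structure, then the result is a DAG
in the same Markov equivalence class. -/
theorem exists_reorientation {α : Type*} [Preorder α] (G : DAG V) (H : Set V) (N : V → V → Prop)
    (r : V → α)
    (hH : ∀ x ∉ H, ∀ h ∈ H, ∀ h' ∈ H, G.arc x h → G.arc x h')
    (hN : ∀ a ∈ H, ∀ b ∈ H, (N a b ∨ N b a) ↔ G.skel a b)
    (hr : ∀ a b, N a b → r a < r b)
    (hmN : ∀ a ∈ H, ∀ b ∈ H, ∀ c ∈ H, a ≠ b → N a c → N b c → G.skel a b)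
    (hmG : ∀ a ∈ H, ∀ b ∈ H, ∀ c ∈ H, a ≠ b → G.arc a c → G.arc b c → G.skel a b) :
    ∃ G' : DAG V, G.MarkovEquiv G' ∧ (∀ a ∈ H, ∀ b ∈ H, (G'.arc a b ↔ N a b)) ∧
      ∀ a b, ¬ (a ∈ H ∧ b ∈ H) → (G'.arc a b ↔ G.arc a b) := by
  let A : V → V → Prop := fun a b => (a ∈ H ∧ b ∈ H ∧ N a b) ∨ (¬ (a ∈ H ∧ b ∈ H) ∧ G.arc a b)
  -- A path of the new graph that starts outside `H` can be replaced by a path of `G`.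
  have out : ∀ z, z ∉ H → ∀ w, Relation.TransGen A z w →
      (w ∉ H → Relation.TransGen G.arc z w) ∧
        (w ∈ H → ∀ w' ∈ H, Relation.TransGen G.arc z w') := by
    intro z hz w hw
    induction hw with
    | single h =>
      rcases h with h | h
      · exact absurd h.1 hz
      · exact ⟨fun _ => .single h.2, fun hb w' hw' => .single (hH z hz _ hb _ hw' h.2)⟩
    | @tail b c _ h ih =>
      rcases h with h | ⟨h1, h2⟩
      · exact ⟨fun hc => absurd h.2.1 hc, fun _ => ih.2 h.1⟩
      · by_cases hb : b ∈ H
        · exact ⟨fun _ => (ih.2 hb b hb).tail h2, fun hc => absurd ⟨hb, hc⟩ h1⟩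
        · exact ⟨fun _ => (ih.1 hb).tail h2,
            fun hc w' hw' => (ih.1 hb).tail (hH b hb _ hc _ hw' h2)⟩
  have ins : ∀ z w, z ∈ H → Relation.TransGen A z w →
      (w ∈ H ∧ r z < r w) ∨ ∃ y, y ∉ H ∧ Relation.TransGen A z y ∧ Relation.ReflTransGen A y w := by
    intro z w hz hw
    induction hw with
    | @single b h =>
      by_cases hb : b ∈ H
      · rcases h with h | h
        · exact Or.inl ⟨hb, hr _ _ h.2.2⟩
        · exact absurd ⟨hz, hb⟩ h.1
      · exact Or.inr ⟨b, hb, .single h, .refl⟩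
    | @tail b c hb h ih =>
      rcases ih with ih | ⟨y, hy, h1, h2⟩
      · by_cases hc : c ∈ H
        · rcases h with h | h
          · exact Or.inl ⟨hc, ih.2.trans (hr _ _ h.2.2)⟩
          · exact absurd ⟨ih.1, hc⟩ h.1
        · exact Or.inr ⟨c, hc, hb.tail h, .refl⟩
      · exact Or.inr ⟨y, hy, h1, h2.tail h⟩
  have acyc : ∀ v, ¬ Relation.TransGen A v v := by
    intro v hv
    have hout : ∀ y, y ∉ H → ¬ Relation.TransGen A y y := fun y hy h =>
      G.acyclic y ((out y hy y h).1 hy)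
    by_cases h : v ∈ H
    · rcases ins v v h hv with h' | ⟨y, hy, h1, h2⟩
      · exact lt_irrefl _ h'.2
      · exact hout y hy (Relation.TransGen.trans_right h2 h1)
    · exact hout v h hv
  have e1 : ∀ a ∈ H, ∀ b ∈ H, (A a b ↔ N a b) := by
    intro a ha b hb; simp [A, ha, hb]
  have e2 : ∀ a b, ¬ (a ∈ H ∧ b ∈ H) → (A a b ↔ G.arc a b) := by
    intro a b h
    constructor
    · rintro (h' | h')
      · exact absurd ⟨h'.1, h'.2.1⟩ h
      · exact h'.2
    · exact fun h' => Or.inr ⟨h, h'⟩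
  have hsk : ∀ u v, G.skel u v ↔ (A u v ∨ A v u) := by
    intro u v
    by_cases h : u ∈ H ∧ v ∈ H
    · rw [e1 u h.1 v h.2, e1 v h.2 u h.1, hN u h.1 v h.2]
    · rw [e2 u v h, e2 v u (fun h' => h h'.symm)]; rfl
  refine ⟨⟨A, acyc⟩, ⟨hsk, ?_⟩, e1, e2⟩
  intro u v w
  simp only [VStructure]
  refine and_congr_right fun hne => ?_
  have hsk' : G.skel u w ↔ (DAG.mk A acyc).skel u w := hsk u w
  rw [← hsk', ← and_assoc, ← and_assoc]
  refine and_congr_left fun hns => ?_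
  by_cases hv : v ∈ H
  · by_cases hu : u ∈ H <;> by_cases hw : w ∈ H
    · rw [e1 u hu v hv, e1 w hw v hv]
      exact ⟨fun h => absurd (hmG u hu w hw v hv hne h.1 h.2) hns,
        fun h => absurd (hmN u hu w hw v hv hne h.1 h.2) hns⟩
    · rw [e2 w v (fun h => hw h.1)]
      exact ⟨fun h => absurd (Or.inr (hH w hw v hv u hu h.2)) hns,
        fun h => absurd (Or.inr (hH w hw v hv u hu h.2)) hns⟩
    · rw [e2 u v (fun h => hu h.1)]
      exact ⟨fun h => absurd (Or.inl (hH u hu v hv w hw h.1)) hns,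
        fun h => absurd (Or.inl (hH u hu v hv w hw h.1)) hns⟩
    · rw [e2 u v (fun h => hu h.1), e2 w v (fun h => hw h.1)]
  · rw [e2 u v (fun h => hv h.2), e2 w v (fun h => hv h.2)]

end DAG

/-! ### Moral orientations of undirected graphs -/

/-- `O` is an acyclic orientation, with topological numbering `r`, in which any two parents of a
vertex are adjacent. The underlying undirected graph of `O` is chordal, and every chordal graph
has such an orientation. -/
structure IsMoral {V : Type*} (O : V → V → Prop) (r : V → ℤ) : Prop where
  rank_lt : ∀ a b, O a b → r a < r b
  moral : ∀ a b c, O a c → O b c → a ≠ b → O a b ∨ O b a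

namespace IsMoral

variable {V : Type*} {O : V → V → Prop} {r : V → ℤ}

theorem asymm (h : IsMoral O r) {a b : V} (hab : O a b) : ¬ O b a := fun hba =>
  lt_asymm (h.rank_lt _ _ hab) (h.rank_lt _ _ hba)

/-- Every vertex with a parent has a last parent `p v`, and all other parents of `v` are parents
of `p v`. A vertex `v` without parents gets `p v = v`. -/
theorem exists_lastParent [Finite V] (h : IsMoral O r) :
    ∃ p : V → V, (∀ v a, O a v → O (p v) v) ∧ (∀ v a, O a v → a ≠ p v → O a (p v)) ∧
      ∀ v, (∀ a, ¬ O a v) → p v = v := by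
  have : ∀ v, ∃ q, (∀ a, O a v → O q v) ∧ (∀ a, O a v → a ≠ q → O a q) ∧
      ((∀ a, ¬ O a v) → q = v) := by
    intro v
    by_cases hv : ∃ a, O a v
    · obtain ⟨q, hq, hmax⟩ := Set.exists_max_image {a | O a v} r (Set.toFinite _) hv
      refine ⟨q, fun _ _ => hq, fun a ha hne => ?_, fun hv' => absurd hq (hv' q)⟩
      rcases h.moral a q v ha hq hne with h' | h'
      · exact h'
      · exact absurd (h.rank_lt _ _ h') (not_lt.2 (hmax a ha))
    · exact ⟨v, fun a ha => absurd ⟨a, ha⟩ hv, fun a ha => absurd ⟨a, ha⟩ hv, fun _ => rfl⟩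
  choose p hp using this
  exact ⟨p, fun v => (hp v).1, fun v => (hp v).2.1, fun v => (hp v).2.2⟩

/-- Going up through last parents ends in a vertex without parents. -/
theorem exists_iterate_root [Finite V] (h : IsMoral O r) {p : V → V}
    (hp : ∀ v a, O a v → O (p v) v) (v : V) : ∃ k, ∀ a, ¬ O a (p^[k] v) := by
  by_contra! hc
  have hlt : ∀ k, r (p^[k + 1] v) < r (p^[k] v) := fun k => by
    obtain ⟨a, ha⟩ := hc k
    rw [Function.iterate_succ_apply']
    exact h.rank_lt _ _ (hp _ a ha)
  have hinj : Function.Injective fun k => r (p^[k] v) := (strictAnti_nat_of_succ_lt hlt).injective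
  exact not_injective_infinite_finite (fun k : ℕ => p^[k] v) fun a b hab => hinj (by simp_all)

theorem rank_iterate_le (h : IsMoral O r) {p : V → V}
    (hp : ∀ v a, O a v → O (p v) v) (hp0 : ∀ v, (∀ a, ¬ O a v) → p v = v) (v : V) {i j : ℕ}
    (hij : i ≤ j) : r (p^[j] v) ≤ r (p^[i] v) := by
  induction hij with
  | refl => exact le_rfl
  | @step m _ ih =>
    refine le_trans ?_ ih
    rw [Function.iterate_succ_apply']
    by_cases hr : ∃ a, O a (p^[m] v)
    · exact (h.rank_lt _ _ (hp _ _ hr.choose_spec)).le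
    · rw [hp0 _ (not_exists.1 hr)]

/-- An edge of a moral orientation can be reversed: some moral orientation of the same graph has
`v → u`.

View a vertex `a` as the subtree of `a` and its children in the tree of last parents; two vertices
are adjacent just if their subtrees meet. Taking `v` as the new root of the tree orders the
subtrees anew, by the distance of their tops from the root, and this order is again moral. The
value `κ a` is that distance if the subtree of `a` meets the path `p^[k] v` from `v` to the old
root, and `⊤` if it does not, in which case the old order can be kept. -/
theorem exists_reversal [Finite V] (h : IsMoral O r) {u v : V} (huv : O u v) :
    ∃ (N : V → V → Prop) (key : V → WithTop ℕ ×ₗ ℤ), (∀ a b, (N a b ∨ N b a) ↔ (O a b ∨ O b a)) ∧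
      (∀ a b, N a b → key a < key b) ∧
      (∀ a b c, N a c → N b c → a ≠ b → O a b ∨ O b a) ∧ N v u := by
  classical
  obtain ⟨p, hp1, hp2, hp0⟩ := h.exists_lastParent
  set y : ℕ → V := fun k => p^[k] v with hy
  have hysucc : ∀ k, y (k + 1) = p (y k) := fun k => Function.iterate_succ_apply' p k v
  have hle : ∀ {i j}, i ≤ j → r (y j) ≤ r (y i) := fun hij => h.rank_iterate_le hp1 hp0 v hij
  let T : V → ℕ → Prop := fun a k => a = y k ∨ O a (y k)
  have hstep : ∀ a k, T a k → a ≠ y k → T a (k + 1) := by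
    intro a k hT hne
    have hO := hT.resolve_left hne
    by_cases he : a = p (y k)
    · exact Or.inl (by rw [hysucc, he])
    · exact Or.inr (by rw [hysucc]; exact hp2 _ a hO he)
  have hto : ∀ a j i, j ≤ i → T a j → T a i ∨ ∃ l, j ≤ l ∧ l < i ∧ a = y l := by
    intro a j i hji hT
    induction hji with
    | refl => exact Or.inl hT
    | @step m hm ih =>
      rcases ih with ih | ⟨l, h1, h2, h3⟩
      · by_cases he : a = y m
        · exact Or.inr ⟨m, hm, Nat.lt_succ_self m, he⟩
        · exact Or.inl (hstep a m ih he)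
      · exact Or.inr ⟨l, h1, h2.trans (Nat.lt_succ_self m), h3⟩
  have hend : ∀ a j, T a j → ∃ l, a = y l := by
    intro a j hT
    obtain ⟨k, hk⟩ := h.exists_iterate_root hp1 v
    rcases le_total j k with hjk | hkj
    · rcases hto a j k hjk hT with hT' | ⟨l, -, -, hl⟩
      · exact ⟨k, hT'.resolve_right (hk a)⟩
      · exact ⟨l, hl⟩
    · -- Past the root the path is constant.
      have hconst : y j = y k := by
        induction hkj with
        | refl => rfl
        | @step m hm ih =>
          have : ∀ i, k ≤ i → y i = y k := by
            intro i hi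
            induction hi with
            | refl => rfl
            | @step i _ ihi => rw [hysucc, ihi]; exact hp0 _ hk
          exact this _ (Nat.le_succ_of_le hm)
      refine ⟨k, ?_⟩
      rcases hT with hT | hT
      · rw [hT, hconst]
      · rw [hconst] at hT; exact absurd hT (hk a)
  let κ : V → WithTop ℕ := fun a => if ha : ∃ k, T a k then WithTop.some (Nat.find ha) else ⊤
  have hκtop : ∀ a, κ a = ⊤ ↔ ¬ ∃ k, T a k := by
    intro a
    by_cases ha : ∃ k, T a k
    · simp only [κ, dif_pos ha, ha, not_true_eq_false, iff_false]
      exact WithTop.coe_ne_top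
    · simp only [κ, dif_neg ha, ha, not_false_eq_true]
  have hκ : ∀ a i, κ a = WithTop.some i → T a i ∧ ∀ j < i, ¬ T a j := by
    intro a i hi
    by_cases ha : ∃ k, T a k
    · simp only [κ, dif_pos ha] at hi
      have hi' : Nat.find ha = i := WithTop.coe_injective hi
      exact ⟨hi' ▸ Nat.find_spec ha, fun j hj => Nat.find_min ha (hi' ▸ hj)⟩
    · simp only [κ, dif_neg ha] at hi
      exact absurd hi.symm WithTop.coe_ne_top
  -- Along the path, the subtree of an earlier neighbour contains the top of a later one.
  have hmeet : ∀ a c i, (O a c ∨ O c a) → κ c = WithTop.some i → κ a ≤ κ c → T a i := by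
    intro a c i hac hc hle'
    obtain ⟨hTc, hmin⟩ := hκ c i hc
    rw [hc] at hle'
    obtain ⟨j, hj⟩ := WithTop.ne_top_iff_exists.1 (ne_top_of_le_ne_top WithTop.coe_ne_top hle')
    obtain ⟨hTa, -⟩ := hκ a j hj.symm
    have hji : j ≤ i := by rw [← hj] at hle'; exact WithTop.coe_le_coe.1 hle'
    rcases hto a j i hji hTa with hT | ⟨l, -, hl, rfl⟩
    · exact hT
    · rcases hac with hac | hca
      · have h1 := h.rank_lt _ _ hac
        have h2 := hle hl.le
        rcases hTc with rfl | hTc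
        · exact absurd h1 (not_lt.2 h2)
        · exact absurd (h1.trans (h.rank_lt _ _ hTc)) (not_lt.2 h2)
      · exact absurd (Or.inr hca) (hmin l hl)
  have hfirst : ∀ a c, (O a c ∨ O c a) → κ c = ⊤ → κ a ≠ ⊤ → O a c := by
    intro a c hac hc ha
    rcases hac with hac | hca
    · exact hac
    · rw [hκtop] at hc
      rw [Ne, hκtop, not_not] at ha
      obtain ⟨j, hj⟩ := ha
      obtain ⟨l, rfl⟩ := hend a j hj
      exact absurd ⟨l, Or.inr hca⟩ hc
  let key : V → WithTop ℕ ×ₗ ℤ := fun a => toLex (κ a, if κ a = ⊤ then r a else - r a)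
  have hkey : ∀ a b, key a < key b ↔ κ a < κ b ∨ (κ a = κ b ∧
      (if κ a = ⊤ then r a else - r a) < if κ b = ⊤ then r b else - r b) := by
    intro a b
    simp only [key, Prod.Lex.toLex_lt_toLex]
  have hkle : ∀ a b, key a < key b → κ a ≤ κ b := by
    intro a b hab
    rcases (hkey a b).1 hab with h' | h'
    · exact h'.le
    · exact h'.1.le
  refine ⟨fun a b => (O a b ∨ O b a) ∧ key a < key b, key, ?_, fun a b hab => hab.2, ?_, ?_⟩
  · intro a b
    constructor
    · rintro (h' | h')
      · exact h'.1
      · exact h'.1.symm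
    · intro hab
      have hne : key a ≠ key b := by
        intro he
        have he' : κ a = κ b ∧ (if κ a = ⊤ then r a else - r a) =
            if κ b = ⊤ then r b else - r b := by
          have := congrArg ofLex he
          simpa [key] using this
        have hrne : r a ≠ r b := by
          rcases hab with hab | hab
          · exact (h.rank_lt _ _ hab).ne
          · exact (h.rank_lt _ _ hab).ne'
        obtain ⟨he1, he2⟩ := he'
        rw [he1] at he2
        split_ifs at he2
        · exact hrne he2
        · exact hrne (neg_injective he2)
      rcases lt_or_gt_of_ne hne with h' | h'
      · exact Or.inl ⟨hab, h'⟩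
      · exact Or.inr ⟨hab.symm, h'⟩
  · rintro a b c ⟨hac, kac⟩ ⟨hbc, kbc⟩ hne
    by_cases hc : κ c = ⊤
    · have harc : ∀ a, (O a c ∨ O c a) → key a < key c → O a c := by
        intro a hac kac
        by_cases ha : κ a = ⊤
        · rcases hac with hac | hca
          · exact hac
          · rw [hkey, ha, hc] at kac
            simp only [lt_self_iff_false, if_true, true_and, false_or] at kac
            exact absurd (h.rank_lt _ _ hca) (not_lt.2 kac.le)
        · exact hfirst a c hac hc ha
      exact h.moral a b c (harc a hac kac) (harc b hbc kbc) hne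
    · obtain ⟨i, hi⟩ := WithTop.ne_top_iff_exists.1 hc
      have ha := hmeet a c i hac hi.symm (hkle _ _ kac)
      have hb := hmeet b c i hbc hi.symm (hkle _ _ kbc)
      rcases ha with rfl | ha <;> rcases hb with rfl | hb
      · exact absurd rfl hne
      · exact Or.inr hb
      · exact Or.inl ha
      · exact h.moral a b _ ha hb hne
  · refine ⟨Or.inr huv, ?_⟩
    have hκ0 : ∀ a, T a 0 → κ a = WithTop.some 0 := by
      intro a ha
      have hex : ∃ k, T a k := ⟨0, ha⟩
      simp only [κ, dif_pos hex]
      congr 1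
      exact (Nat.find_eq_zero hex).2 ha
    have hv := hκ0 v (Or.inl rfl)
    have hu := hκ0 u (Or.inr huv)
    rw [hkey, hv, hu]
    right
    refine ⟨rfl, ?_⟩
    rw [if_neg WithTop.coe_ne_top, if_neg WithTop.coe_ne_top]
    exact neg_lt_neg (h.rank_lt _ _ huv)

end IsMoral

/-! ### Essential graphs are the closures under Meek's rules -/

namespace DAG

variable {V : Type*}

/-- The adjacency `u - v` of `G` is left undirected by the set `D` of directed arcs. -/
def Undirected (G : DAG V) (D : V → V → Prop) (u v : V) : Prop :=
  G.skel u v ∧ ¬ D u v ∧ ¬ D v u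

theorem Undirected.symm {G : DAG V} {D : V → V → Prop} {u v : V} (h : G.Undirected D u v) :
    G.Undirected D v u := ⟨h.1.symm, h.2.2, h.2.1⟩

/-- A set `D` of arcs of `G` that contains the v-structures, and whose undirected components have
the same `D`-parents at all their vertices. -/
structure ChainClosed (G : DAG V) (D : V → V → Prop) : Prop where
  sub : ∀ u v, D u v → G.arc u v
  vstr : ∀ u v w, G.VStructure u v w → D u v
  chain : ∀ x u v, D x u → G.Undirected D u v → D x v

namespace ChainClosed

variable {G : DAG V} {D : V → V → Prop}

theorem chain_path (h : ChainClosed G D) {x u v : V}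
    (huv : Relation.ReflTransGen (G.Undirected D) u v) (hx : D x u) : D x v := by
  induction huv with
  | refl => exact hx
  | tail _ h' ih => exact h.chain _ _ _ ih h'

theorem path_symm {u v : V} (huv : Relation.ReflTransGen (G.Undirected D) u v) :
    Relation.ReflTransGen (G.Undirected D) v u := by
  induction huv with
  | refl => exact .refl
  | tail _ h ih => exact .head h.symm ih

/-- Two adjacent vertices of one undirected component are joined by an undirected edge. -/
theorem undirected_of_path (h : ChainClosed G D) {u v : V}
    (huv : Relation.ReflTransGen (G.Undirected D) u v) (hs : G.skel u v) : G.Undirected D u v :=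
  ⟨hs, fun hD => G.asymm (h.sub _ _ (h.chain_path (path_symm huv) hD))
      (h.sub _ _ (h.chain_path (path_symm huv) hD)),
    fun hD => G.asymm (h.sub _ _ (h.chain_path huv hD)) (h.sub _ _ (h.chain_path huv hD))⟩

/-- The undirected edges, oriented as in `G`, form a moral orientation. -/
theorem isMoral (h : ChainClosed G D) {r : V → ℤ} (hr : ∀ u v, G.arc u v → r u < r v) :
    IsMoral (fun u v => G.arc u v ∧ G.Undirected D u v) r where
  rank_lt a b hab := hr a b hab.1
  moral := by
    rintro a b c ⟨hac, hac'⟩ ⟨hbc, hbc'⟩ hne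
    have hs : G.skel a b := by
      by_contra hs
      exact hac'.2.1 (h.vstr a c b ⟨hne, hac, hbc, hs⟩)
    have hu := h.undirected_of_path (.tail (.single hac') hbc'.symm) hs
    rcases hs with hs | hs
    · exact Or.inl ⟨hs, hu⟩
    · exact Or.inr ⟨hs, hu.symm⟩

/-- If moreover `D` contains all arcs that are cut by the interventions, then every undirected edge
is reversed in some equivalent graph. -/
theorem exists_equiv_reversed [Finite V] {𝓘 : Set (Set V)} (h : ChainClosed G D)
    (hcut : ∀ u v, Cut 𝓘 u v → G.arc u v → D u v) {u v : V} (huv : G.arc u v)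
    (hD : G.Undirected D u v) : ∃ G', InterventionEquiv 𝓘 G G' ∧ G'.arc v u := by
  obtain ⟨r, hr⟩ := G.exists_rank
  obtain ⟨N, key, hN, hkey, hmor, hvu⟩ := (h.isMoral hr).exists_reversal ⟨huv, hD⟩
  have hund : ∀ a b, (N a b ∨ N b a) ↔ G.Undirected D a b := by
    intro a b
    rw [hN]
    constructor
    · rintro (h' | h')
      · exact h'.2
      · exact h'.2.symm
    · intro h'
      rcases h'.1 with h'' | h''
      · exact Or.inl ⟨h'', h'⟩
      · exact Or.inr ⟨h'', h'.symm⟩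
  let H : Set V := {x | Relation.ReflTransGen (G.Undirected D) v x}
  have hHH : ∀ a ∈ H, ∀ b ∈ H, Relation.ReflTransGen (G.Undirected D) a b :=
    fun a ha b hb => (path_symm ha).trans hb
  obtain ⟨G', hM, h1, h2⟩ := exists_reorientation G H N key
    (by
      intro x hx a ha b hb hxa
      have hxa' : D x a := by
        by_contra hc
        refine hx (Relation.ReflTransGen.tail ha ⟨Or.inr hxa, fun hc' => ?_, hc⟩)
        exact G.asymm hxa (h.sub _ _ hc')
      exact h.sub _ _ (h.chain_path (hHH a ha b hb) hxa'))
    (by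
      intro a ha b hb
      rw [hund]
      exact ⟨fun h' => h'.1, h.undirected_of_path (hHH a ha b hb)⟩)
    hkey
    (by
      intro a _ b _ c _ hne hac hbc
      rcases hmor a b c hac hbc hne with h' | h'
      · exact Or.inl h'.1
      · exact Or.inr h'.1)
    (by
      intro a ha b hb c hc hne hac hbc
      by_contra hs
      exact (h.undirected_of_path (hHH a ha c hc) (Or.inl hac)).2.1
        (h.vstr a c b ⟨hne, hac, hbc, hs⟩))
  refine ⟨G', interventionEquiv_iff.2 ⟨hM, fun a b hab hab' => ?_⟩, ?_⟩
  · rw [h2 a b]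
    · exact hab'
    · rintro ⟨ha, hb⟩
      exact (h.undirected_of_path (hHH a ha b hb) (Or.inl hab')).2.1 (hcut a b hab hab')
  · exact (h1 v .refl u (.single hD.symm)).2 hvu

/-- A sound set of this kind is the set of arcs of the essential graph. -/
theorem arcs_iff [Finite V] {𝓘 : Set (Set V)} (h : ChainClosed G D)
    (hcut : ∀ u v, Cut 𝓘 u v → G.arc u v → D u v)
    (hsound : ∀ u v, D u v → (G.essential 𝓘).arcs u v) (u v : V) :
    (G.essential 𝓘).arcs u v ↔ D u v := by
  refine ⟨fun ha => ?_, hsound u v⟩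
  by_contra hc
  have huv : G.arc u v := ha G (InterventionEquiv.refl 𝓘 G)
  obtain ⟨G', hG', hvu⟩ := h.exists_equiv_reversed hcut huv
    ⟨Or.inl huv, hc, fun h' => G.asymm huv (h.sub _ _ h')⟩
  exact G'.asymm hvu (ha G' hG')

end ChainClosed

/-- The closure of the v-structures of `G` under Meek's first three rules. The fourth rule matters
only with background knowledge. In the third rule, `x - a` and `x - b` may have any orientation
that does not make `a → x ← b` a v-structure. -/
inductive Meek (G : DAG V) : V → V → Prop
  | vstr {x u y : V} : G.VStructure x u y → Meek G x u
  | rule1 {y x u : V} : Meek G y x → ¬ G.skel y u → y ≠ u → G.arc x u → Meek G x u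
  | rule2 {x w u : V} : Meek G x w → Meek G w u → G.arc x u → Meek G x u
  | rule3 {a b x u : V} : Meek G a u → Meek G b u → a ≠ b → ¬ G.skel a b → G.skel x a →
      G.skel x b → ¬ (G.arc a x ∧ G.arc b x) → G.arc x u → Meek G x u

theorem Meek.arc {G : DAG V} {x u : V} (h : Meek G x u) : G.arc x u := by
  cases h with
  | vstr h => exact h.2.1
  | rule1 _ _ _ h => exact h
  | rule2 _ _ h => exact h
  | rule3 _ _ _ _ _ _ _ h => exact h

theorem arc_of_not_arc {G G' : DAG V} (hM : G.MarkovEquiv G') {u v : V} (h : G.arc u v)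
    (h' : ¬ G'.arc v u) : G'.arc u v :=
  ((hM.1 u v).1 (Or.inl h)).resolve_right h'

theorem arc_of_path {G G' : DAG V} (hM : G.MarkovEquiv G') {u v w : V} (h : G.arc u v)
    (h1 : G'.arc u w) (h2 : G'.arc w v) : G'.arc u v :=
  arc_of_not_arc hM h (G'.not_three_cycle h1 h2)

theorem rule1_sound {G G' : DAG V} (hM : G.MarkovEquiv G') {y x u : V} (h : G'.arc y x)
    (hs : ¬ G.skel y u) (hne : y ≠ u) (hxu : G.arc x u) : G'.arc x u :=
  arc_of_not_arc hM hxu fun h' =>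
    G.asymm hxu ((hM.2 y x u).2 ⟨hne, h, h', fun h'' => hs ((hM.1 y u).2 h'')⟩).2.2.1

theorem Meek.sound {G G' : DAG V} (hM : G.MarkovEquiv G') {x u : V} (h : Meek G x u) :
    G'.arc x u := by
  induction h with
  | vstr h => exact ((hM.2 _ _ _).1 h).2.1
  | rule1 _ hs hne hxu ih => exact rule1_sound hM ih hs hne hxu
  | rule2 _ _ hxu ih1 ih2 => exact arc_of_path hM hxu ih1 ih2
  | @rule3 a b x u _ _ hne hs hxa hxb hnc hxu ih1 ih2 =>
    refine arc_of_not_arc hM hxu fun hux => hnc ?_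
    have h1 : G'.arc a x := ((hM.1 x a).1 hxa).resolve_left fun h => G'.not_three_cycle h ih1 hux
    have h2 : G'.arc b x := ((hM.1 x b).1 hxb).resolve_left fun h => G'.not_three_cycle h ih2 hux
    have := (hM.2 a x b).2 ⟨hne, h1, h2, fun h => hs ((hM.1 a b).2 h)⟩
    exact ⟨this.2.1, this.2.2.1⟩

/-- For a set `D` of arcs closed under the first two rules: of the ends of an undirected edge
`u - v`, every `D`-parent of `u` is either a `D`-parent or an undirected neighbour of `v`. -/
theorem parent_or_undirected {G : DAG V} {D : V → V → Prop} (hsub : ∀ u v, D u v → G.arc u v)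
    (hvs : ∀ u v w, G.VStructure u v w → D u v)
    (h1 : ∀ y x u, D y x → ¬ G.skel y u → y ≠ u → G.arc x u → D x u)
    (h2 : ∀ x w u, D x w → D w u → G.arc x u → D x u)
    {x u v : V} (hx : D x u) (hu : G.Undirected D u v) : D x v ∨ G.Undirected D x v := by
  have hne : x ≠ v := by
    rintro rfl
    exact hu.2.2 hx
  have hs : G.skel x v := by
    by_contra hs
    rcases hu.1 with h | h
    · exact hu.2.1 (h1 x u v hx hs hne h)
    · exact hu.2.2 (hvs v u x ⟨hne.symm, h, hsub _ _ hx, fun h' => hs h'.symm⟩)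
  by_cases h : D x v
  · exact Or.inl h
  · refine Or.inr ⟨hs, h, fun hvx => hu.2.2 (h2 v x u hvx hx ?_)⟩
    rcases hu.1 with h' | h'
    · exact absurd h' (G.not_three_cycle (hsub _ _ hvx) (hsub _ _ hx))
    · exact h'

theorem Meek.chainClosed (G : DAG V) : ChainClosed G (Meek G) where
  sub _ _ h := h.arc
  vstr _ _ _ h := .vstr h
  chain := by
    have pre : ∀ {x u v : V}, Meek G x u → G.Undirected (Meek G) u v →
        Meek G x v ∨ G.Undirected (Meek G) x v :=
      parent_or_undirected (fun _ _ h => h.arc) (fun _ _ _ h => .vstr h)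
        (fun _ _ _ => .rule1) fun _ _ _ => .rule2
    intro x u v hx
    induction hx generalizing v with
    | @vstr x u y h =>
      intro hu
      have hxu : Meek G x u := .vstr h
      have hyu : Meek G y u := .vstr ⟨h.1.symm, h.2.2.1, h.2.1, fun h' => h.2.2.2 h'.symm⟩
      refine (pre hxu hu).resolve_right fun hxv => ?_
      rcases pre hyu hu with hyv | hyv
      · rcases pre hyv hxv.symm with h' | h'
        · exact h.2.2.2 (Or.inr h'.arc)
        · exact h.2.2.2 h'.1.symm
      · have hnc : ¬ (G.arc x v ∧ G.arc y v) := fun hc =>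
          hxv.2.1 (.vstr ⟨h.1, hc.1, hc.2, h.2.2.2⟩)
        rcases hu.1 with huv | hvu
        · refine hnc ⟨hxv.1.resolve_right ?_, hyv.1.resolve_right ?_⟩
          · exact fun h' => G.not_three_cycle huv h' h.2.1
          · exact fun h' => G.not_three_cycle huv h' h.2.2.1
        · exact hu.2.2 (.rule3 hxu hyu h.1 h.2.2.2 hxv.1.symm hyv.1.symm hnc hvu)
    | @rule1 y x u h hs hne hxu ih =>
      intro hu
      refine (pre (.rule1 h hs hne hxu) hu).resolve_right fun hxv => ?_
      rcases pre (ih v hxv) hu.symm with h' | h'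
      · exact hs (Or.inl h'.arc)
      · exact hs h'.1
    | @rule2 x w u h h' hxu ih ih' =>
      intro hu
      refine (pre (.rule2 h h' hxu) hu).resolve_right fun hxv => hxv.2.1 ?_
      have hwv := ih' v hu
      refine .rule2 h hwv (hxv.1.resolve_right fun hvx => ?_)
      exact G.not_three_cycle h.arc hwv.arc hvx
    | @rule3 a b x u ha hb hne hs hxa hxb hnc hxu iha ihb =>
      intro hu
      refine (pre (.rule3 ha hb hne hs hxa hxb hnc hxu) hu).resolve_right fun hxv => hxv.2.1 ?_
      have hav := iha v hu
      have hbv := ihb v hu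
      refine .rule3 hav hbv hne hs hxa hxb hnc (hxv.1.resolve_right fun hvx => hnc ⟨?_, ?_⟩)
      · exact hxa.resolve_left fun h => G.not_three_cycle h hav.arc hvx
      · exact hxb.resolve_left fun h => G.not_three_cycle h hbv.arc hvx

theorem not_cut_empty (u v : V) : ¬ Cut ∅ u v := fun ⟨_, h, _⟩ => h

theorem essential_empty_arcs_iff [Finite V] (G : DAG V) (u v : V) :
    (G.essential ∅).arcs u v ↔ Meek G u v :=
  (Meek.chainClosed G).arcs_iff (fun a b h => absurd h (not_cut_empty a b))
    (fun _ _ h _ hG' => h.sound hG'.1) u v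

/-- The closure of the observationally compelled arcs and the arcs cut by interventions under the
first two of Meek's rules. The third rule would add nothing: its premises `a → u ← b` form a
v-structure, so that its conclusion is compelled by the skeleton and the v-structures alone. -/
inductive InterventionMeek (𝓘 : Set (Set V)) (G : DAG V) : V → V → Prop
  | base {u v : V} : (G.essential ∅).arcs u v → InterventionMeek 𝓘 G u v
  | cut {u v : V} : Cut 𝓘 u v → G.arc u v → InterventionMeek 𝓘 G u v
  | rule1 {y x u : V} : InterventionMeek 𝓘 G y x → ¬ G.skel y u → y ≠ u → G.arc x u →
      InterventionMeek 𝓘 G x u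
  | rule2 {x w u : V} : InterventionMeek 𝓘 G x w → InterventionMeek 𝓘 G w u → G.arc x u →
      InterventionMeek 𝓘 G x u

theorem InterventionEquiv.mono {𝓘 𝓙 : Set (Set V)} (h : 𝓘 ⊆ 𝓙) {G G' : DAG V}
    (hG : InterventionEquiv 𝓙 G G') : InterventionEquiv 𝓘 G G' :=
  ⟨hG.1, fun S hS => hG.2 S (h hS)⟩

theorem InterventionMeek.sound {𝓘 : Set (Set V)} {G : DAG V} {u v : V}
    (h : InterventionMeek 𝓘 G u v) : (G.essential 𝓘).arcs u v := by
  intro G' hG'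
  induction h with
  | base h => exact h G' (hG'.mono (Set.empty_subset _))
  | cut hc h => exact (interventionEquiv_iff.1 hG').2 _ _ hc h
  | rule1 _ hs hne hxu ih => exact rule1_sound hG'.1 ih hs hne hxu
  | rule2 _ _ hxu ih1 ih2 => exact arc_of_path hG'.1 hxu ih1 ih2

theorem InterventionMeek.chainClosed [Finite V] (𝓘 : Set (Set V)) (G : DAG V) :
    ChainClosed G (InterventionMeek 𝓘 G) := by
  have hsub : ∀ u v, InterventionMeek 𝓘 G u v → G.arc u v := fun u v h =>
    h.sound G (InterventionEquiv.refl 𝓘 G)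
  have hvs : ∀ u v w, G.VStructure u v w → InterventionMeek 𝓘 G u v := fun u v w h =>
    .base ((essential_empty_arcs_iff G u v).2 (.vstr h))
  refine ⟨hsub, hvs, ?_⟩
  have pre : ∀ {x u v : V}, InterventionMeek 𝓘 G x u → G.Undirected (InterventionMeek 𝓘 G) u v →
      InterventionMeek 𝓘 G x v ∨ G.Undirected (InterventionMeek 𝓘 G) x v :=
    parent_or_undirected hsub hvs (fun _ _ _ => .rule1) fun _ _ _ => .rule2
  have hnc : ∀ {u v : V}, G.Undirected (InterventionMeek 𝓘 G) u v → ¬ Cut 𝓘 u v := by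
    intro u v h hc
    rcases h.1 with h' | h'
    · exact h.2.1 (.cut hc h')
    · exact h.2.2 (.cut (cut_symm hc) h')
  intro x u v hx
  induction hx generalizing v with
  | @base x u h =>
    intro hu
    refine .base ((essential_empty_arcs_iff G x v).2 ?_)
    exact (Meek.chainClosed G).chain x u v ((essential_empty_arcs_iff G x u).1 h)
      ⟨hu.1, fun h' => hu.2.1 (.base ((essential_empty_arcs_iff G u v).2 h')),
        fun h' => hu.2.2 (.base ((essential_empty_arcs_iff G v u).2 h'))⟩
  | @cut x u hc h =>
    intro hu
    refine (pre (.cut hc h) hu).resolve_right fun hxv => ?_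
    obtain ⟨S, hS, hc⟩ := hc
    by_cases hv : v ∈ S
    · rcases hc with hc | hc
      · exact hnc hu ⟨S, hS, Or.inr ⟨hc.2, hv⟩⟩
      · exact hnc hxv ⟨S, hS, Or.inr ⟨hc.1, hv⟩⟩
    · rcases hc with hc | hc
      · exact hnc hxv ⟨S, hS, Or.inl ⟨hc.1, hv⟩⟩
      · exact hnc hu ⟨S, hS, Or.inl ⟨hc.2, hv⟩⟩
  | @rule1 y x u h hs hne hxu ih =>
    intro hu
    refine (pre (.rule1 h hs hne hxu) hu).resolve_right fun hxv => ?_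
    rcases pre (ih v hxv) hu.symm with h' | h'
    · exact hs (Or.inl (hsub _ _ h'))
    · exact hs h'.1
  | @rule2 x w u h h' hxu ih ih' =>
    intro hu
    refine (pre (.rule2 h h' hxu) hu).resolve_right fun hxv => hxv.2.1 ?_
    have hwv := ih' v hu
    refine .rule2 h hwv (hxv.1.resolve_right fun hvx => ?_)
    exact G.not_three_cycle (hsub _ _ h) (hsub _ _ hwv) hvx

theorem essential_arcs_iff [Finite V] (𝓘 : Set (Set V)) (G : DAG V) (u v : V) :
    (G.essential 𝓘).arcs u v ↔ InterventionMeek 𝓘 G u v :=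
  (InterventionMeek.chainClosed 𝓘 G).arcs_iff (fun _ _ => .cut) (fun _ _ h => h.sound) u v

theorem essential_chainClosed [Finite V] (𝓘 : Set (Set V)) (G : DAG V) :
    ChainClosed G (G.essential 𝓘).arcs := by
  have : (G.essential 𝓘).arcs = InterventionMeek 𝓘 G := by
    ext u v; exact essential_arcs_iff 𝓘 G u v
  rw [this]
  exact InterventionMeek.chainClosed 𝓘 G

theorem essential_adj_iff (𝓘 : Set (Set V)) (G : DAG V) (u v : V) :
    (G.essential 𝓘).edges.Adj u v ↔ G.Undirected (G.essential 𝓘).arcs u v := by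
  constructor
  · rintro ⟨⟨G₁, h1, h1'⟩, ⟨G₂, h2, h2'⟩⟩
    exact ⟨(h1.1.1 u v).2 (Or.inl h1'), fun h => G₂.asymm h2' (h G₂ h2),
      fun h => G₁.asymm h1' (h G₁ h1)⟩
  · rintro ⟨hs, h1, h2⟩
    have key : ∀ {a b : V}, G.skel a b → ¬ (G.essential 𝓘).arcs a b →
        ∃ G', InterventionEquiv 𝓘 G G' ∧ G'.arc b a := by
      intro a b hs h
      by_contra! hc
      exact h fun G' hG' => ((hG'.1.1 a b).1 hs).resolve_right (hc G' hG')
    exact ⟨key hs.symm h2, key hs h1⟩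

/-- The unoriented part of an essential graph, with the orientation of `G`. -/
def residual (𝓘 : Set (Set V)) (G : DAG V) (u v : V) : Prop :=
  G.arc u v ∧ (G.essential 𝓘).edges.Adj u v

theorem adj_iff_residual (𝓘 : Set (Set V)) (G : DAG V) (u v : V) :
    (G.essential 𝓘).edges.Adj u v ↔ G.residual 𝓘 u v ∨ G.residual 𝓘 v u := by
  constructor
  · intro h
    rcases ((essential_adj_iff 𝓘 G u v).1 h).1 with h' | h'
    · exact Or.inl ⟨h', h⟩
    · exact Or.inr ⟨h', h.symm⟩
  · rintro (h | h)
    · exact h.2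
    · exact h.2.symm

theorem residual_isMoral [Finite V] (𝓘 : Set (Set V)) (G : DAG V) {r : V → ℤ}
    (hr : ∀ u v, G.arc u v → r u < r v) : IsMoral (G.residual 𝓘) r := by
  have := (essential_chainClosed 𝓘 G).isMoral hr
  simp only [← essential_adj_iff] at this
  exact this

theorem not_adj_of_cut {𝓘 : Set (Set V)} {G : DAG V} {u v : V} (hc : Cut 𝓘 u v) :
    ¬ (G.essential 𝓘).edges.Adj u v := by
  intro h
  obtain ⟨hs, h1, h2⟩ := (essential_adj_iff 𝓘 G u v).1 h
  rcases hs with h' | h'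
  · exact h1 (InterventionMeek.sound (.cut hc h'))
  · exact h2 (InterventionMeek.sound (.cut (cut_symm hc) h'))

theorem edges_mono {𝓘 𝓙 : Set (Set V)} (h : 𝓘 ⊆ 𝓙) (G : DAG V) :
    (G.essential 𝓙).edges ≤ (G.essential 𝓘).edges := by
  rintro u v ⟨⟨G₁, h1, h1'⟩, ⟨G₂, h2, h2'⟩⟩
  exact ⟨⟨G₁, h1.mono h, h1'⟩, ⟨G₂, h2.mono h, h2'⟩⟩

theorem isVerifying_iff {𝓘 : Set (Set V)} {G : DAG V} :
    IsVerifying 𝓘 G ↔ (G.essential 𝓘).edges = ⊥ := by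
  refine ⟨fun h => by rw [show G.essential 𝓘 = _ from h]; rfl, fun h => ?_⟩
  refine PDGraph.ext h ?_
  funext u v
  refine propext ⟨fun h' => h' G (InterventionEquiv.refl 𝓘 G), fun h' => ?_⟩
  by_contra hc
  have := (essential_adj_iff 𝓘 G u v).2
    ⟨Or.inl h', hc, fun h'' => G.asymm h' (h'' G (InterventionEquiv.refl 𝓘 G))⟩
  rw [h] at this
  exact this

end DAG

/-! ### Clique separators -/

namespace IsMoral

variable {V : Type*} {O : V → V → Prop} {r : V → ℤ}

/-- The descendants of `w` in the orientation `O`, with `w` itself. -/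
def desc (O : V → V → Prop) (w : V) : Set V := {a | Relation.ReflTransGen O w a}

/-- A parent of a descendant of `w` that is not itself a descendant of `w` is a parent of `w`. -/
theorem parent_of_desc (h : IsMoral O r) {w a b : V} (ha : a ∈ desc O w) (hb : b ∉ desc O w)
    (hba : O b a) : O b w := by
  change Relation.ReflTransGen O w a at ha
  induction ha with
  | refl => exact hba
  | @tail a' a ha' haa ih =>
    have hne : b ≠ a' := by
      rintro rfl
      exact hb ha'
    rcases h.moral b a' a hba haa hne with h' | h'
    · exact ih h'
    · exact absurd (Relation.ReflTransGen.tail ha' h') hb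

/-- Two vertices with a common descendant are comparable. -/
theorem comparable (h : IsMoral O r) [Finite V] {w w' a : V}
    (ha : a ∈ desc O w) (ha' : a ∈ desc O w') : w' ∈ desc O w ∨ w ∈ desc O w' := by
  have hwf : WellFounded fun a b => O a b :=
    Finite.wellFounded_of_trans_of_irrefl (fun a b => r a < r b) |>.mono fun a b => h.rank_lt a b
  induction a using hwf.induction with
  | _ a ih =>
    rcases Relation.ReflTransGen.cases_tail ha with rfl | ⟨b, hb, hba⟩
    · exact Or.inr ha'
    rcases Relation.ReflTransGen.cases_tail ha' with rfl | ⟨b', hb', hba'⟩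
    · exact Or.inl ha
    by_cases he : b = b'
    · subst he; exact ih b hba hb hb'
    rcases h.moral b b' a hba hba' he with h' | h'
    · exact ih b' hba' (Relation.ReflTransGen.tail hb h') hb'
    · exact ih b hba hb (Relation.ReflTransGen.tail hb' h')

/-- `w` is a centroid for the weight `m`: more than `m / 2` vertices descend from `w`, but at most
`m / 2` from each child of `w`. -/
def IsCentroid (O : V → V → Prop) (m : ℕ) (w : V) : Prop :=
  m < 2 * (desc O w).ncard ∧ ∀ c, O w c → 2 * (desc O c).ncard ≤ m

variable {U : SimpleGraph V} {H : U.ConnectedComponent}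

theorem desc_subset_supp (hU : ∀ a b, U.Adj a b ↔ O a b ∨ O b a) {w : V} (hw : w ∈ H.supp) :
    desc O w ⊆ H.supp := by
  intro a ha
  change Relation.ReflTransGen O w a at ha
  induction ha with
  | refl => exact hw
  | tail _ h ih => exact H.mem_supp_of_adj_mem_supp ih ((hU _ _).2 (Or.inl h))

/-- The last vertex with more than half of the component below it is a centroid. -/
theorem exists_centroid [Finite V] (h : IsMoral O r) (hU : ∀ a b, U.Adj a b ↔ O a b ∨ O b a)
    (H : U.ConnectedComponent) : ∃ w ∈ H.supp, IsCentroid O H.supp.ncard w := by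
  obtain ⟨x, hx, hmin⟩ := Set.exists_min_image H.supp r (Set.toFinite _) H.nonempty_supp
  -- The first vertex of the component has no parents, so that all others descend from it.
  have hroot : H.supp ⊆ desc O x := by
    intro y hy
    have hxy : U.Reachable x y := SimpleGraph.ConnectedComponent.exact
      (((H.mem_supp_iff x).1 hx).trans ((H.mem_supp_iff y).1 hy).symm)
    rw [SimpleGraph.reachable_iff_reflTransGen] at hxy
    clear hy
    induction hxy with
    | refl => exact .refl
    | @tail b c _ hbc ih =>
      rcases (hU b c).1 hbc with h' | h'
      · exact Relation.ReflTransGen.tail ih h'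
      · by_contra hc
        have hcx := h.parent_of_desc ih hc h'
        have hcH := H.mem_supp_of_adj_mem_supp hx ((hU x c).2 (Or.inr hcx))
        exact absurd (h.rank_lt _ _ hcx) (not_lt.2 (hmin c hcH))
  have hpos : 0 < H.supp.ncard := (Set.ncard_pos (Set.toFinite _)).2 H.nonempty_supp
  obtain ⟨w, ⟨hw, hw'⟩, hmax⟩ := Set.exists_max_image
    {w | w ∈ H.supp ∧ H.supp.ncard < 2 * (desc O w).ncard} r (Set.toFinite _)
    ⟨x, hx, by have := Set.ncard_le_ncard hroot (Set.toFinite _); omega⟩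
  refine ⟨w, hw, hw', fun c hc => ?_⟩
  by_contra hlt
  have hcH := H.mem_supp_of_adj_mem_supp hw ((hU w c).2 (Or.inl hc))
  exact absurd (h.rank_lt _ _ hc) (not_lt.2 (hmax c ⟨hcH, not_le.1 hlt⟩))

theorem centroid_unique [Finite V] (h : IsMoral O r) (hU : ∀ a b, U.Adj a b ↔ O a b ∨ O b a)
    {w w' : V}
    (hw : w ∈ H.supp) (hw' : w' ∈ H.supp) (hc : IsCentroid O H.supp.ncard w)
    (hc' : IsCentroid O H.supp.ncard w') : w = w' := by
  have aux : ∀ {w w' : V}, IsCentroid O H.supp.ncard w → IsCentroid O H.supp.ncard w' →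
      w' ∈ desc O w → w = w' := by
    intro w w' hc hc' hd
    rcases Relation.ReflTransGen.cases_head hd with h' | ⟨c, h1, h2⟩
    · exact h'
    · have hsub : desc O w' ⊆ desc O c := fun a ha => Relation.ReflTransGen.trans h2 ha
      have := Set.ncard_le_ncard hsub (Set.toFinite _)
      have := hc.2 c h1
      have := hc'.1
      omega
  have hmeet : (desc O w ∩ desc O w').Nonempty := by
    rw [Set.nonempty_iff_ne_empty]
    intro he
    have h1 := Set.ncard_union_eq (Set.disjoint_iff_inter_eq_empty.2 he) (Set.toFinite _)
      (Set.toFinite _)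
    have h2 := Set.ncard_le_ncard
      (Set.union_subset (desc_subset_supp hU hw) (desc_subset_supp hU hw')) (Set.toFinite _)
    have := hc.1
    have := hc'.1
    omega
  obtain ⟨a, ha, ha'⟩ := hmeet
  rcases h.comparable ha ha' with h' | h'
  · exact aux hc hc' h'
  · exact (aux hc' hc h').symm

/-- A centroid and its parents form a `1/2`-clique separator: a component that is left either
contains no descendant of the centroid, or consists of descendants of one of its children. -/
theorem isHalfCliqueSeparator [Finite V] (h : IsMoral O r) (hU : ∀ a b, U.Adj a b ↔ O a b ∨ O b a)
    {w : V} (hw : w ∈ H.supp) (hc : IsCentroid O H.supp.ncard w) :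
    IsHalfCliqueSeparator U H.supp {x | x = w ∨ O x w} := by
  refine ⟨?_, ?_, fun D => ?_⟩
  · rintro x (rfl | hx)
    · exact hw
    · exact H.mem_supp_of_adj_mem_supp hw ((hU w x).2 (Or.inr hx))
  · rintro x (rfl | hx) y (rfl | hy) hne
    · exact absurd rfl hne
    · exact (hU _ _).2 (Or.inr hy)
    · exact (hU _ _).2 (Or.inl hx)
    · exact (hU _ _).2 (h.moral x y w hx hy hne)
  rw [← Set.ncard_image_of_injective D.supp Subtype.val_injective]
  by_cases hD : ∃ a ∈ D.supp, a.1 ∈ desc O w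
  · obtain ⟨a, haD, ha⟩ := hD
    have hne : ∃ c, O w c ∧ a.1 ∈ desc O c := by
      rcases Relation.ReflTransGen.cases_head ha with h' | h'
      · exact absurd (Or.inl h'.symm) a.2.2
      · exact h'
    obtain ⟨c, ⟨hwc, hca⟩, hmin⟩ := Set.exists_min_image {c | O w c ∧ a.1 ∈ desc O c} r
      (Set.toFinite _) hne
    refine le_trans (Nat.mul_le_mul_left 2 (Set.ncard_le_ncard ?_ (Set.toFinite _))) (hc.2 c hwc)
    rintro _ ⟨x, hx, rfl⟩
    have hax : (U.induce (H.supp \ {x | x = w ∨ O x w})).Reachable a x :=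
      SimpleGraph.ConnectedComponent.exact
        (((D.mem_supp_iff a).1 haD).trans ((D.mem_supp_iff x).1 hx).symm)
    rw [SimpleGraph.reachable_iff_reflTransGen] at hax
    clear hx
    induction hax with
    | refl => exact hca
    | @tail x y _ hxy ih =>
      rcases (hU x.1 y.1).1 hxy with h' | h'
      · exact Relation.ReflTransGen.tail ih h'
      · by_contra hy
        have hyc := h.parent_of_desc ih hy h'
        rcases h.moral y.1 w c hyc hwc (fun he => y.2.2 (Or.inl he)) with h'' | h''
        · exact y.2.2 (Or.inr h'')
        · exact absurd (h.rank_lt _ _ hyc)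
            (not_lt.2 (hmin y.1 ⟨h'', Relation.ReflTransGen.head hyc hca⟩))
  · have hsub : Subtype.val '' D.supp ⊆ H.supp \ desc O w := by
      rintro _ ⟨x, hx, rfl⟩
      exact ⟨x.2.1, fun hd => hD ⟨x, hx, hd⟩⟩
    have h1 := Set.ncard_le_ncard hsub (Set.toFinite _)
    have h2 := Set.ncard_sdiff_add_ncard_of_subset (desc_subset_supp hU hw) (Set.toFinite _)
    have := hc.1
    omega

end IsMoral

/-! ### Lower bounds for verifying sets -/

namespace DAG

variable {V : Type*}

/-- An edge `u → v` for which all other parents of `u` and `v` agree can be turned around, so that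
every verifying family cuts it. -/
theorem cut_of_covered [Finite V] {G : DAG V} {𝓘 𝓙 : Set (Set V)} (hJ : IsVerifying 𝓙 G) {u v : V}
    (huv : G.residual 𝓘 u v) (hcov : ∀ x, x ≠ u → (G.residual 𝓘 x u ↔ G.residual 𝓘 x v)) :
    Cut 𝓙 u v := by
  by_contra hcut
  obtain ⟨r, hr⟩ := G.exists_rank
  have hch := essential_chainClosed 𝓘 G
  have huv' := (essential_adj_iff 𝓘 G u v).1 huv.2
  have hpar : ∀ {x a b : V}, G.arc x a → (a = u ∧ b = v ∨ a = v ∧ b = u) → x ≠ u → x ≠ v →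
      G.arc x b := by
    intro x a b hxa hab hxu hxv
    by_cases hD : (G.essential 𝓘).arcs x a
    · refine hch.sub _ _ (hch.chain x a b hD ?_)
      rcases hab with ⟨rfl, rfl⟩ | ⟨rfl, rfl⟩
      · exact huv'
      · exact huv'.symm
    · have hres : G.residual 𝓘 x a := ⟨hxa, (essential_adj_iff 𝓘 G x a).2
        ⟨Or.inl hxa, hD, fun h => G.asymm hxa (hch.sub _ _ h)⟩⟩
      rcases hab with ⟨rfl, rfl⟩ | ⟨rfl, rfl⟩
      · exact ((hcov x hxu).1 hres).1
      · exact ((hcov x hxu).2 hres).1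
  obtain ⟨G', hM, h1, h2⟩ := exists_reorientation G {u, v} (fun a b => a = v ∧ b = u)
    (fun x => - r x)
    (by
      rintro x hx a (rfl | rfl) b (rfl | rfl) hxa
      · exact hxa
      · exact hpar hxa (Or.inl ⟨rfl, rfl⟩) (fun h => hx (Or.inl h)) (fun h => hx (Or.inr h))
      · exact hpar hxa (Or.inr ⟨rfl, rfl⟩) (fun h => hx (Or.inl h)) (fun h => hx (Or.inr h))
      · exact hxa)
    (by
      have hne := G.arc_ne huv.1
      have hs : ∀ a, ¬ G.skel a a := fun a h => h.elim (fun h => G.arc_ne h rfl)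
        fun h => G.arc_ne h rfl
      rintro a (rfl | rfl) b (rfl | rfl)
      · simp [hs, hne]
      · simp [skel, huv.1]
      · simp [skel, huv.1]
      · simp [hs, hne.symm])
    (by rintro a b ⟨rfl, rfl⟩; exact neg_lt_neg (hr _ _ huv.1))
    (by rintro a - b - c - hne ⟨rfl, -⟩ ⟨rfl, -⟩; exact absurd rfl hne)
    (by
      rintro a ha b hb c hc hne hac hbc
      rcases ha with rfl | rfl <;> rcases hb with rfl | rfl
      · exact absurd rfl hne
      · exact Or.inl huv.1
      · exact Or.inr huv.1
      · exact absurd rfl hne)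
  have hE : InterventionEquiv 𝓙 G G' := by
    refine interventionEquiv_iff.2 ⟨hM, fun a b hab hab' => ?_⟩
    rw [h2 a b]
    · exact hab'
    · rintro ⟨rfl | rfl, rfl | rfl⟩
      · exact G.arc_ne hab' rfl
      · exact hcut hab
      · exact hcut (cut_symm hab)
      · exact G.arc_ne hab' rfl
  have harc : (G.essential 𝓙).arcs u v := by
    rw [show G.essential 𝓙 = _ from hJ]; exact huv.1
  exact G'.asymm (harc G' hE) ((h1 v (Or.inr rfl) u (Or.inl rfl)).2 ⟨rfl, rfl⟩)

end DAG

namespace IsMoral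

variable {V : Type*} {O : V → V → Prop} {r : V → ℤ}

/-- On the way from a root to `v`, through last parents, the number of parents grows by at most one
in each step, and it grows just in the steps along covered edges. So each value below the number
of parents of `v` is the number of parents of the tail of some covered edge above `v`. -/
theorem exists_covered_edge [Finite V] (h : IsMoral O r) (v : V) (j : ℕ)
    (hj : j < {a | O a v}.ncard) :
    ∃ u' v', O u' v' ∧ (∀ x, x ≠ u' → (O x u' ↔ O x v')) ∧ {a | O a u'}.ncard = j ∧
      {a | O a v'}.ncard = j + 1 ∧ Relation.ReflTransGen O v' v := by
  obtain ⟨p, hp1, hp2, -⟩ := h.exists_lastParent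
  have hwf : WellFounded fun a b => O a b :=
    Finite.wellFounded_of_trans_of_irrefl (fun a b => r a < r b) |>.mono fun a b => h.rank_lt a b
  induction v using hwf.induction with
  | _ v ih =>
    obtain ⟨a, ha⟩ := Set.nonempty_of_ncard_ne_zero (Nat.ne_zero_of_lt hj)
    have hpv := hp1 v a ha
    have hsub : {a | O a v} ⊆ insert (p v) {a | O a (p v)} := by
      intro x hx
      by_cases he : x = p v
      · exact Or.inl he
      · exact Or.inr (hp2 v x hx he)
    have hle := Set.ncard_le_ncard hsub (Set.toFinite _)
    have hins : (insert (p v) {a | O a (p v)}).ncard = {a | O a (p v)}.ncard + 1 :=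
      Set.ncard_insert_of_notMem (fun hm => h.asymm hm hm) (Set.toFinite _)
    by_cases hj' : j < {a | O a (p v)}.ncard
    · obtain ⟨u', v', h1, h2, h3, h4, h5⟩ := ih (p v) hpv hj'
      exact ⟨u', v', h1, h2, h3, h4, h5.tail hpv⟩
    · have heq := Set.eq_of_subset_of_ncard_le hsub (by omega) (Set.toFinite _)
      refine ⟨p v, v, hpv, fun x hx => ?_, by omega, by omega, .refl⟩
      have := Set.ext_iff.1 heq x
      simp only [Set.mem_ofPred_eq, Set.mem_insert_iff, hx, false_or] at this
      exact this.symm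

end IsMoral

namespace DAG

variable {V : Type*}

/-- The vertices that a family of interventions targets by themselves. -/
def targets (𝓙 : Set (Set V)) : Set V := {v | {v} ∈ 𝓙}

theorem ncard_targets_le [Finite V] (𝓙 : Set (Set V)) : (targets 𝓙).ncard ≤ 𝓙.ncard :=
  Set.ncard_le_ncard_of_injOn (fun v => {v}) (fun _ h => h)
    (fun _ _ _ _ h => Set.singleton_injective h) (Set.toFinite _)

theorem mem_targets_of_cut {𝓙 : Set (Set V)} (hJ : ∀ S ∈ 𝓙, S.ncard = 1) {u v : V}
    (h : Cut 𝓙 u v) : u ∈ targets 𝓙 ∨ v ∈ targets 𝓙 := by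
  obtain ⟨S, hS, h⟩ := h
  obtain ⟨w, rfl⟩ := Set.ncard_eq_one.1 (hJ S hS)
  rcases h with h | h
  · rw [Set.mem_singleton_iff.1 h.1]; exact Or.inl hS
  · rw [Set.mem_singleton_iff.1 h.2]; exact Or.inr hS

/-- Every atomic verifying family has many targets in a component with a large clique: the covered
edges found at the even levels are disjoint, and each contains a target. -/
theorem half_clique_le [Finite V] (G : DAG V) (𝓘 : Set (Set V)) {𝓙 : Set (Set V)}
    (hJ : ∀ S ∈ 𝓙, S.ncard = 1) (hV : IsVerifying 𝓙 G)
    (H : (G.essential 𝓘).edges.ConnectedComponent) {K : Set V} (hK : K ⊆ H.supp)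
    (hclique : (G.essential 𝓘).edges.IsClique K) :
    K.ncard / 2 ≤ (targets 𝓙 ∩ H.supp).ncard := by
  obtain ⟨r, hr⟩ := G.exists_rank
  have hO := residual_isMoral 𝓘 G hr
  rcases K.eq_empty_or_nonempty with rfl | hne
  · simp
  obtain ⟨v, hv, hmax⟩ := Set.exists_max_image K r (Set.toFinite _) hne
  have hsub : K ⊆ insert v {a | G.residual 𝓘 a v} := by
    intro x hx
    by_cases he : x = v
    · exact Or.inl he
    · rcases (adj_iff_residual 𝓘 G x v).1 (hclique hx hv he) with h | h
      · exact Or.inr h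
      · exact absurd (hr _ _ h.1) (not_lt.2 (hmax x hx))
  have hcard : K.ncard ≤ {a | G.residual 𝓘 a v}.ncard + 1 :=
    (Set.ncard_le_ncard hsub (Set.toFinite _)).trans (Set.ncard_insert_le _ _)
  have hup : ∀ x, Relation.ReflTransGen (G.residual 𝓘) x v → x ∈ H.supp := by
    intro x hx
    induction hx using Relation.ReflTransGen.head_induction_on with
    | refl => exact hK hv
    | head h _ ih => exact H.mem_supp_of_adj_mem_supp ih h.2.symm
  have himg : Set.Iio (K.ncard / 2) ⊆
      (fun w => {a | G.residual 𝓘 a w}.ncard / 2) '' (targets 𝓙 ∩ H.supp) := by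
    intro i hi
    have hi' : i < K.ncard / 2 := hi
    obtain ⟨u', v', h1, h2, h3, h4, h5⟩ := hO.exists_covered_edge v (2 * i) (by omega)
    have hvH : v' ∈ H.supp := hup v' h5
    have huH : u' ∈ H.supp := H.mem_supp_of_adj_mem_supp hvH h1.2.symm
    rcases mem_targets_of_cut hJ (cut_of_covered hV h1 h2) with h | h
    · exact ⟨u', ⟨h, huH⟩, by simp only [h3]; omega⟩
    · exact ⟨v', ⟨h, hvH⟩, by simp only [h4]; omega⟩
  calc K.ncard / 2 = (Set.Iio (K.ncard / 2)).ncard := by simp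
    _ ≤ _ := Set.ncard_le_ncard himg (Set.toFinite _)
    _ ≤ _ := Set.ncard_image_le (Set.toFinite _)

theorem exists_adj_of_mem_supp [Finite V] {U : SimpleGraph V} {H : U.ConnectedComponent}
    (hH : 2 ≤ H.supp.ncard) {a : V} (ha : a ∈ H.supp) : ∃ c, U.Adj a c := by
  obtain ⟨b, hb, hab⟩ := Set.exists_ne_of_one_lt_ncard hH a
  have hreach : U.Reachable a b := SimpleGraph.ConnectedComponent.exact
    (((H.mem_supp_iff a).1 ha).trans ((H.mem_supp_iff b).1 hb).symm)
  rw [SimpleGraph.reachable_iff_reflTransGen] at hreach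
  rcases Relation.ReflTransGen.cases_head hreach with h | ⟨c, hac, -⟩
  · exact absurd h.symm hab
  · exact ⟨c, hac⟩

/-- The bound `K.ncard / 2` rounds down; applied to a single edge, it also shows that the component
contains a target, which makes up for the rounding. -/
theorem clique_le [Finite V] (G : DAG V) (𝓘 : Set (Set V)) {𝓙 : Set (Set V)}
    (hJ : ∀ S ∈ 𝓙, S.ncard = 1) (hV : IsVerifying 𝓙 G)
    (H : (G.essential 𝓘).edges.ConnectedComponent) (hH : 2 ≤ H.supp.ncard) {K : Set V}
    (hK : K ⊆ H.supp) (hclique : (G.essential 𝓘).edges.IsClique K) :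
    K.ncard ≤ 3 * (targets 𝓙 ∩ H.supp).ncard := by
  have h1 := half_clique_le G 𝓘 hJ hV H hK hclique
  obtain ⟨a, ha⟩ := H.nonempty_supp
  obtain ⟨c, hac⟩ := exists_adj_of_mem_supp hH ha
  have hpair : (G.essential 𝓘).edges.IsClique {a, c} := by
    rintro x (rfl | rfl) y (rfl | rfl) hne
    · exact absurd rfl hne
    · exact hac
    · exact hac.symm
    · exact absurd rfl hne
  have h2 := half_clique_le G 𝓘 hJ hV H (K := {a, c})
    (by rintro x (rfl | rfl); exacts [ha, H.mem_supp_of_adj_mem_supp ha hac]) hpair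
  rw [Set.ncard_pair hac.ne] at h2
  omega

/-- The minimum in the definition of `nu1` is attained, as all vertices together are verifying. -/
theorem exists_minimum_verifying [Finite V] (G : DAG V) :
    ∃ 𝓙 : Set (Set V), (∀ S ∈ 𝓙, S.ncard = 1) ∧ IsVerifying 𝓙 G ∧ 𝓙.ncard = G.nu1 := by
  refine Nat.sInf_mem (s := {m | ∃ 𝓘 : Set (Set V), (∀ S ∈ 𝓘, S.ncard = 1) ∧ IsVerifying 𝓘 G ∧
    𝓘.ncard = m}) ⟨_, {S | S.ncard = 1}, fun _ h => h, isVerifying_iff.2 ?_, rfl⟩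
  ext u v
  refine ⟨fun h => ?_, fun h => h.elim⟩
  refine absurd h (not_adj_of_cut ⟨{u}, Set.ncard_singleton u, Or.inl ⟨rfl, ?_⟩⟩)
  exact fun h' => h.ne' h'

end DAG

/-! ### Runs of the search algorithm -/

namespace DAG

variable {V : Type*}

theorem atomicSet_append (l l' : List V) : atomicSet l ⊆ atomicSet (l ++ l') := by
  rintro S ⟨v, hv, rfl⟩
  exact ⟨v, List.mem_append_left _ hv, rfl⟩

theorem not_mem_of_adj {G : DAG V} {l : List V} {u v : V}
    (h : (G.essential (atomicSet l)).edges.Adj u v) : u ∉ l := fun hu =>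
  not_adj_of_cut ((cut_atomicSet_iff h.ne).2 (Or.inl hu)) h

end DAG

section Search

open DAG

variable {V : Type*} {G : DAG V} {l l' : List V}

/-- The search algorithm can get to the sequence `l` in exactly `i` iterations of its loop. -/
def ReachesIn (G : DAG V) : ℕ → List V → Prop
  | 0, l => l = []
  | i + 1, l' => ∃ l, ReachesIn G i l ∧ SearchStep G l l'

theorem SearchReaches.exists_reachesIn (h : SearchReaches G l) : ∃ i, ReachesIn G i l := by
  induction h with
  | refl => exact ⟨0, rfl⟩
  | tail _ hs ih =>
    obtain ⟨i, hi⟩ := ih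
    exact ⟨i + 1, _, hi, hs⟩

theorem exists_large_component [Finite V] {U : SimpleGraph V} (h : U ≠ ⊥) :
    ∃ H : U.ConnectedComponent, 2 ≤ H.supp.ncard := by
  obtain ⟨a, b, hab⟩ := SimpleGraph.ne_bot_iff_exists_adj.1 h
  refine ⟨U.connectedComponentMk a, (Set.one_lt_ncard (Set.toFinite _)).2 ⟨a, rfl, b, ?_, hab.ne⟩⟩
  exact SimpleGraph.ConnectedComponent.sound hab.symm.reachable

/-- A chain component that is left after an iteration lies in a component that was left by one of
the chosen separators. -/
theorem SearchStep.halves [Finite V] (h : SearchStep G l l')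
    (H' : (G.essential (atomicSet l')).edges.ConnectedComponent) (hH' : 2 ≤ H'.supp.ncard) :
    ∃ H : (G.essential (atomicSet l)).edges.ConnectedComponent,
      2 * H'.supp.ncard ≤ H.supp.ncard := by
  obtain ⟨-, K, hK, batch, -, hb, rfl⟩ := h
  have hle := edges_mono (atomicSet_append l batch) G
  obtain ⟨a, ha⟩ := H'.nonempty_supp
  set H := (G.essential (atomicSet l)).edges.connectedComponentMk a with hHdef
  have hpath : ∀ x ∈ H'.supp,
      Relation.ReflTransGen (G.essential (atomicSet (l ++ batch))).edges.Adj a x := by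
    intro x hx
    rw [← SimpleGraph.reachable_iff_reflTransGen]
    exact SimpleGraph.ConnectedComponent.exact
      (((H'.mem_supp_iff a).1 ha).trans ((H'.mem_supp_iff x).1 hx).symm)
  have hsub : H'.supp ⊆ H.supp := by
    intro x hx
    have := (SimpleGraph.reachable_iff_reflTransGen a x).2 (hpath x hx)
    exact SimpleGraph.ConnectedComponent.sound (this.mono hle).symm
  have hH2 : 2 ≤ H.supp.ncard := hH'.trans (Set.ncard_le_ncard hsub (Set.toFinite _))
  have hout : ∀ x ∈ H'.supp, x ∈ H.supp \ K H := by
    intro x hx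
    refine ⟨hsub hx, fun hxK => ?_⟩
    obtain ⟨y, hxy⟩ := exists_adj_of_mem_supp hH' hx
    exact not_mem_of_adj hxy (List.mem_append_right _ ((hb x).2 ⟨H, hH2, hxK⟩))
  let D := ((G.essential (atomicSet l)).edges.induce (H.supp \ K H)).connectedComponentMk
    ⟨a, hout a ha⟩
  refine ⟨H, le_trans ?_ ((hK H hH2).2.2 D)⟩
  rw [← Set.ncard_image_of_injective D.supp Subtype.val_injective]
  refine Nat.mul_le_mul_left 2 (Set.ncard_le_ncard (fun x hx => ?_) (Set.toFinite _))
  refine ⟨⟨x, hout x hx⟩, ?_, rfl⟩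
  have key : ∀ x, Relation.ReflTransGen (G.essential (atomicSet (l ++ batch))).edges.Adj a x →
      ∃ hx' : x ∈ H'.supp, ((G.essential (atomicSet l)).edges.induce (H.supp \ K H)).Reachable
        ⟨a, hout a ha⟩ ⟨x, hout x hx'⟩ := by
    intro x hx
    induction hx with
    | refl => exact ⟨ha, SimpleGraph.Reachable.refl _⟩
    | @tail b c _ hbc ih =>
      obtain ⟨hb', hr⟩ := ih
      refine ⟨H'.mem_supp_of_adj_mem_supp hb' hbc, hr.trans (SimpleGraph.Adj.reachable ?_)⟩
      exact hle hbc
  obtain ⟨_, hr⟩ := key x (hpath x hx)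
  exact SimpleGraph.ConnectedComponent.sound hr.symm

theorem ReachesIn.component_bound [Finite V] {i : ℕ} (h : ReachesIn G i l)
    (H : (G.essential (atomicSet l)).edges.ConnectedComponent) (hH : 2 ≤ H.supp.ncard) :
    2 ^ i * H.supp.ncard ≤ Nat.card V := by
  induction i generalizing l with
  | zero =>
    rw [pow_zero, one_mul, ← Set.ncard_univ]
    exact Set.ncard_le_ncard (Set.subset_univ _) (Set.toFinite _)
  | succ i ih =>
    obtain ⟨m, hm, hs⟩ := h
    obtain ⟨H₀, h₀⟩ := hs.halves H hH
    have := ih hm H₀ (by omega)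
    calc 2 ^ (i + 1) * H.supp.ncard = 2 ^ i * (2 * H.supp.ncard) := by ring
      _ ≤ 2 ^ i * H₀.supp.ncard := Nat.mul_le_mul_left _ h₀
      _ ≤ _ := this

theorem ReachesIn.pow_le_of_not_done [Finite V] {i : ℕ} (h : ReachesIn G i l)
    (hd : ¬ SearchDone G l) : 2 ^ (i + 1) ≤ Nat.card V := by
  obtain ⟨H, hH⟩ := exists_large_component hd
  calc 2 ^ (i + 1) = 2 ^ i * 2 := pow_succ _ _
    _ ≤ 2 ^ i * H.supp.ncard := Nat.mul_le_mul_left _ hH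
    _ ≤ _ := h.component_bound H hH

/-- One iteration costs at most three times the optimum, as the chosen cliques lie in different
components. -/
theorem SearchStep.length_le [Finite V] (h : SearchStep G l l') :
    l'.length ≤ l.length + 3 * G.nu1 := by
  classical
  obtain ⟨-, K, hK, batch, hnd, hb, rfl⟩ := h
  obtain ⟨𝓙, hJ, hV, hcard⟩ := exists_minimum_verifying G
  have := Fintype.ofFinite V
  have := Fintype.ofFinite (G.essential (atomicSet l)).edges.ConnectedComponent
  let c : V → (G.essential (atomicSet l)).edges.ConnectedComponent :=
    (G.essential (atomicSet l)).edges.connectedComponentMk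
  let t : Finset V := (targets 𝓙).toFinset
  have hfib : ∀ H, (batch.toFinset.filter fun v => c v = H).card ≤
      3 * (t.filter fun v => c v = H).card := by
    intro H
    rcases (batch.toFinset.filter fun v => c v = H).eq_empty_or_nonempty with he | ⟨v, hv⟩
    · rw [he]; simp
    have hmem : ∀ v, v ∈ batch → 2 ≤ (c v).supp.ncard ∧ v ∈ K (c v) := by
      intro v hv
      obtain ⟨H', h2, hvK⟩ := (hb v).1 hv
      have : c v = H' := (hK H' h2).1 hvK
      subst this
      exact ⟨h2, hvK⟩
    simp only [Finset.mem_filter, List.mem_toFinset] at hv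
    have hH2 : 2 ≤ H.supp.ncard := hv.2 ▸ (hmem v hv.1).1
    have hsub : ((batch.toFinset.filter fun v => c v = H : Finset V) : Set V) ⊆ K H := by
      intro x hx
      simp only [Finset.coe_filter, List.mem_toFinset, Set.mem_ofPred_eq] at hx
      exact hx.2 ▸ (hmem x hx.1).2
    have h1 := Set.ncard_le_ncard hsub (Set.toFinite _)
    rw [Set.ncard_coe_finset] at h1
    refine h1.trans ((clique_le G _ hJ hV H hH2 (hK H hH2).1 (hK H hH2).2.1).trans (le_of_eq ?_))
    rw [← Set.ncard_coe_finset]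
    congr 2
    ext x
    simp [t, c]
  have hsum : batch.toFinset.card ≤ 3 * t.card := by
    rw [Finset.card_eq_sum_card_fiberwise (f := c) (t := Finset.univ) (by simp),
      Finset.card_eq_sum_card_fiberwise (s := t) (f := c) (t := Finset.univ) (by simp),
      Finset.mul_sum]
    exact Finset.sum_le_sum fun H _ => hfib H
  rw [List.toFinset_card_of_nodup hnd] at hsum
  have ht : t.card ≤ G.nu1 := by
    rw [← hcard, ← Set.ncard_eq_toFinset_card']
    exact ncard_targets_le 𝓙
  rw [List.length_append]
  omega

theorem ReachesIn.length_le [Finite V] {i : ℕ} (h : ReachesIn G i l) :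
    l.length ≤ i * (3 * G.nu1) := by
  induction i generalizing l with
  | zero => rw [show l = [] from h]; simp
  | succ i ih =>
    obtain ⟨m, hm, hs⟩ := h
    have := ih hm
    have := hs.length_le
    rw [Nat.succ_mul]
    omega

theorem ReachesIn.pow_le [Finite V] {i : ℕ} (h : ReachesIn G i l) (hi : i ≠ 0) :
    2 ^ i ≤ Nat.card V := by
  cases i with
  | zero => exact absurd rfl hi
  | succ i =>
    obtain ⟨m, hm, hs⟩ := h
    exact hm.pow_le_of_not_done hs.1

theorem SearchReaches.length_le {n : ℕ} {G : DAG (Fin n)} {l : List (Fin n)}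
    (h : SearchReaches G l) : (l.length : ℝ) ≤ 3 / Real.log 2 * (Real.log n * G.nu1) := by
  obtain ⟨i, hi⟩ := h.exists_reachesIn
  have hlog : 0 < Real.log 2 := Real.log_pos one_lt_two
  have hlen : (l.length : ℝ) ≤ i * (3 * G.nu1) := by exact_mod_cast hi.length_le
  have hin : (i : ℝ) * Real.log 2 ≤ Real.log n := by
    rcases eq_or_ne i 0 with rfl | h0
    · simpa using Real.log_natCast_nonneg n
    · have h1 := hi.pow_le h0
      rw [Nat.card_eq_fintype_card, Fintype.card_fin] at h1
      have h2 : (2 : ℝ) ^ i ≤ n := by exact_mod_cast h1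
      rw [← Real.log_pow]
      exact Real.log_le_log (by positivity) h2
  have hin' : (i : ℝ) ≤ Real.log n / Real.log 2 := (le_div_iff₀ hlog).2 hin
  calc (l.length : ℝ) ≤ i * (3 * G.nu1) := hlen
    _ ≤ Real.log n / Real.log 2 * (3 * G.nu1) := by gcongr
    _ = _ := by ring

/-- The vertices that are chosen next are ends of unoriented edges, which the vertices chosen before
are not. -/
theorem SearchReaches.nodup [Finite V] (h : SearchReaches G l) : l.Nodup := by
  induction h with
  | refl => exact List.nodup_nil
  | tail _ hs ih =>
    obtain ⟨-, K, hK, batch, hnd, hb, rfl⟩ := hs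
    refine List.nodup_append'.2 ⟨ih, hnd, fun v hv hv' => ?_⟩
    obtain ⟨H, h2, hvK⟩ := (hb v).1 hv'
    obtain ⟨y, hy⟩ := exists_adj_of_mem_supp h2 ((hK H h2).1 hvK)
    exact not_mem_of_adj hy hv

/-- The algorithm does not get stuck: the orientation of the ground truth yields separators. -/
theorem exists_searchStep [Finite V] (hd : ¬ SearchDone G l) : ∃ l', SearchStep G l l' := by
  classical
  have := Fintype.ofFinite V
  obtain ⟨r, hr⟩ := G.exists_rank
  have hO := residual_isMoral (atomicSet l) G hr
  have hsep : ∀ H : (G.essential (atomicSet l)).edges.ConnectedComponent, ∃ K,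
      IsHalfCliqueSeparator (G.essential (atomicSet l)).edges H.supp K := by
    intro H
    obtain ⟨w, hw, hc⟩ := hO.exists_centroid (adj_iff_residual _ G) H
    exact ⟨_, hO.isHalfCliqueSeparator (adj_iff_residual _ G) hw hc⟩
  choose K hK using hsep
  refine ⟨_, hd, K, fun H _ => hK H, (Finset.univ.filter fun v => ∃ H : (G.essential
    (atomicSet l)).edges.ConnectedComponent, 2 ≤ H.supp.ncard ∧ v ∈ K H).toList,
    Finset.nodup_toList _, fun v => ?_, rfl⟩
  simp

/-- Each iteration halves the largest chain component, so that there is no infinite run. -/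
theorem not_exists_infinite_run [Finite V] :
    ¬ ∃ f : ℕ → List V, f 0 = [] ∧ ∀ i, SearchStep G (f i) (f (i + 1)) := by
  rintro ⟨f, h0, hf⟩
  have hr : ∀ i, ReachesIn G i (f i) := by
    intro i
    induction i with
    | zero => exact h0
    | succ i ih => exact ⟨_, ih, hf i⟩
  have h1 := (hr (Nat.card V)).pow_le_of_not_done (hf _).1
  exact absurd (h1.trans_lt Nat.lt_two_pow_self) (not_lt.2 (Nat.pow_le_pow_right two_pos (by omega)))

end Search

/-! ### A language of matrix programs -/

/-- Numeric terms over matrices of natural numbers that are indexed by vertices. Variables are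
numbers; `sum t` binds the variable whose number is the current depth of binders. -/
inductive Tm where
  | const (c : ℕ)
  | cell (a x y : ℕ)
  | vlt (x y : ℕ)
  | add (s t : Tm)
  | sub (s t : Tm)
  | lt (s t : Tm)
  | sum (t : Tm)

/-- A family of matrices. -/
abbrev Arrays (n : ℕ) := ℕ → Fin n → Fin n → ℕ

namespace Tm

/-- The value of a term at depth `k`, for the values `e` of the variables. -/
def eval {n : ℕ} (A : Arrays n) : Tm → ℕ → (ℕ → Fin n) → ℕ
  | const c, _, _ => c
  | cell a x y, _, e => A a (e x) (e y)
  | vlt x y, _, e => if e x < e y then 1 else 0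
  | add s t, k, e => s.eval A k e + t.eval A k e
  | sub s t, k, e => s.eval A k e - t.eval A k e
  | lt s t, k, e => if s.eval A k e < t.eval A k e then 1 else 0
  | sum t, k, e => ∑ v : Fin n, t.eval A (k + 1) (Function.update e k v)

/-- At depth `k`, all free variables are below `k`. -/
def ok : Tm → ℕ → Bool
  | const _, _ => true
  | cell _ x y, k => decide (x < k) && decide (y < k)
  | vlt x y, k => decide (x < k) && decide (y < k)
  | add s t, k => s.ok k && t.ok k
  | sub s t, k => s.ok k && t.ok k
  | lt s t, k => s.ok k && t.ok k
  | sum t, k => t.ok (k + 1)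

end Tm

/-- Matrix programs: assignment of the matrix given by a term in the variables `0` (row) and `1`
(column), `n`-fold repetition, and intervention on the vertices marked on the diagonal of
matrix `9`. All of them are total, and run in polynomial time. -/
inductive Cmd where
  | assign (a : ℕ) (t : Tm)
  | seq (c d : Cmd)
  | rep (c : Cmd)
  | interv

namespace Cmd

/-- All terms of the program are closed, up to the row and the column variable. -/
def ok : Cmd → Bool
  | assign _ t => t.ok 2
  | seq c d => c.ok && d.ok
  | rep c => c.ok
  | interv => true

open Classical in
/-- The effect of a matrix program on the matrices and on the list of interventions. Matrix `1`
receives the revealed arcs. -/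
noncomputable def denote {n : ℕ} (G : DAG (Fin n)) :
    Cmd → Arrays n × List (Fin n) → Arrays n × List (Fin n)
  | assign a t, σ =>
    (Function.update σ.1 a fun i j => t.eval σ.1 2 fun x => if x = 0 then i else j, σ.2)
  | seq c d, σ => d.denote G (c.denote G σ)
  | rep c, σ => (c.denote G)^[n] σ
  | interv, σ =>
    (Function.update σ.1 1 fun u v =>
      if σ.1 9 u u ≠ 0 ∨ σ.1 9 v v ≠ 0 then if G.arc u v then 1 else 0 else σ.1 1 u v,
      σ.2 ++ (List.finRange n).filter fun v => decide (σ.1 9 v v ≠ 0))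

end Cmd

/-! ### Compilation of matrix programs -/

/-- The array of the machine that holds the matrix `a`. The matrices `0`, `1` and `2` are the input,
the revealed arcs and the output; the arrays `1` and `4` to `7` are left for the number of
vertices, the variables, the intermediate results, a copy, and the loop counters. -/
def code (a : ℕ) : ℕ :=
  if a = 0 then 0 else if a = 1 then 2 else if a = 2 then 3 else a + 5

theorem code_injective : Function.Injective code := by
  intro a b h
  unfold code at h
  split_ifs at h <;> omega

theorem code_ne (a : ℕ) : code a ≠ 1 ∧ code a ≠ 4 ∧ code a ≠ 5 ∧ code a ≠ 6 ∧ code a ≠ 7 := by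
  unfold code
  split_ifs <;> omega

/-- The cell `(i, 0)` of array `a`. -/
def RExpr.reg (a i : ℕ) : RExpr := .cell a (.const i) (.const 0)

/-- A loop with the counter in cell `(i, 0)` of array `a`, which runs through the vertices. -/
def RProg.forLoop (a i : ℕ) (c : RProg) : RProg :=
  .seq (.store a (.const i) (.const 0) (.const 0))
    (.loop (.lt (.reg a i) (.reg 1 0))
      (.seq c (.store a (.const i) (.const 0) (.add (.reg a i) (.const 1)))))

/-- Evaluation of a term at depth `k` into the cell `(d, 0)` of array `5`. -/
def Tm.compile : Tm → ℕ → ℕ → RProg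
  | const c, _, d => .store 5 (.const d) (.const 0) (.const c)
  | cell a x y, _, d => .store 5 (.const d) (.const 0) (.cell (code a) (.reg 4 x) (.reg 4 y))
  | vlt x y, _, d => .store 5 (.const d) (.const 0) (.lt (.reg 4 x) (.reg 4 y))
  | add s t, k, d => .seq (s.compile k d) (.seq (t.compile k (d + 1))
      (.store 5 (.const d) (.const 0) (.add (.reg 5 d) (.reg 5 (d + 1)))))
  | sub s t, k, d => .seq (s.compile k d) (.seq (t.compile k (d + 1))
      (.store 5 (.const d) (.const 0) (.sub (.reg 5 d) (.reg 5 (d + 1)))))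
  | lt s t, k, d => .seq (s.compile k d) (.seq (t.compile k (d + 1))
      (.store 5 (.const d) (.const 0) (.lt (.reg 5 d) (.reg 5 (d + 1)))))
  | sum t, k, d => .seq (.store 5 (.const d) (.const 0) (.const 0))
      (.forLoop 4 k (.seq (t.compile (k + 1) (d + 1))
        (.store 5 (.const d) (.const 0) (.add (.reg 5 d) (.reg 5 (d + 1))))))

/-- Run `c` and then store `e`, for all entries of array `b`. -/
def RProg.fill (b : ℕ) (c : RProg) (e : RExpr) : RProg :=
  .forLoop 4 0 (.forLoop 4 1 (.seq c (.store b (.reg 4 0) (.reg 4 1) e)))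

/-- The machine program for a matrix program below `d` repetitions. An assignment goes through a
copy, as the term may mention the matrix that is assigned. -/
def Cmd.compile : Cmd → ℕ → RProg
  | assign a t, _ => .seq (.fill 6 (t.compile 2 0) (.reg 5 0))
      (.fill (code a) .skip (.cell 6 (.reg 4 0) (.reg 4 1)))
  | seq c c', d => .seq (c.compile d) (c'.compile d)
  | rep c, d => .forLoop 7 d (c.compile (d + 1))
  | interv, _ => .forLoop 4 0
      (.cond (.cell (code 9) (.reg 4 0) (.reg 4 0)) (.intervene (.reg 4 0)) .skip)

/-- Write `x` into the cell `(i, j)` of array `a`. -/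
def RState.set {n : ℕ} (s : RState n) (a i j x : ℕ) : RState n :=
  { s with mem := s.mem.write a i j x }

@[simp]
theorem RState.set_log {n : ℕ} (s : RState n) (a i j x : ℕ) : (s.set a i j x).log = s.log := rfl

theorem RState.set_self {n : ℕ} (s : RState n) (a i j x : ℕ) : (s.set a i j x).mem a i j = x := by
  simp [set, RMem.write]

theorem RState.set_of_ne {n : ℕ} (s : RState n) {a i j x a' i' j' : ℕ}
    (h : ¬ (a' = a ∧ i' = i ∧ j' = j)) : (s.set a i j x).mem a' i' j' = s.mem a' i' j' := by
  simp [set, RMem.write, h]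

section Exec

variable {n : ℕ} {G : DAG (Fin n)}

/-- `c` halts in at most `B` steps in a state that satisfies `Q`. -/
def Halts (G : DAG (Fin n)) (c : RProg) (s : RState n) (B : ℕ) (Q : RState n → Prop) : Prop :=
  ∃ t s', RExec G c s t s' ∧ t ≤ B ∧ Q s'

theorem Halts.seq {c d : RProg} {s : RState n} {B B' B'' : ℕ} {Q R : RState n → Prop}
    (h : Halts G c s B Q) (h' : ∀ s', Q s' → Halts G d s' B' R) (hB : B + B' + 1 ≤ B'') :
    Halts G (.seq c d) s B'' R := by
  obtain ⟨t, s₁, h1, h2, h3⟩ := h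
  obtain ⟨t', s₂, h4, h5, h6⟩ := h' s₁ h3
  exact ⟨_, s₂, .seq _ _ _ _ _ _ _ h1 h4, by omega, h6⟩

theorem Halts.store {a : ℕ} {i j e : RExpr} {s : RState n} {B : ℕ} {Q : RState n → Prop}
    (h : Q (s.set a (i.eval s.mem) (j.eval s.mem) (e.eval s.mem)))
    (hB : i.cost + j.cost + e.cost + 1 ≤ B) : Halts G (.store a i j e) s B Q :=
  ⟨_, _, .store a i j e s, hB, h⟩

/-- The rule for loops with an invariant. The constants in the bound cover the cost of the test and
of the steps of the counter. -/
theorem Halts.forLoop {a i : ℕ} {c : RProg} {s : RState n} {B B' : ℕ} {Q : RState n → Prop}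
    (Inv : ℕ → RState n → Prop)
    (hc : ∀ m s, Inv m s → s.mem a i 0 = m ∧ s.mem 1 0 0 = n)
    (hb : ∀ m < n, ∀ s, Inv m s → Halts G c s B fun s' =>
      s'.mem a i 0 = m ∧ Inv (m + 1) (s'.set a i 0 (m + 1)))
    (h0 : Inv 0 (s.set a i 0 0)) (hQ : ∀ s', Inv n s' → Q s')
    (hB : n * (B + 20) + 20 ≤ B') : Halts G (.forLoop a i c) s B' Q := by
  have key : ∀ k m s, m + k = n → Inv m s → Halts G (.loop (.lt (.reg a i) (.reg 1 0))
      (.seq c (.store a (.const i) (.const 0) (.add (.reg a i) (.const 1))))) s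
      (k * (B + 20) + 10) Q := by
    intro k
    induction k with
    | zero =>
      intro m s hm hI
      obtain ⟨h1, h2⟩ := hc m s hI
      refine ⟨_, s, .loop_false _ _ _ ?_, ?_, hQ s ?_⟩
      · simp only [RExpr.eval, RExpr.reg, h1, h2]
        rw [if_neg (by omega)]
      · simp [RExpr.cost, RExpr.reg]
      · rwa [← hm]
    | succ k ih =>
      intro m s hm hI
      obtain ⟨h1, h2⟩ := hc m s hI
      obtain ⟨t, s', h3, h4, h5, h6⟩ := hb m (by omega) s hI
      obtain ⟨t', s'', h7, h8, h9⟩ := ih (m + 1) _ (by omega) h6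
      subst h5
      refine ⟨_, s'', .loop_true _ _ _ _ _ _ _ ?_ (.seq _ _ _ _ _ _ _ h3 (.store _ _ _ _ _)) h7,
        ?_, h9⟩
      · simp only [RExpr.eval, RExpr.reg, h1, h2]
        rw [if_pos (by omega)]
        exact one_ne_zero
      · simp only [RExpr.cost, RExpr.reg]
        rw [Nat.succ_mul]
        omega
  refine Halts.seq (Halts.store (B := 5) (Q := Inv 0) ?_ ?_) (fun s' hs' => key n 0 s' (by omega) hs') ?_
  · exact h0
  · simp [RExpr.cost]
  · omega

/-- The arrays of the machine hold the matrices `A`. -/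
def Holds (A : Arrays n) (s : RState n) : Prop :=
  s.mem 1 0 0 = n ∧ ∀ a (i j : Fin n), s.mem (code a) i j = A a i j

/-- At most the variables from `k` on and the intermediate results from `d` on differ. -/
def Agree (k d : ℕ) (s s' : RState n) : Prop :=
  s'.log = s.log ∧ ∀ a i j, (a = 4 → i < k) → (a = 5 → i < d) → s'.mem a i j = s.mem a i j

theorem Agree.trans {k k' d d' : ℕ} {s s' s'' : RState n} (h : Agree k d s s')
    (h' : Agree k' d' s' s'') (hk : k ≤ k') (hd : d ≤ d') : Agree k d s s'' :=
  ⟨h'.1.trans h.1, fun a i j h1 h2 => (h'.2 a i j (fun h => (h1 h).trans_le hk)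
    fun h => (h2 h).trans_le hd).trans (h.2 a i j h1 h2)⟩

theorem Agree.write_tmp (k d x : ℕ) (s : RState n) :
    Agree k d s (s.set 5 d 0 x) :=
  ⟨rfl, fun _ _ _ _ h2 => RState.set_of_ne _ fun h => absurd h.2.1 (h2 h.1).ne⟩

theorem Agree.write_var (k d x : ℕ) (s : RState n) :
    Agree k d s (s.set 4 k 0 x) :=
  ⟨rfl, fun _ _ _ h1 _ => RState.set_of_ne _ fun h => absurd h.2.1 (h1 h.1).ne⟩

theorem Agree.holds {k d : ℕ} {A : Arrays n} {s s' : RState n} (h : Agree k d s s')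
    (hA : Holds A s) : Holds A s' :=
  ⟨(h.2 1 0 0 (by omega) (by omega)).trans hA.1, fun a i j =>
    (h.2 _ _ _ (fun h => absurd h (code_ne a).2.1) fun h => absurd h (code_ne a).2.2.1).trans
      (hA.2 a i j)⟩

theorem Agree.vars {k d : ℕ} {e : ℕ → Fin n} {s s' : RState n} (h : Agree k d s s')
    (he : ∀ x < k, s.mem 4 x 0 = e x) : ∀ x < k, s'.mem 4 x 0 = e x :=
  fun x hx => (h.2 4 x 0 (fun _ => hx) (by omega)).trans (he x hx)

/-- The value of a term is computed in polynomial time. -/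
theorem Tm.halts (t : Tm) (k d : ℕ) (hok : t.ok k = true) : ∃ p : Polynomial ℕ,
    ∀ {n : ℕ} (G : DAG (Fin n)) (A : Arrays n) (e : ℕ → Fin n) (s : RState n), Holds A s →
      (∀ x < k, s.mem 4 x 0 = e x) → Halts G (t.compile k d) s (p.eval n) fun s' =>
        Agree k d s s' ∧ s'.mem 5 d 0 = t.eval A k e := by
  -- The three binary operations are treated alike.
  have binary : ∀ (s t : Tm) (op : RExpr → RExpr → RExpr) (f : ℕ → ℕ → ℕ) (k d : ℕ),
      (∀ e e' m, (op e e').eval m = f (e.eval m) (e'.eval m)) →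
      (∀ e e', (op e e').cost = e.cost + e'.cost + 1) →
      (∃ p : Polynomial ℕ, ∀ {n : ℕ} (G : DAG (Fin n)) (A : Arrays n) (e : ℕ → Fin n)
        (z : RState n), Holds A z → (∀ x < k, z.mem 4 x 0 = e x) →
        Halts G (s.compile k d) z (p.eval n) fun s' =>
          Agree k d z s' ∧ s'.mem 5 d 0 = s.eval A k e) →
      (∃ p : Polynomial ℕ, ∀ {n : ℕ} (G : DAG (Fin n)) (A : Arrays n) (e : ℕ → Fin n)
        (z : RState n), Holds A z → (∀ x < k, z.mem 4 x 0 = e x) →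
        Halts G (t.compile k (d + 1)) z (p.eval n) fun s' =>
          Agree k (d + 1) z s' ∧ s'.mem 5 (d + 1) 0 = t.eval A k e) →
      ∃ p : Polynomial ℕ, ∀ {n : ℕ} (G : DAG (Fin n)) (A : Arrays n) (e : ℕ → Fin n)
        (z : RState n), Holds A z → (∀ x < k, z.mem 4 x 0 = e x) →
        Halts G (.seq (s.compile k d) (.seq (t.compile k (d + 1))
          (.store 5 (.const d) (.const 0) (op (.reg 5 d) (.reg 5 (d + 1)))))) z (p.eval n)
          fun s' => Agree k d z s' ∧ s'.mem 5 d 0 = f (s.eval A k e) (t.eval A k e) := by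
    rintro s t op f k d hev hco ⟨p, hp⟩ ⟨q, hq⟩
    refine ⟨p + q + 20, fun {n} G A e z hA he => ?_⟩
    refine (hp G A e z hA he).seq (B' := q.eval n + 15) ?_ (by simp; omega)
    rintro z₁ ⟨h1, h2⟩
    refine (hq G A e z₁ (h1.holds hA) (h1.vars he)).seq (B' := 11) ?_ (by omega)
    rintro z₂ ⟨h3, h4⟩
    refine Halts.store ⟨(h1.trans h3 le_rfl (Nat.le_succ d)).trans (Agree.write_tmp k d _ z₂)
      le_rfl le_rfl, ?_⟩ (by simp [hco, RExpr.cost, RExpr.reg])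
    simp only [RExpr.eval, hev, RExpr.reg, RState.set_self]
    rw [h4, h3.2 5 d 0 (by omega) (by omega), h2]
  induction t generalizing k d with
  | const c =>
    refine ⟨10, fun G A e s hA he => Halts.store ⟨Agree.write_tmp k d _ s, ?_⟩ ?_⟩
    · exact RState.set_self _ _ _ _ _
    · simp [RExpr.cost]
  | cell a x y =>
    simp only [ok, Bool.and_eq_true, decide_eq_true_eq] at hok
    refine ⟨20, fun G A e s hA he => Halts.store ⟨Agree.write_tmp k d _ s, ?_⟩ ?_⟩
    · simp only [RExpr.eval, RExpr.reg, RState.set_self, he x hok.1, he y hok.2]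
      exact hA.2 a (e x) (e y)
    · simp [RExpr.cost, RExpr.reg]
  | vlt x y =>
    simp only [ok, Bool.and_eq_true, decide_eq_true_eq] at hok
    refine ⟨20, fun G A e s hA he => Halts.store ⟨Agree.write_tmp k d _ s, ?_⟩ ?_⟩
    · simp only [RExpr.eval, RExpr.reg, RState.set_self, he x hok.1, he y hok.2]
      rfl
    · simp [RExpr.cost, RExpr.reg]
  | add s t ihs iht =>
    simp only [ok, Bool.and_eq_true] at hok
    exact binary s t .add (· + ·) k d (fun _ _ _ => rfl) (fun _ _ => rfl) (ihs k d hok.1)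
      (iht k (d + 1) hok.2)
  | sub s t ihs iht =>
    simp only [ok, Bool.and_eq_true] at hok
    exact binary s t .sub (· - ·) k d (fun _ _ _ => rfl) (fun _ _ => rfl) (ihs k d hok.1)
      (iht k (d + 1) hok.2)
  | lt s t ihs iht =>
    simp only [ok, Bool.and_eq_true] at hok
    exact binary s t .lt (fun x y => if x < y then 1 else 0) k d (fun _ _ _ => rfl)
      (fun _ _ => rfl) (ihs k d hok.1) (iht k (d + 1) hok.2)
  | sum t ih =>
    obtain ⟨p, hp⟩ := ih (k + 1) (d + 1) hok
    refine ⟨Polynomial.X * (p + 40) + 40, fun {n} G A e s hA he => ?_⟩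
    let g : ℕ → ℕ := fun i =>
      if h : i < n then t.eval A (k + 1) (Function.update e k ⟨i, h⟩) else 0
    refine Halts.seq (B := 5) (B' := n * (p.eval n + 40) + 20) (Q := fun s' =>
      Agree k d s s' ∧ s'.mem 5 d 0 = 0) ?_ ?_ (by simp; omega)
    · refine Halts.store ⟨Agree.write_tmp k d _ s, ?_⟩ (by simp [RExpr.cost])
      simp only [RExpr.eval, RState.set_self]
    rintro s₀ ⟨h0, h0'⟩
    refine Halts.forLoop (B := p.eval n + 20) (fun m s' => s'.mem 4 k 0 = m ∧ Agree k d s s' ∧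
      s'.mem 5 d 0 = ∑ i ∈ Finset.range m, g i) ?_ ?_ ?_ ?_ le_rfl
    · rintro m s' ⟨h1, h2, -⟩
      exact ⟨h1, (h2.holds hA).1⟩
    · rintro m hm s₁ ⟨h1, h2, h3⟩
      refine (hp G A (Function.update e k ⟨m, hm⟩) s₁ (h2.holds hA) ?_).seq (B' := 12) ?_ (by omega)
      · intro x hx
        rcases Nat.lt_succ_iff_lt_or_eq.1 hx with hx | rfl
        · rw [Function.update_of_ne hx.ne]; exact h2.vars he x hx
        · rw [Function.update_self]; exact h1
      · rintro s₂ ⟨h4, h5⟩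
        refine Halts.store ?_ (by simp [RExpr.cost, RExpr.reg])
        have h6 : Agree k d s s₂ := h2.trans h4 (Nat.le_succ k) (Nat.le_succ d)
        have h7 := h4.2 4 k 0 (by omega) (by omega)
        have h8 := h4.2 5 d 0 (by omega) (by omega)
        refine ⟨?_, RState.set_self _ _ _ _ _, ?_, ?_⟩
        · simp only [RExpr.eval]
          rw [RState.set_of_ne _ (by omega), h7, h1]
        · exact (h6.trans (Agree.write_tmp k d _ s₂) le_rfl le_rfl).trans
            (Agree.write_var k d _ _) le_rfl le_rfl
        · simp only [RExpr.eval, RExpr.reg]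
          rw [RState.set_of_ne _ (by omega), RState.set_self, h5, h8, h3, Finset.sum_range_succ]
          simp only [g, dif_pos hm]
    · refine ⟨RState.set_self _ _ _ _ _, h0.trans (Agree.write_var k d 0 s₀) le_rfl le_rfl, ?_⟩
      rw [Finset.range_zero, Finset.sum_empty]
      exact (RState.set_of_ne _ (by omega)).trans h0'
    · rintro s' ⟨-, h2, h3⟩
      refine ⟨h2, h3.trans ?_⟩
      rw [Finset.sum_range]
      simp only [g, Fin.is_lt, dif_pos, Fin.eta]
      rfl

/-- Arrays other than the variables, the intermediate results, and `b` are the same. -/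
def SameOff (b : ℕ) (s s' : RState n) : Prop :=
  s'.log = s.log ∧ ∀ a i j, a ≠ 4 → a ≠ 5 → a ≠ b → s'.mem a i j = s.mem a i j

theorem SameOff.trans {b : ℕ} {s s' s'' : RState n} (h : SameOff b s s') (h' : SameOff b s' s'') :
    SameOff b s s'' :=
  ⟨h'.1.trans h.1, fun a i j h1 h2 h3 => (h'.2 a i j h1 h2 h3).trans (h.2 a i j h1 h2 h3)⟩

theorem SameOff.write (b i j x : ℕ) (s : RState n) : SameOff b s (s.set b i j x) :=
  ⟨rfl, fun _ _ _ _ _ h3 => RState.set_of_ne _ fun h => h3 h.1⟩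

theorem SameOff.write_var (b i x : ℕ) (s : RState n) :
    SameOff b s (s.set 4 i 0 x) :=
  ⟨rfl, fun _ _ _ h1 _ _ => RState.set_of_ne _ fun h => h1 h.1⟩

theorem Agree.sameOff {k d b : ℕ} {s s' : RState n} (h : Agree k d s s') : SameOff b s s' :=
  ⟨h.1, fun a i j h1 h2 _ => h.2 a i j (fun h => absurd h h1) fun h => absurd h h2⟩

/-- The rule for filling an array: `val i j` is the value of `e` after `c` has run for the entry
`(i, j)`. -/
theorem Halts.fill {b : ℕ} {c : RProg} {e : RExpr} {s : RState n} {B B' : ℕ} (hb1 : b ≠ 1)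
    (hb4 : b ≠ 4) (hb5 : b ≠ 5) (hn : s.mem 1 0 0 = n) (val : ℕ → ℕ → ℕ)
    (h : ∀ i < n, ∀ j < n, ∀ s', SameOff b s s' → s'.mem 4 0 0 = i → s'.mem 4 1 0 = j →
      Halts G c s' B fun s'' => Agree 2 0 s' s'' ∧ e.eval s''.mem = val i j)
    (hB : n * (n * (B + e.cost + 40) + 60) + 60 ≤ B') :
    Halts G (.fill b c e) s B' fun s' =>
      SameOff b s s' ∧ ∀ i j : Fin n, s'.mem b i j = val i j := by
  refine Halts.forLoop (B := n * (B + e.cost + 40) + 40) (fun i s' => s'.mem 4 0 0 = i ∧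
    SameOff b s s' ∧ ∀ i' < i, ∀ j' < n, s'.mem b i' j' = val i' j') ?_ ?_ ?_ ?_
    (by refine le_trans ?_ hB; rw [add_assoc]; omega)
  · rintro m s' ⟨h1, h2, -⟩
    exact ⟨h1, (h2.2 1 0 0 (by omega) (by omega) hb1.symm).trans hn⟩
  · rintro i hi s₁ ⟨h1, h2, h3⟩
    refine Halts.forLoop (B := B + e.cost + 20) (fun j s' => s'.mem 4 1 0 = j ∧
      s'.mem 4 0 0 = i ∧ SameOff b s s' ∧ (∀ i' < i, ∀ j' < n, s'.mem b i' j' = val i' j') ∧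
      ∀ j' < j, s'.mem b i j' = val i j') ?_ ?_ ?_ ?_ (by rw [add_assoc]; omega)
    · rintro m s' ⟨h1, -, h2, -⟩
      exact ⟨h1, (h2.2 1 0 0 (by omega) (by omega) hb1.symm).trans hn⟩
    · rintro j hj s₂ ⟨h4, h5, h6, h7, h8⟩
      refine (h i hi j hj s₂ h6 h5 h4).seq (B' := e.cost + 10) ?_ (by omega)
      rintro s₃ ⟨h9, h10⟩
      have hv0 : s₃.mem 4 0 0 = i := (h9.2 4 0 0 (by omega) (by omega)).trans h5
      have hv1 : s₃.mem 4 1 0 = j := (h9.2 4 1 0 (by omega) (by omega)).trans h4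
      have hsame : ∀ i' j', s₃.mem b i' j' = s₂.mem b i' j' := fun i' j' =>
        h9.2 b i' j' (fun h => absurd h hb4) fun h => absurd h hb5
      refine Halts.store ?_ (by simp [RExpr.cost, RExpr.reg]; omega)
      simp only [RExpr.eval, RExpr.reg, hv0, hv1, h10]
      refine ⟨?_, RState.set_self _ _ _ _ _, ?_, ?_, ?_, ?_⟩
      · rw [RState.set_of_ne _ (by omega)]; exact hv1
      · rw [RState.set_of_ne _ (by omega), RState.set_of_ne _ (by omega)]; exact hv0
      · exact (((h6.trans h9.sameOff).trans (SameOff.write b i j _ s₃))).trans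
          (SameOff.write_var b 1 _ _)
      · intro i' hi' j' hj'
        rw [RState.set_of_ne _ (by omega), RState.set_of_ne _ (by omega), hsame]
        exact h7 i' hi' j' hj'
      · intro j' hj'
        rw [RState.set_of_ne _ (by omega)]
        rcases Nat.lt_succ_iff_lt_or_eq.1 hj' with hj' | rfl
        · rw [RState.set_of_ne _ (by omega), hsame]
          exact h8 j' hj'
        · exact RState.set_self _ _ _ _ _
    · refine ⟨RState.set_self _ _ _ _ _, ?_, h2.trans (SameOff.write_var b 1 0 s₁), ?_, ?_⟩
      · exact (RState.set_of_ne _ (by omega)).trans h1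
      · intro i' hi' j' hj'
        exact (RState.set_of_ne _ (by omega)).trans (h3 i' hi' j' hj')
      · intro j' hj'
        exact absurd hj' (Nat.not_lt_zero _)
    · rintro s' ⟨-, h5, h6, h7, h8⟩
      refine ⟨h5, RState.set_self _ _ _ _ _, h6.trans (SameOff.write_var b 0 _ s'), ?_⟩
      intro i' hi' j' hj'
      rw [RState.set_of_ne _ (by omega)]
      rcases Nat.lt_succ_iff_lt_or_eq.1 hi' with hi' | rfl
      · exact h7 i' hi' j' hj'
      · exact h8 j' hj'
  · exact ⟨RState.set_self _ _ _ _ _, SameOff.write_var b 0 0 s,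
      fun i' hi' => absurd hi' (Nat.not_lt_zero _)⟩
  · rintro s' ⟨-, h2, h3⟩
    exact ⟨h2, fun i j => h3 i i.2 j j.2⟩

/-- A machine state represents the matrices and the interventions of a matrix program. -/
def Represents (s : RState n) (σ : Arrays n × List (Fin n)) : Prop :=
  Holds σ.1 s ∧ s.log = σ.2

/-- Matrix programs are compiled correctly, and run in polynomial time. The counters of the `d`
surrounding loops are kept, as the induction needs. -/
theorem Cmd.halts (c : Cmd) (d : ℕ) (hok : c.ok = true) : ∃ p : Polynomial ℕ,
    ∀ {n : ℕ} (G : DAG (Fin n)) (σ : Arrays n × List (Fin n)) (s : RState n), Represents s σ →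
      Halts G (c.compile d) s (p.eval n) fun s' =>
        Represents s' (c.denote G σ) ∧ ∀ r < d, s'.mem 7 r 0 = s.mem 7 r 0 := by
  classical
  induction c generalizing d with
  | assign a t =>
    obtain ⟨p, hp⟩ := t.halts 2 0 hok
    refine ⟨Polynomial.X * (Polynomial.X * (p + 100) + 100) + 200 +
      (Polynomial.X * (Polynomial.X * 100 + 100) + 200), fun {n} G σ s hs => ?_⟩
    have hcn := code_ne a
    let val : ℕ → ℕ → ℕ := fun i j => if h : i < n ∧ j < n then
      t.eval σ.1 2 (fun x => if x = 0 then ⟨i, h.1⟩ else ⟨j, h.2⟩) else 0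
    refine Halts.seq (B := n * (n * (p.eval n + 100) + 100) + 100)
      (B' := n * (n * 100 + 100) + 100)
      (Halts.fill (B := p.eval n) (by omega) (by omega) (by omega) hs.1.1 val ?_ ?_) ?_ (by simp; omega)
    · intro i hi j hj s' h1 h2 h3
      have hA : Holds σ.1 s' := ⟨(h1.2 1 0 0 (by omega) (by omega) (by omega)).trans hs.1.1,
        fun a i j => (h1.2 _ _ _ (code_ne a).2.1 (code_ne a).2.2.1 (code_ne a).2.2.2.1).trans
          (hs.1.2 a i j)⟩
      obtain ⟨T, s'', h4, h5, h6, h7⟩ := hp G σ.1 (fun x => if x = 0 then ⟨i, hi⟩ else ⟨j, hj⟩) s' hA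
        (by
          intro x hx
          interval_cases x
          · exact h2
          · exact h3)
      refine ⟨T, s'', h4, h5, h6, ?_⟩
      simp only [val, dif_pos (And.intro hi hj), RExpr.eval, RExpr.reg]
      exact h7
    · simp only [RExpr.cost, RExpr.reg]
      rw [add_assoc (p.eval n)]
      gcongr <;> omega
    · rintro s₁ ⟨h1, h2⟩
      obtain ⟨T, s₂, h3, h4, h5, h6⟩ := Halts.fill (G := G) (b := code a) (c := .skip)
        (e := .cell 6 (.reg 4 0) (.reg 4 1)) (s := s₁) (B := 1) (B' := n * (n * 100 + 100) + 100)
        hcn.1 hcn.2.1 hcn.2.2.1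
        ((h1.2 1 0 0 (by omega) (by omega) (by omega)).trans hs.1.1) val
        (by
          intro i hi j hj s' h3 h4 h5
          refine ⟨1, s', .skip s', le_rfl, ⟨rfl, fun _ _ _ _ _ => rfl⟩, ?_⟩
          simp only [RExpr.eval, RExpr.reg, h4, h5]
          rw [h3.2 6 i j (by omega) (by omega) hcn.2.2.2.1.symm]
          exact h2 ⟨i, hi⟩ ⟨j, hj⟩)
        (by simp only [RExpr.cost, RExpr.reg]; gcongr <;> omega)
      refine ⟨T, s₂, h3, h4, ⟨⟨?_, fun a' i j => ?_⟩, h5.1.trans (h1.1.trans hs.2)⟩, fun r _ => ?_⟩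
      · exact (h5.2 1 0 0 (by omega) (by omega) hcn.1.symm).trans
          ((h1.2 1 0 0 (by omega) (by omega) (by omega)).trans hs.1.1)
      · by_cases ha : a' = a
        · subst ha
          rw [h6]
          simp only [denote, Function.update_self, val, dif_pos (And.intro i.2 j.2)]
        · simp only [denote, Function.update_of_ne ha]
          have hcn' := code_ne a'
          exact ((h5.2 _ _ _ hcn'.2.1 hcn'.2.2.1 fun h => ha (code_injective h)).trans
            (h1.2 _ _ _ hcn'.2.1 hcn'.2.2.1 hcn'.2.2.2.1)).trans (hs.1.2 a' i j)
      · exact (h5.2 7 r 0 (by omega) (by omega) hcn.2.2.2.2.symm).trans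
          (h1.2 7 r 0 (by omega) (by omega) (by omega))
  | seq c c' ih ih' =>
    simp only [ok, Bool.and_eq_true] at hok
    obtain ⟨p, hp⟩ := ih d hok.1
    obtain ⟨q, hq⟩ := ih' d hok.2
    refine ⟨p + q + 1, fun {n} G σ s hs => ?_⟩
    refine (hp G σ s hs).seq (B' := q.eval n) ?_ (by simp)
    rintro s₁ ⟨h1, h2⟩
    obtain ⟨T, s₂, h3, h4, h5, h6⟩ := hq G _ s₁ h1
    exact ⟨T, s₂, h3, h4, h5, fun r hr => (h6 r hr).trans (h2 r hr)⟩
  | rep c ih =>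
    obtain ⟨p, hp⟩ := ih (d + 1) hok
    refine ⟨Polynomial.X * (p + 20) + 20, fun {n} G σ s hs => ?_⟩
    have hw : ∀ (s : RState n) (σ) (x : ℕ), Represents s σ →
        Represents (s.set 7 d 0 x) σ := by
      intro s σ x hs
      refine ⟨⟨(RState.set_of_ne _ (by omega)).trans hs.1.1, fun a i j => ?_⟩, hs.2⟩
      exact (RState.set_of_ne _ fun h => (code_ne a).2.2.2.2 h.1).trans (hs.1.2 a i j)
    refine Halts.forLoop (B := p.eval n) (fun m s' => s'.mem 7 d 0 = m ∧
      Represents s' ((c.denote G)^[m] σ) ∧ ∀ r < d, s'.mem 7 r 0 = s.mem 7 r 0) ?_ ?_ ?_ ?_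
      (by simp)
    · rintro m s' ⟨h1, h2, -⟩
      exact ⟨h1, h2.1.1⟩
    · rintro m hm s₁ ⟨h1, h2, h3⟩
      obtain ⟨T, s₂, h4, h5, h6, h7⟩ := hp G _ s₁ h2
      refine ⟨T, s₂, h4, h5, (h7 d (Nat.lt_succ_self d)).trans h1, RState.set_self _ _ _ _ _, ?_, ?_⟩
      · rw [Function.iterate_succ_apply']
        exact hw _ _ _ h6
      · intro r hr
        rw [RState.set_of_ne _ (by omega), h7 r (by omega)]
        exact h3 r hr
    · refine ⟨RState.set_self _ _ _ _ _, hw _ _ _ hs, fun r hr => ?_⟩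
      exact RState.set_of_ne _ (by omega)
    · rintro s' ⟨-, h2, h3⟩
      exact ⟨h2, h3⟩
  | interv =>
    refine ⟨Polynomial.X * (Polynomial.X + 60) + 20, fun {n} G σ s hs => ?_⟩
    let mk : Fin n → Prop := fun v => σ.1 9 v v ≠ 0
    refine Halts.forLoop (B := n + 40) (fun m s' => s'.mem 4 0 0 = m ∧
      (∀ a i j, a ≠ 2 → a ≠ 4 → s'.mem a i j = s.mem a i j) ∧
      s'.log = σ.2 ++ ((List.finRange n).take m).filter (fun v => decide (mk v)) ∧
      ∀ u v : Fin n, s'.mem 2 u v = if (mk u ∧ u.1 < m) ∨ (mk v ∧ v.1 < m) then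
        if G.arc u v then 1 else 0 else σ.1 1 u v) ?_ ?_ ?_ ?_ (by simp; ring_nf; rfl)
    · rintro m s' ⟨h1, h2, -⟩
      exact ⟨h1, (h2 1 0 0 (by omega) (by omega)).trans hs.1.1⟩
    · rintro m hm s₁ ⟨h1, h2, h3, h4⟩
      have hmark : (RExpr.cell (code 9) (.reg 4 0) (.reg 4 0)).eval s₁.mem =
          σ.1 9 ⟨m, hm⟩ ⟨m, hm⟩ := by
        simp only [RExpr.eval, RExpr.reg, h1]
        rw [h2 _ _ _ (by simp [code]) (by simp [code])]
        exact hs.1.2 9 ⟨m, hm⟩ ⟨m, hm⟩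
      have htake : (List.finRange n).take (m + 1) = (List.finRange n).take m ++ [⟨m, hm⟩] := by
        rw [List.take_succ_eq_append_getElem (by simpa using hm)]
        simp
      by_cases hmk : mk ⟨m, hm⟩
      · refine ⟨_, _, .cond_true _ _ _ _ _ _ (by rw [hmark]; exact hmk)
          (.intervene _ s₁ ⟨m, hm⟩ (by simp only [RExpr.eval, RExpr.reg, h1])),
          by simp [RExpr.cost, RExpr.reg]; omega, ?_, RState.set_self _ _ _ _ _, ?_, ?_, ?_⟩
        · simp only [RMem.reveal]
          rw [dif_neg (by omega)]
          exact h1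
        · intro a i j ha ha'
          rw [RState.set_of_ne _ (by omega)]
          simp only [RMem.reveal]
          rw [dif_neg (by omega)]
          exact h2 a i j ha ha'
        · simp only [RState.set_log, h3, htake, List.filter_append, List.append_assoc]
          simp [hmk]
        · intro u v
          rw [RState.set_of_ne _ (by omega)]
          simp only [RMem.reveal]
          by_cases huv : u.1 = m ∨ v.1 = m
          · rw [dif_pos ⟨trivial, u.2, v.2, huv⟩, if_pos (c := _ ∨ _)]
            rcases huv with rfl | rfl
            · exact Or.inl ⟨hmk, Nat.lt_succ_self _⟩
            · exact Or.inr ⟨hmk, Nat.lt_succ_self _⟩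
          · rw [dif_neg (fun h => huv h.2.2.2), h4 u v]
            have hu : u.1 < m + 1 ↔ u.1 < m := by omega
            have hv : v.1 < m + 1 ↔ v.1 < m := by omega
            simp only [hu, hv]
      · refine ⟨_, _, .cond_false _ _ _ _ _ _ (by rw [hmark]; exact not_not.1 hmk) (.skip s₁),
          by simp [RExpr.cost, RExpr.reg], h1, RState.set_self _ _ _ _ _, ?_, ?_, ?_⟩
        · intro a i j ha ha'
          rw [RState.set_of_ne _ (by omega)]
          exact h2 a i j ha ha'
        · simp only [RState.set_log, h3, htake, List.filter_append]
          simp [hmk]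
        · intro u v
          rw [RState.set_of_ne _ (by omega), h4 u v]
          have hx : ∀ u : Fin n, (mk u ∧ u.1 < m + 1) ↔ (mk u ∧ u.1 < m) := by
            intro u
            refine and_congr_right fun hu => ?_
            have : u.1 ≠ m := by
              rintro rfl
              exact hmk hu
            omega
          simp only [hx]
    · refine ⟨RState.set_self _ _ _ _ _, fun a i j _ h => RState.set_of_ne _ (by omega), ?_, ?_⟩
      · simp [hs.2]
      · intro u v
        rw [if_neg (by omega)]
        exact (RState.set_of_ne _ (by omega)).trans (hs.1.2 1 u v)
    · rintro s' ⟨-, h2, h3, h4⟩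
      refine ⟨⟨⟨(h2 1 0 0 (by omega) (by omega)).trans hs.1.1, fun a i j => ?_⟩, ?_⟩,
        fun r _ => h2 7 r 0 (by omega) (by omega)⟩
      · by_cases ha : a = 1
        · subst ha
          have := h4 i j
          simp only [denote, Function.update_self]
          simp only [mk, Fin.is_lt, and_true] at this
          exact this
        · simp only [denote, Function.update_of_ne ha]
          rw [h2 _ _ _ (fun h => ha (code_injective h)) (code_ne a).2.1]
          exact hs.1.2 a i j
      · rw [h3, List.take_of_length_le (by simp)]
        rfl

end Exec

/-! ### Formulas and saturation -/

namespace Tm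

/-- Negation: `1` if the value of `t` is `0`, and `0` otherwise. -/
def neg (t : Tm) : Tm := .lt t (.const 1)

/-- Conjunction, for values that count as true if they are not `0`. -/
def and (s t : Tm) : Tm := neg (.add (neg s) (neg t))

/-- The truth value, `0` or `1`, of a term. -/
def ind (t : Tm) : Tm := neg (neg t)

/-- Equality of two variables. -/
def eq (x y : ℕ) : Tm := neg (.add (.vlt x y) (.vlt y x))

/-- A term is true if its value is not `0`; addition is disjunction, and summation is existential
quantification. -/
def Holds {n : ℕ} (A : Arrays n) (k : ℕ) (e : ℕ → Fin n) (t : Tm) : Prop := t.eval A k e ≠ 0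

variable {n : ℕ} (A : Arrays n) (k : ℕ) (e : ℕ → Fin n)

theorem holds_cell (a x y : ℕ) : Holds A k e (.cell a x y) ↔ A a (e x) (e y) ≠ 0 := Iff.rfl

theorem holds_lt (s t : Tm) : Holds A k e (.lt s t) ↔ s.eval A k e < t.eval A k e := by
  simp [Holds, eval]

theorem holds_vlt (x y : ℕ) : Holds A k e (.vlt x y) ↔ e x < e y := by
  simp [Holds, eval]

theorem holds_add (s t : Tm) : Holds A k e (.add s t) ↔ Holds A k e s ∨ Holds A k e t := by
  simp only [Holds, eval]
  omega

theorem holds_neg (t : Tm) : Holds A k e (neg t) ↔ ¬ Holds A k e t := by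
  simp [neg, Holds, eval]

theorem holds_and (s t : Tm) : Holds A k e (.and s t) ↔ Holds A k e s ∧ Holds A k e t := by
  simp only [and, holds_neg, holds_add]
  tauto

theorem holds_sum (t : Tm) :
    Holds A k e (.sum t) ↔ ∃ v, Holds A (k + 1) (Function.update e k v) t := by
  simp [Holds, eval]

theorem holds_eq (x y : ℕ) : Holds A k e (eq x y) ↔ e x = e y := by
  simp only [eq, holds_neg, holds_add, holds_vlt, not_or, not_lt]
  exact ⟨fun h => le_antisymm h.2 h.1, fun h => ⟨h.ge, h.le⟩⟩

open Classical in
theorem eval_ind (t : Tm) : (ind t).eval A k e = if Holds A k e t then 1 else 0 := by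
  by_cases h : t.eval A k e = 0 <;> simp [ind, neg, eval, Holds, h]

theorem eval_add (s t : Tm) : (add s t).eval A k e = s.eval A k e + t.eval A k e := rfl

open Classical in
/-- Summation of truth values is counting. -/
theorem eval_sum_ind (t : Tm) : (sum (ind t)).eval A k e =
    {v | Holds A (k + 1) (Function.update e k v) t}.ncard := by
  rw [eval]
  simp only [eval_ind, Finset.sum_boole, Nat.cast_id]
  rw [← Set.ncard_coe_finset]
  simp

end Tm

/-- The values of the row and the column variable. -/
def entryEnv {n : ℕ} (i j : Fin n) : ℕ → Fin n := fun x => if x = 0 then i else j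

/-- The relation that the matrix `a` of a state represents. -/
def On {n : ℕ} (σ : Arrays n × List (Fin n)) (a : ℕ) (i j : Fin n) : Prop := σ.1 a i j ≠ 0

section Saturate

variable {n : ℕ} {G : DAG (Fin n)}

theorem on_assign (σ : Arrays n × List (Fin n)) (a : ℕ) (t : Tm) (i j : Fin n) :
    On ((Cmd.assign a t).denote G σ) a i j ↔ t.Holds σ.1 2 (entryEnv i j) := by
  simp only [On, Cmd.denote, Function.update_self]
  rfl

theorem assign_of_ne (σ : Arrays n × List (Fin n)) {a b : ℕ} (t : Tm) (h : b ≠ a) :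
    ((Cmd.assign a t).denote G σ).1 b = σ.1 b := by
  simp only [Cmd.denote, Function.update_of_ne h]

/-- A function that makes progress in a bounded measure until it is in a good state is in a good
state after as many iterations as the bound. -/
theorem iterate_good {α : Type*} (f : α → α) (Inv Good : α → Prop) (μ : α → ℕ) (N : ℕ)
    (hInv : ∀ x, Inv x → Inv (f x)) (hμ : ∀ x, Inv x → μ x ≤ N)
    (hstep : ∀ x, Inv x → Good x ∨ μ x < μ (f x)) (hgood : ∀ x, Inv x → Good x → Good (f x))
    {x : α} (hx : Inv x) : Inv (f^[N] x) ∧ Good (f^[N] x) := by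
  have key : ∀ k, Inv (f^[k] x) ∧ (Good (f^[k] x) ∨ k ≤ μ (f^[k] x)) := by
    intro k
    induction k with
    | zero => exact ⟨hx, Or.inr (Nat.zero_le _)⟩
    | succ k ih =>
      rw [Function.iterate_succ_apply']
      refine ⟨hInv _ ih.1, ?_⟩
      rcases ih.2 with h | h
      · exact Or.inl (hgood _ ih.1 h)
      · rcases hstep _ ih.1 with h' | h'
        · exact Or.inl (hgood _ ih.1 h')
        · exact Or.inr (by omega)
  obtain ⟨h1, h2⟩ := key N
  refine ⟨h1, h2.elim id fun h => (hstep _ h1).resolve_right fun h' => ?_⟩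
  have := hμ _ (hInv _ h1)
  omega

/-- `n * n` iterations of a program. -/
def Cmd.rep₂ (c : Cmd) : Cmd := .rep (.rep c)

theorem denote_rep₂ (c : Cmd) (σ : Arrays n × List (Fin n)) :
    c.rep₂.denote G σ = (c.denote G)^[n * n] σ := by
  rw [Function.iterate_mul]
  rfl

/-- Compute in matrix `a` the closure of `base` under the rule `step`. -/
def Cmd.saturate (a : ℕ) (base step : Tm) : Cmd :=
  .seq (.assign a base) (Cmd.rep₂ (.assign a (.add (.cell a 0 1) step)))

/-- The result of saturation contains the base, is closed under the rule, and is contained in every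
relation `Q` with these properties. -/
theorem denote_saturate (σ : Arrays n × List (Fin n)) (a : ℕ) (base step : Tm)
    (B : Fin n → Fin n → Prop) (F : (Fin n → Fin n → Prop) → Fin n → Fin n → Prop)
    (Q : Fin n → Fin n → Prop)
    (hB : ∀ i j, base.Holds σ.1 2 (entryEnv i j) ↔ B i j)
    (hF : ∀ τ : Arrays n × List (Fin n), (∀ b, b ≠ a → τ.1 b = σ.1 b) →
      ∀ i j, step.Holds τ.1 2 (entryEnv i j) ↔ F (On τ a) i j)
    (hBQ : ∀ i j, B i j → Q i j)
    (hFQ : ∀ R : Fin n → Fin n → Prop, (∀ i j, R i j → Q i j) → ∀ i j, F R i j → Q i j) :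
    ∃ τ, (Cmd.saturate a base step).denote G σ = τ ∧ τ.2 = σ.2 ∧ (∀ b, b ≠ a → τ.1 b = σ.1 b) ∧
      (∀ i j, B i j → On τ a i j) ∧ (∀ i j, F (On τ a) i j → On τ a i j) ∧
      ∀ i j, On τ a i j → Q i j := by
  classical
  let f := (Cmd.assign a (.add (.cell a 0 1) step)).denote G
  have hf : ∀ τ : Arrays n × List (Fin n), (∀ b, b ≠ a → τ.1 b = σ.1 b) → ∀ i j,
      On (f τ) a i j ↔ On τ a i j ∨ F (On τ a) i j := by
    intro τ hτ i j
    rw [on_assign, Tm.holds_add, hF τ hτ]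
    rfl
  have hmain := iterate_good f
    (fun τ => τ.2 = σ.2 ∧ (∀ b, b ≠ a → τ.1 b = σ.1 b) ∧ (∀ i j, B i j → On τ a i j) ∧
      ∀ i j, On τ a i j → Q i j)
    (fun τ => ∀ i j, F (On τ a) i j → On τ a i j)
    (fun τ => (Finset.univ.filter fun p : Fin n × Fin n => On τ a p.1 p.2).card) (n * n)
    (by
      rintro τ ⟨h1, h2, h3, h4⟩
      refine ⟨h1, fun b hb => (assign_of_ne τ _ hb).trans (h2 b hb), fun i j hij => ?_,
        fun i j hij => ?_⟩
      · exact (hf τ h2 i j).2 (Or.inl (h3 i j hij))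
      · rcases (hf τ h2 i j).1 hij with h | h
        · exact h4 i j h
        · exact hFQ _ h4 i j h)
    (by
      intro τ _
      refine (Finset.card_le_univ _).trans ?_
      simp)
    (by
      rintro τ ⟨-, h2, -⟩
      by_cases hg : ∀ i j, F (On τ a) i j → On τ a i j
      · exact Or.inl hg
      · right
        push Not at hg
        obtain ⟨i, j, h, h'⟩ := hg
        refine Finset.card_lt_card ⟨fun p hp => ?_, fun hs => ?_⟩
        · simp only [Finset.mem_filter, Finset.mem_univ, true_and] at hp ⊢
          exact (hf τ h2 _ _).2 (Or.inl hp)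
        · have := @hs (i, j) (by
            simp only [Finset.mem_filter, Finset.mem_univ, true_and]
            exact (hf τ h2 _ _).2 (Or.inr h))
          simp only [Finset.mem_filter, Finset.mem_univ, true_and] at this
          exact h' this)
    (by
      rintro τ ⟨-, h2, -⟩ hg
      have he : On (f τ) a = On τ a := by
        ext i j
        rw [hf τ h2]
        exact ⟨fun h => h.elim id (hg i j), Or.inl⟩
      rw [he]
      exact hg)
    (x := (Cmd.assign a base).denote G σ)
    ⟨rfl, fun b hb => assign_of_ne σ _ hb, fun i j h => (on_assign _ _ _ _ _).2 ((hB i j).2 h),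
      fun i j h => hBQ i j ((hB i j).1 ((on_assign _ _ _ _ _).1 h))⟩
  obtain ⟨⟨h1, h2, h3, h4⟩, h5⟩ := hmain
  refine ⟨_, ?_, h1, h2, h3, h5, h4⟩
  rw [← denote_rep₂]
  rfl

/-- The reflexive transitive closure of matrix `b`, in matrix `a`. -/
def Cmd.reach (a b : ℕ) : Cmd :=
  .saturate a (.eq 0 1) (.sum (.and (.cell a 0 2) (.cell b 2 1)))

theorem denote_reach (σ : Arrays n × List (Fin n)) {a b : ℕ} (hab : b ≠ a) :
    ∃ τ, (Cmd.reach a b).denote G σ = τ ∧ τ.2 = σ.2 ∧ (∀ c, c ≠ a → τ.1 c = σ.1 c) ∧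
      ∀ i j, On τ a i j ↔ Relation.ReflTransGen (On σ b) i j := by
  obtain ⟨τ, h0, h1, h2, h3, h4, h5⟩ := denote_saturate (G := G) σ a (.eq 0 1)
    (.sum (.and (.cell a 0 2) (.cell b 2 1))) (fun i j => i = j)
    (fun R i j => ∃ w, R i w ∧ On σ b w j) (Relation.ReflTransGen (On σ b))
    (by
      intro i j
      rw [Tm.holds_eq]
      rfl)
    (by
      intro τ hτ i j
      simp only [Tm.holds_sum, Tm.holds_and, Tm.holds_cell, hτ b hab, On]
      simp [entryEnv])
    (by
      rintro i j rfl
      exact .refl)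
    (by
      rintro R hR i j ⟨w, h, h'⟩
      exact .tail (hR i w h) h')
  refine ⟨τ, h0, h1, h2, fun i j => ⟨h5 i j, fun h => ?_⟩⟩
  induction h with
  | refl => exact h3 i i rfl
  | tail _ h ih => exact h4 _ _ ⟨_, ih, h⟩

end Saturate

/-! ### The search algorithm as a matrix program -/

/-- The closure, in matrix `3`, of the known arcs under Meek's first two rules. Matrix `0` is the
observational essential graph, and matrix `1` holds the revealed arcs. -/
def meekCmd : Cmd :=
  .saturate 3 (.add (.and (.cell 0 0 1) (.neg (.cell 0 1 0))) (.cell 1 0 1))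
    (.and (.cell 0 0 1) (.sum (.add
      (.and (.cell 3 2 0) (.and (.neg (.cell 0 2 1)) (.and (.neg (.cell 0 1 2)) (.neg (.eq 2 1)))))
      (.and (.cell 3 0 2) (.cell 3 2 1)))))

/-- The unoriented edges, in matrix `10`. -/
def undirectedCmd : Cmd :=
  .assign 10 (.and (.add (.cell 0 0 1) (.cell 0 1 0))
    (.and (.neg (.cell 3 0 1)) (.neg (.cell 3 1 0))))

/-- One round of elimination of vertices. The vertices marked in matrix `4` are eliminated already;
those marked in matrix `11` are simplicial in the rest. They are eliminated, and all edges to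
the rest, and to smaller vertices of this round, become arcs into them in matrix `5`. -/
def eliminationStep : Cmd :=
  .seq
    (.assign 11 (.and (.neg (.cell 4 0 0)) (.neg (.sum (.sum
      (.and (.cell 10 0 2) (.and (.cell 10 0 3) (.and (.neg (.cell 4 2 2))
        (.and (.neg (.cell 4 3 3)) (.and (.neg (.eq 2 3)) (.neg (.cell 10 2 3))))))))))))
    (.seq
      (.assign 5 (.add (.cell 5 0 1) (.and (.cell 10 0 1) (.and (.neg (.cell 4 0 0))
        (.and (.cell 11 1 1) (.add (.neg (.cell 11 0 0)) (.vlt 1 0)))))))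
      (.assign 4 (.add (.cell 4 0 0) (.cell 11 0 0))))

/-- A moral orientation of the unoriented edges, in matrix `5`. -/
def orientationCmd : Cmd :=
  .seq (.assign 4 (.const 0)) (.seq (.assign 5 (.const 0)) eliminationStep.rep₂)

/-- The centroids of the chain components, in matrix `8`. Matrix `6` holds the descendants, and
matrix `7` the chain components. -/
def centroidCmd : Cmd :=
  .assign 8 (.and (.sum (.cell 10 0 2)) (.and
    (.lt (.sum (.ind (.cell 7 0 2)))
      (.add (.sum (.ind (.cell 6 0 2))) (.sum (.ind (.cell 6 0 2)))))
    (.neg (.sum (.and (.cell 5 0 2) (.lt (.sum (.ind (.cell 7 0 3)))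
      (.add (.sum (.ind (.cell 6 2 3))) (.sum (.ind (.cell 6 2 3))))))))))

/-- The union of the separators that consist of a centroid and its parents, in matrix `9`. -/
def batchCmd : Cmd :=
  .assign 9 (.add (.cell 8 0 0) (.sum (.and (.cell 8 2 2) (.cell 5 0 2))))

/-- One iteration of the search algorithm. -/
def roundCmd : Cmd :=
  .seq meekCmd (.seq undirectedCmd (.seq orientationCmd (.seq (.reach 6 5) (.seq (.reach 7 10)
    (.seq centroidCmd (.seq batchCmd .interv))))))

/-- The search algorithm; the ground truth ends up in matrix `2`. -/
def searchCmd : Cmd :=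
  .seq (.rep roundCmd) (.seq meekCmd (.assign 2 (.ind (.cell 3 0 1))))

section Search

open DAG

variable {n : ℕ} {G : DAG (Fin n)}

/-- What a state of the algorithm knows between two iterations: the observational essential graph,
and the arcs at the vertices that have been intervened on. -/
structure Knows (G : DAG (Fin n)) (σ : Arrays n × List (Fin n)) : Prop where
  input : ∀ u v, On σ 0 u v ↔ (G.essential ∅).arcs u v ∨ (G.essential ∅).edges.Adj u v
  revealed : ∀ u v, On σ 1 u v ↔ G.arc u v ∧ (u ∈ σ.2 ∨ v ∈ σ.2)

namespace Knows

variable {σ : Arrays n × List (Fin n)}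

theorem on_of_arc (h : Knows G σ) {u v : Fin n} (huv : G.arc u v) : On σ 0 u v := by
  rw [h.input, essential_adj_iff]
  by_cases hc : (G.essential ∅).arcs u v
  · exact Or.inl hc
  · exact Or.inr ⟨Or.inl huv, hc, fun h' => G.asymm huv ((essential_chainClosed ∅ G).sub _ _ h')⟩

theorem skel_of_on (h : Knows G σ) {u v : Fin n} (huv : On σ 0 u v) : G.skel u v := by
  rcases (h.input u v).1 huv with h' | h'
  · exact Or.inl ((essential_chainClosed ∅ G).sub _ _ h')
  · exact ((essential_adj_iff ∅ G u v).1 h').1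

theorem skel_iff (h : Knows G σ) (u v : Fin n) : G.skel u v ↔ On σ 0 u v ∨ On σ 0 v u :=
  ⟨fun h' => h'.imp h.on_of_arc h.on_of_arc,
    fun h' => h'.elim h.skel_of_on fun h'' => (h.skel_of_on h'').symm⟩

theorem not_on_of_arcs (h : Knows G σ) {u v : Fin n} (huv : (G.essential ∅).arcs u v) :
    ¬ On σ 0 v u := by
  rw [h.input]
  rintro (h' | h')
  · exact (G.essential ∅).arcs_asymm _ _ huv h'
  · exact (G.essential ∅).arcs_not_edge _ _ huv h'.symm

theorem arcs_iff (h : Knows G σ) (u v : Fin n) :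
    (G.essential ∅).arcs u v ↔ On σ 0 u v ∧ ¬ On σ 0 v u := by
  refine ⟨fun h' => ⟨(h.input u v).2 (Or.inl h'), h.not_on_of_arcs h'⟩, fun ⟨h1, h2⟩ => ?_⟩
  exact ((h.input u v).1 h1).resolve_right fun h' => h2 ((h.input v u).2 (Or.inr h'.symm))

theorem denote_meekCmd (h : Knows G σ) : ∃ τ, meekCmd.denote G σ = τ ∧ τ.2 = σ.2 ∧
    (∀ b, b ≠ 3 → τ.1 b = σ.1 b) ∧
      ∀ u v, On τ 3 u v ↔ (G.essential (atomicSet σ.2)).arcs u v := by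
  have hsub := (InterventionMeek.chainClosed (atomicSet σ.2) G).sub
  obtain ⟨τ, h0, h1, h2, h3, h4, h5⟩ := denote_saturate (G := G) σ 3
    (.add (.and (.cell 0 0 1) (.neg (.cell 0 1 0))) (.cell 1 0 1))
    (.and (.cell 0 0 1) (.sum (.add
      (.and (.cell 3 2 0) (.and (.neg (.cell 0 2 1)) (.and (.neg (.cell 0 1 2)) (.neg (.eq 2 1)))))
      (.and (.cell 3 0 2) (.cell 3 2 1)))))
    (fun u v => (On σ 0 u v ∧ ¬ On σ 0 v u) ∨ On σ 1 u v)
    (fun R u v => On σ 0 u v ∧ ∃ w, (R w u ∧ ¬ On σ 0 w v ∧ ¬ On σ 0 v w ∧ w ≠ v) ∨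
      (R u w ∧ R w v))
    (InterventionMeek (atomicSet σ.2) G)
    (by
      intro i j
      simp only [Tm.holds_add, Tm.holds_and, Tm.holds_neg, Tm.holds_cell, On]
      simp [entryEnv])
    (by
      intro τ hτ i j
      simp only [Tm.holds_add, Tm.holds_and, Tm.holds_neg, Tm.holds_cell, Tm.holds_sum, Tm.holds_eq,
        hτ 0 (by norm_num), On]
      simp [entryEnv])
    (by
      rintro u v (h' | h')
      · exact .base ((h.arcs_iff u v).2 h')
      · obtain ⟨h1, h2⟩ := (h.revealed u v).1 h'
        exact .cut ((cut_atomicSet_iff (G.arc_ne h1)).2 h2) h1)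
    (by
      rintro R hR u v ⟨huv, w, ⟨h1, h2, h3, h4⟩ | ⟨h1, h2⟩⟩
      · have hs : ¬ G.skel w v := by rw [h.skel_iff]; tauto
        refine .rule1 (hR w u h1) hs h4 ((h.skel_of_on huv).resolve_right fun hvu => ?_)
        have hvs : G.VStructure v u w := ⟨h4.symm, hvu, hsub _ _ (hR w u h1), fun h' => hs h'.symm⟩
        exact h.not_on_of_arcs ((essential_chainClosed ∅ G).vstr _ _ _ hvs) huv
      · exact .rule2 (hR _ _ h1) (hR _ _ h2) ((h.skel_of_on huv).resolve_right
          (G.not_three_cycle (hsub _ _ (hR _ _ h1)) (hsub _ _ (hR _ _ h2)))))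
  refine ⟨τ, h0, h1, h2, fun u v => ?_⟩
  rw [essential_arcs_iff]
  refine ⟨h5 u v, fun hM => ?_⟩
  induction hM with
  | base h' => exact h3 _ _ (Or.inl ((h.arcs_iff _ _).1 h'))
  | cut hc h' =>
    exact h3 _ _ (Or.inr ((h.revealed _ _).2 ⟨h', (cut_atomicSet_iff (G.arc_ne h')).1 hc⟩))
  | @rule1 y x u _ hs hne hxu ih =>
    rw [h.skel_iff, not_or] at hs
    exact h4 _ _ ⟨h.on_of_arc hxu, y, Or.inl ⟨ih, hs.1, hs.2, hne⟩⟩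
  | @rule2 x w u _ _ hxu ih ih' => exact h4 _ _ ⟨h.on_of_arc hxu, w, Or.inr ⟨ih, ih'⟩⟩

end Knows

/-- The invariant of the elimination: the eliminated vertices are those with a time `e v < k`, all
edges at them are oriented, and arcs go backwards in time. -/
structure Eliminating (U : SimpleGraph (Fin n)) (E : Fin n → Prop) (O : Fin n → Fin n → Prop)
    (k : ℕ) (e : Fin n → ℕ) : Prop where
  time_lt : ∀ v, E v → e v < k
  time_eq : ∀ v, ¬ E v → e v = k
  order : ∀ a b, O a b → e b < e a ∨ (e b = e a ∧ b < a)
  head : ∀ a b, O a b → E b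
  adj : ∀ a b, O a b → U.Adj a b
  total : ∀ a b, U.Adj a b → E b → O a b ∨ O b a
  moral : ∀ a b c, O a c → O b c → a ≠ b → U.Adj a b

/-- `v` is simplicial in the graph of the vertices that are not eliminated. -/
def SimplicialRest (U : SimpleGraph (Fin n)) (E : Fin n → Prop) (v : Fin n) : Prop :=
  ¬ E v ∧ ∀ a b, U.Adj v a → U.Adj v b → ¬ E a → ¬ E b → a ≠ b → U.Adj a b

theorem Eliminating.step {U : SimpleGraph (Fin n)} {E : Fin n → Prop}
    {O : Fin n → Fin n → Prop} {k : ℕ} {e : Fin n → ℕ} (h : Eliminating U E O k e) :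
    ∃ e', Eliminating U (fun v => E v ∨ SimplicialRest U E v)
      (fun a b => O a b ∨ (U.Adj a b ∧ ¬ E a ∧ SimplicialRest U E b ∧
        (¬ SimplicialRest U E a ∨ b < a))) (k + 1) e' := by
  classical
  have hEk : ∀ v, e v < k + 1 := by
    intro v
    by_cases hv : E v
    · exact (h.time_lt v hv).trans (Nat.lt_succ_self k)
    · rw [h.time_eq v hv]; exact Nat.lt_succ_self k
  refine ⟨fun v => if E v ∨ SimplicialRest U E v then e v else k + 1, ?_, ?_, ?_, ?_, ?_, ?_, ?_⟩
  · intro v hv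
    simp only [if_pos hv]
    exact hEk v
  · intro v hv
    simp only [if_neg hv]
  · rintro a b (hab | ⟨hab, ha, hb, hab'⟩)
    · have hb : E b ∨ SimplicialRest U E b := Or.inl (h.head a b hab)
      simp only [if_pos hb]
      by_cases ha : E a ∨ SimplicialRest U E a
      · simp only [if_pos ha]; exact h.order a b hab
      · simp only [if_neg ha]; exact Or.inl (hEk b)
    · have hb' : E b ∨ SimplicialRest U E b := Or.inr hb
      simp only [if_pos hb']
      by_cases ha' : SimplicialRest U E a
      · have ha'' : E a ∨ SimplicialRest U E a := Or.inr ha'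
        simp only [if_pos ha'']
        exact Or.inr ⟨(h.time_eq b hb.1).trans (h.time_eq a ha).symm,
          hab'.resolve_left (not_not.2 ha')⟩
      · have ha'' : ¬ (E a ∨ SimplicialRest U E a) := not_or.2 ⟨ha, ha'⟩
        simp only [if_neg ha'']
        exact Or.inl (hEk b)
  · rintro a b (hab | hab)
    · exact Or.inl (h.head a b hab)
    · exact Or.inr hab.2.2.1
  · rintro a b (hab | hab)
    · exact h.adj a b hab
    · exact hab.1
  · intro a b hab hb
    by_cases hbE : E b
    · exact (h.total a b hab hbE).imp Or.inl Or.inl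
    by_cases haE : E a
    · exact (h.total b a hab.symm haE).symm.imp Or.inl Or.inl
    have hb := hb.resolve_left hbE
    by_cases ha : SimplicialRest U E a
    · rcases lt_or_gt_of_ne hab.ne with hlt | hlt
      · exact Or.inr (Or.inr ⟨hab.symm, hbE, ha, Or.inr hlt⟩)
      · exact Or.inl (Or.inr ⟨hab, haE, hb, Or.inr hlt⟩)
    · exact Or.inl (Or.inr ⟨hab, haE, hb, Or.inl ha⟩)
  · rintro a b c (hac | hac) (hbc | hbc) hne
    · exact h.moral a b c hac hbc hne
    · exact absurd (h.head a c hac) hbc.2.2.1.1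
    · exact absurd (h.head b c hbc) hac.2.2.1.1
    · exact hac.2.2.1.2 a b hac.1.symm hbc.1.symm hac.2.1 hbc.2.1 hne

/-- A moral orientation has a last vertex among those that are not eliminated, and this vertex is
simplicial. -/
theorem exists_simplicialRest {U : SimpleGraph (Fin n)} {O : Fin n → Fin n → Prop} {r : Fin n → ℤ}
    (hO : IsMoral O r) (hU : ∀ a b, U.Adj a b ↔ O a b ∨ O b a) {E : Fin n → Prop}
    (hE : ∃ v, ¬ E v) : ∃ v, SimplicialRest U E v := by
  obtain ⟨v, hv, hmax⟩ := Set.exists_max_image {v | ¬ E v} r (Set.toFinite _) hE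
  refine ⟨v, hv, fun a b ha hb haE hbE hne => ?_⟩
  have hin : ∀ a, U.Adj v a → ¬ E a → O a v := by
    intro a ha haE
    refine ((hU v a).1 ha).resolve_left fun h => ?_
    exact absurd (hO.rank_lt _ _ h) (not_lt.2 (hmax a haE))
  exact (hU a b).2 (hO.moral a b v (hin a ha haE) (hin b hb hbE) hne)

theorem denote_eliminationStep {U : SimpleGraph (Fin n)} (τ : Arrays n × List (Fin n))
    (hU : ∀ u v, On τ 10 u v ↔ U.Adj u v) :
    ∃ τ', eliminationStep.denote G τ = τ' ∧ τ'.2 = τ.2 ∧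
      (∀ b, b ≠ 4 → b ≠ 5 → b ≠ 11 → τ'.1 b = τ.1 b) ∧
      (∀ v, On τ' 4 v v ↔ On τ 4 v v ∨ SimplicialRest U (fun v => On τ 4 v v) v) ∧
      ∀ a b, On τ' 5 a b ↔ On τ 5 a b ∨ (U.Adj a b ∧ ¬ On τ 4 a a ∧
        SimplicialRest U (fun v => On τ 4 v v) b ∧
          (¬ SimplicialRest U (fun v => On τ 4 v v) a ∨ b < a)) := by
  set τ₁ := (Cmd.assign 11 (.and (.neg (.cell 4 0 0)) (.neg (.sum (.sum
      (.and (.cell 10 0 2) (.and (.cell 10 0 3) (.and (.neg (.cell 4 2 2))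
        (.and (.neg (.cell 4 3 3)) (.and (.neg (.eq 2 3)) (.neg (.cell 10 2 3)))))))))))).denote G τ
    with hτ₁
  have h11 : ∀ v w, On τ₁ 11 v w ↔ SimplicialRest U (fun v => On τ 4 v v) v := by
    intro v w
    rw [hτ₁, on_assign]
    simp only [Tm.holds_and, Tm.holds_neg, Tm.holds_cell, Tm.holds_sum, Tm.holds_eq]
    simp only [SimplicialRest, ← hU, On]
    simp only [entryEnv, ne_eq, not_not, not_exists, not_and]
    refine and_congr_right fun _ => ?_
    exact ⟨fun h a b ha hb => h a b ha hb, fun h a b ha hb => h a b ha hb⟩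
  have h1 : ∀ b, b ≠ 11 → τ₁.1 b = τ.1 b := fun b hb => assign_of_ne τ _ hb
  set τ₂ := (Cmd.assign 5 (.add (.cell 5 0 1) (.and (.cell 10 0 1) (.and (.neg (.cell 4 0 0))
        (.and (.cell 11 1 1) (.add (.neg (.cell 11 0 0)) (.vlt 1 0))))))).denote G τ₁ with hτ₂
  have h2 : ∀ b, b ≠ 5 → τ₂.1 b = τ₁.1 b := fun b hb => assign_of_ne τ₁ _ hb
  have h5 : ∀ a b, On τ₂ 5 a b ↔ On τ 5 a b ∨ (U.Adj a b ∧ ¬ On τ 4 a a ∧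
        SimplicialRest U (fun v => On τ 4 v v) b ∧
          (¬ SimplicialRest U (fun v => On τ 4 v v) a ∨ b < a)) := by
    intro a b
    rw [hτ₂, on_assign, ← h11 a a, ← h11 b b, ← hU]
    simp only [Tm.holds_and, Tm.holds_neg, Tm.holds_cell, Tm.holds_add, Tm.holds_vlt,
      h1 4 (by norm_num), h1 5 (by norm_num), h1 10 (by norm_num), On]
    simp [entryEnv]
  refine ⟨_, rfl, rfl, fun b hb4 hb5 hb11 => ?_, fun v => ?_, fun a b => ?_⟩
  · exact (assign_of_ne (G := G) τ₂ _ hb4).trans ((h2 b hb5).trans (h1 b hb11))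
  · refine (on_assign (G := G) τ₂ 4 _ v v).trans ?_
    rw [← h11 v v]
    simp only [Tm.holds_cell, Tm.holds_add, h2 4 (by norm_num), h2 11 (by norm_num),
      h1 4 (by norm_num), On]
    simp [entryEnv]
  · rw [← h5 a b]
    unfold On
    rw [show (eliminationStep.denote G τ).1 5 = τ₂.1 5 from assign_of_ne (G := G) τ₂ _ (by norm_num)]

theorem denote_orientationCmd {U : SimpleGraph (Fin n)} (σ : Arrays n × List (Fin n))
    (hU : ∀ u v, On σ 10 u v ↔ U.Adj u v) {O : Fin n → Fin n → Prop} {r : Fin n → ℤ}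
    (hO : IsMoral O r) (hUO : ∀ a b, U.Adj a b ↔ O a b ∨ O b a) :
    ∃ τ, orientationCmd.denote G σ = τ ∧ τ.2 = σ.2 ∧
      (∀ b, b ≠ 4 → b ≠ 5 → b ≠ 11 → τ.1 b = σ.1 b) ∧
      (∃ r, IsMoral (On τ 5) r) ∧ ∀ a b, U.Adj a b ↔ On τ 5 a b ∨ On τ 5 b a := by
  classical
  set τ₀ := (Cmd.assign 5 (.const 0)).denote G ((Cmd.assign 4 (.const 0)).denote G σ) with hτ₀
  have h04 : ∀ v, ¬ On τ₀ 4 v v := by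
    intro v hv
    unfold On at hv
    rw [hτ₀, assign_of_ne _ _ (by norm_num)] at hv
    exact (on_assign (G := G) σ 4 (.const 0) v v).1 hv rfl
  have h05 : ∀ a b, ¬ On τ₀ 5 a b := by
    intro a b hab
    exact (on_assign (G := G) _ 5 (.const 0) a b).1 hab rfl
  have hmain := iterate_good (eliminationStep.denote G)
    (fun τ => τ.2 = σ.2 ∧ (∀ b, b ≠ 4 → b ≠ 5 → b ≠ 11 → τ.1 b = σ.1 b) ∧
      ∃ k e, Eliminating U (fun v => On τ 4 v v) (On τ 5) k e)
    (fun τ => ∀ v, On τ 4 v v)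
    (fun τ => (Finset.univ.filter fun v : Fin n => On τ 4 v v).card) (n * n)
    (by
      rintro τ ⟨h1, h2, k, e, h3⟩
      have hUτ : ∀ u v, On τ 10 u v ↔ U.Adj u v := by
        intro u v
        rw [← hU, On, On, h2 10 (by norm_num) (by norm_num) (by norm_num)]
      obtain ⟨τ', h0, h1', h2', h4, h5⟩ := denote_eliminationStep (G := G) τ hUτ
      rw [h0]
      refine ⟨h1'.trans h1, fun b hb hb' hb'' => (h2' b hb hb' hb'').trans (h2 b hb hb' hb''), ?_⟩
      obtain ⟨e', he'⟩ := h3.step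
      refine ⟨k + 1, e', ?_⟩
      have e1 : (fun v => On τ' 4 v v) =
          fun v => On τ 4 v v ∨ SimplicialRest U (fun v => On τ 4 v v) v := by
        ext v; exact h4 v
      have e2 : On τ' 5 = fun a b => On τ 5 a b ∨ (U.Adj a b ∧ ¬ On τ 4 a a ∧
          SimplicialRest U (fun v => On τ 4 v v) b ∧
            (¬ SimplicialRest U (fun v => On τ 4 v v) a ∨ b < a)) := by
        ext a b; exact h5 a b
      rw [e1, e2]
      exact he')
    (by
      intro τ _
      refine (Finset.card_le_univ _).trans ?_
      rw [Fintype.card_fin]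
      exact Nat.le_mul_self n)
    (by
      rintro τ ⟨-, h2, -⟩
      have hUτ : ∀ u v, On τ 10 u v ↔ U.Adj u v := by
        intro u v
        rw [← hU, On, On, h2 10 (by norm_num) (by norm_num) (by norm_num)]
      obtain ⟨τ', h0, -, -, h4, -⟩ := denote_eliminationStep (G := G) τ hUτ
      rw [h0]
      by_cases hg : ∀ v, On τ 4 v v
      · exact Or.inl hg
      · right
        obtain ⟨s, hs⟩ := exists_simplicialRest hO hUO (E := fun v => On τ 4 v v)
          (not_forall.1 hg)
        refine Finset.card_lt_card ⟨fun v hv => ?_, fun hsub => ?_⟩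
        · simp only [Finset.mem_filter, Finset.mem_univ, true_and] at hv ⊢
          exact (h4 v).2 (Or.inl hv)
        · have := @hsub s (by
            simp only [Finset.mem_filter, Finset.mem_univ, true_and]
            exact (h4 s).2 (Or.inr hs))
          simp only [Finset.mem_filter, Finset.mem_univ, true_and] at this
          exact hs.1 this)
    (by
      rintro τ ⟨-, h2, -⟩ hg v
      have hUτ : ∀ u v, On τ 10 u v ↔ U.Adj u v := by
        intro u v
        rw [← hU, On, On, h2 10 (by norm_num) (by norm_num) (by norm_num)]
      obtain ⟨τ', h0, -, -, h4, -⟩ := denote_eliminationStep (G := G) τ hUτ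
      rw [h0]
      exact (h4 v).2 (Or.inl (hg v)))
    (x := τ₀)
    ⟨rfl, fun b hb hb' _ => (assign_of_ne _ _ hb').trans (assign_of_ne _ _ hb), 0, fun _ => 0,
      fun v hv => absurd hv (h04 v), fun _ _ => rfl, fun a b h => absurd h (h05 a b),
      fun a b h => absurd h (h05 a b), fun a b h => absurd h (h05 a b),
      fun a b _ h => absurd h (h04 b), fun a b c h => absurd h (h05 a c)⟩
  obtain ⟨⟨h1, h2, k, e, h3⟩, h4⟩ := hmain
  rw [← denote_rep₂] at h1 h2 h3 h4
  have hadj : ∀ a b, U.Adj a b → On (eliminationStep.rep₂.denote G τ₀) 5 a b ∨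
      On (eliminationStep.rep₂.denote G τ₀) 5 b a := fun a b hab => h3.total a b hab (h4 b)
  -- Later times come first; among vertices eliminated at the same time, larger numbers come first.
  refine ⟨_, rfl, h1, h2, ⟨fun v => -((e v : ℤ) * n + v), fun a b hab => ?_, ?_⟩, fun a b =>
    ⟨hadj a b, ?_⟩⟩
  · have ha := a.2
    have hb := b.2
    rcases h3.order a b hab with hlt | ⟨heq, hlt⟩
    · have : ((e b : ℤ) + 1) * n ≤ e a * n := by
        gcongr
        exact_mod_cast hlt
      have hb' : (b : ℤ) < n := by exact_mod_cast hb
      have ha' : (0 : ℤ) ≤ (a : ℕ) := Int.natCast_nonneg _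
      rw [add_mul, one_mul] at this
      linarith
    · have hlt' : ((b : ℕ) : ℤ) < (a : ℕ) := by exact_mod_cast hlt
      rw [heq]
      linarith
  · intro a b c hac hbc hne
    exact hadj a b (h3.moral a b c hac hbc hne)
  · rintro (h | h)
    · exact h3.adj a b h
    · exact (h3.adj b a h).symm

/-- One iteration up to its interventions. It finds a moral orientation `O` of the unoriented edges,
and marks in matrix `9` the centroids of the nontrivial chain components and their parents. -/
theorem denote_roundCmd_eq_interv {σ : Arrays n × List (Fin n)} (h : Knows G σ)
    {U : SimpleGraph (Fin n)} (hUdef : U = (G.essential (atomicSet σ.2)).edges) :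
    ∃ (τ : Arrays n × List (Fin n)) (O : Fin n → Fin n → Prop) (r : Fin n → ℤ),
      roundCmd.denote G σ = Cmd.interv.denote G τ ∧ τ.2 = σ.2 ∧ (τ.1 0 = σ.1 0 ∧ τ.1 1 = σ.1 1) ∧
      IsMoral O r ∧ (∀ a b, U.Adj a b ↔ O a b ∨ O b a) ∧
      ∀ v, On τ 9 v v ↔ ∃ w, ((∃ x, U.Adj w x) ∧
        IsMoral.IsCentroid O (U.connectedComponentMk w).supp.ncard w) ∧ (v = w ∨ O v w) := by
  obtain ⟨r, hr⟩ := G.exists_rank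
  obtain ⟨τ₁, e1, l1, f1, m1⟩ := h.denote_meekCmd
  obtain ⟨τ₂, e2⟩ : ∃ τ, undirectedCmd.denote G τ₁ = τ := ⟨_, rfl⟩
  have l2 : τ₂.2 = τ₁.2 := by rw [← e2]; rfl
  have f2 : ∀ b, b ≠ 10 → τ₂.1 b = τ₁.1 b := fun b hb => by rw [← e2]; exact assign_of_ne τ₁ _ hb
  have hU : ∀ u v, On τ₂ 10 u v ↔ U.Adj u v := by
    intro u v
    rw [← e2, undirectedCmd, on_assign, hUdef, essential_adj_iff, Undirected, h.skel_iff, ← m1,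
      ← m1]
    simp only [Tm.holds_and, Tm.holds_neg, Tm.holds_cell, Tm.holds_add, f1 0 (by norm_num), On]
    simp [entryEnv]
  obtain ⟨τ₃, e3, l3, f3, ⟨r', hO⟩, hUO⟩ := denote_orientationCmd (G := G) τ₂ hU
    (residual_isMoral (atomicSet σ.2) G hr) (by rw [hUdef]; exact adj_iff_residual _ G)
  obtain ⟨τ₄, e4, l4, f4, m4⟩ := denote_reach (G := G) τ₃ (a := 6) (b := 5) (by norm_num)
  obtain ⟨τ₅, e5, l5, f5, m5⟩ := denote_reach (G := G) τ₄ (a := 7) (b := 10) (by norm_num)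
  obtain ⟨τ₆, e6⟩ : ∃ τ, centroidCmd.denote G τ₅ = τ := ⟨_, rfl⟩
  have l6 : τ₆.2 = τ₅.2 := by rw [← e6]; rfl
  have f6 : ∀ b, b ≠ 8 → τ₆.1 b = τ₅.1 b := fun b hb => by rw [← e6]; exact assign_of_ne τ₅ _ hb
  obtain ⟨τ₇, e7⟩ : ∃ τ, batchCmd.denote G τ₆ = τ := ⟨_, rfl⟩
  have l7 : τ₇.2 = τ₆.2 := by rw [← e7]; rfl
  have f7 : ∀ b, b ≠ 9 → τ₇.1 b = τ₆.1 b := fun b hb => by rw [← e7]; exact assign_of_ne τ₆ _ hb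
  have hround : roundCmd.denote G σ = Cmd.interv.denote G τ₇ := by
    rw [← e7, ← e6, ← e5, ← e4, ← e3, ← e2, ← e1]
    rfl
  have hkeep : ∀ b, b = 0 ∨ b = 1 → τ₇.1 b = σ.1 b := by
    intro b hb
    rw [f7 _ (by omega), f6 _ (by omega), f5 _ (by omega), f4 _ (by omega),
      f3 _ (by omega) (by omega) (by omega), f2 _ (by omega), f1 _ (by omega)]
  have hU4 : On τ₄ 10 = U.Adj := by
    ext u v
    rw [← hU, On, On, f4 10 (by norm_num), f3 10 (by norm_num) (by norm_num) (by norm_num)]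
  have hcomp : ∀ u v, On τ₅ 7 u v ↔ v ∈ (U.connectedComponentMk u).supp := by
    intro u v
    rw [m5, hU4, ← SimpleGraph.reachable_iff_reflTransGen]
    exact ⟨fun h => SimpleGraph.ConnectedComponent.sound h.symm,
      fun h => (SimpleGraph.ConnectedComponent.exact h).symm⟩
  have hdesc : ∀ u v, On τ₅ 6 u v ↔ v ∈ IsMoral.desc (On τ₃ 5) u := by
    intro u v
    rw [On, f5 6 (by norm_num)]
    exact m4 u v
  have hO5 : ∀ u v, On τ₅ 5 u v ↔ On τ₃ 5 u v := by
    intro u v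
    rw [On, f5 5 (by norm_num), f4 5 (by norm_num)]
    rfl
  have hU5 : ∀ u v, On τ₅ 10 u v ↔ U.Adj u v := by
    intro u v
    rw [On, f5 10 (by norm_num)]
    exact iff_of_eq (congrFun (congrFun hU4 u) v)
  have hsel : ∀ w w', On τ₆ 8 w w' ↔ (∃ x, U.Adj w x) ∧
      IsMoral.IsCentroid (On τ₃ 5) (U.connectedComponentMk w).supp.ncard w := by
    intro w w'
    have hc : {v | On τ₅ 7 w v} = (U.connectedComponentMk w).supp := by
      ext v; exact hcomp w v
    have hd : ∀ c, {v | On τ₅ 6 c v} = IsMoral.desc (On τ₃ 5) c := by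
      intro c; ext v; exact hdesc c v
    simp only [IsMoral.IsCentroid, ← hU5, ← hO5, ← hc, ← hd]
    rw [← e6, centroidCmd, on_assign]
    simp only [Tm.holds_and, Tm.holds_neg, Tm.holds_cell, Tm.holds_sum, Tm.holds_lt, Tm.eval_add,
      Tm.eval_sum_ind, On]
    simp [entryEnv, two_mul]
  refine ⟨τ₇, On τ₃ 5, r', hround, ?_, ⟨hkeep 0 (Or.inl rfl), hkeep 1 (Or.inr rfl)⟩, hO, hUO, ?_⟩
  · rw [l7, l6, l5, l4, l3, l2, l1]
  · intro v
    have hv : On τ₇ 9 v v ↔ On τ₆ 8 v v ∨ ∃ w, On τ₆ 8 w w ∧ On τ₅ 5 v w := by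
      rw [← e7, batchCmd, on_assign]
      simp only [Tm.holds_add, Tm.holds_and, Tm.holds_cell, Tm.holds_sum, f6 5 (by norm_num), On]
      simp [entryEnv]
    rw [hv]
    constructor
    · rintro (h' | ⟨w, h', h''⟩)
      · exact ⟨v, (hsel v v).1 h', Or.inl rfl⟩
      · exact ⟨w, (hsel w w).1 h', Or.inr ((hO5 v w).1 h'')⟩
    · rintro ⟨w, h', rfl | h''⟩
      · exact Or.inl ((hsel v v).2 h')
      · exact Or.inr ⟨w, (hsel w w).2 h', (hO5 v w).2 h''⟩

/-- One iteration of the program is one iteration of the search algorithm, unless that is done. -/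
theorem denote_roundCmd {σ : Arrays n × List (Fin n)} (h : Knows G σ) :
    Knows G (roundCmd.denote G σ) ∧ ((SearchDone G σ.2 ∧ (roundCmd.denote G σ).2 = σ.2) ∨
      SearchStep G σ.2 (roundCmd.denote G σ).2) := by
  classical
  obtain ⟨τ, O, r, hround, hτ, ⟨h0, h1⟩, hO, hUO, hbatch⟩ := denote_roundCmd_eq_interv h rfl
  obtain ⟨batch, hb⟩ : ∃ b, ((List.finRange n).filter fun v => decide (τ.1 9 v v ≠ 0)) = b :=
    ⟨_, rfl⟩
  have hmem : ∀ v, v ∈ batch ↔ τ.1 9 v v ≠ 0 := by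
    intro v
    simp [← hb]
  have hlog : (roundCmd.denote G σ).2 = σ.2 ++ batch := by
    rw [hround, ← hτ, ← hb]
    simp only [Cmd.denote]
  refine ⟨⟨fun u v => ?_, fun u v => ?_⟩, ?_⟩
  · rw [← h.input, On, On, ← h0, hround]
    simp only [Cmd.denote]
    rw [Function.update_of_ne (by norm_num)]
  · have hr := h.revealed u v
    rw [On, ← h1] at hr
    rw [hlog, List.mem_append, List.mem_append, hmem, hmem, hround]
    simp only [On, Cmd.denote, Function.update_self]
    split_ifs with h2 h3
    · exact ⟨fun _ => ⟨h3, by tauto⟩, fun _ => one_ne_zero⟩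
    · exact ⟨fun h => absurd rfl h, fun h => absurd h.1 h3⟩
    · rw [hr]
      tauto
  by_cases hd : SearchDone G σ.2
  · left
    refine ⟨hd, ?_⟩
    have : batch = [] := by
      refine List.eq_nil_iff_forall_not_mem.2 fun v hv => ?_
      obtain ⟨w, ⟨⟨x, hx⟩, -⟩, -⟩ := (hbatch v).1 ((hmem v).1 hv)
      rw [show (G.essential (atomicSet σ.2)).edges = ⊥ from hd] at hx
      exact hx
    rw [hlog, this, List.append_nil]
  · right
    refine ⟨hd, fun H => {v | ∃ w ∈ H.supp, IsMoral.IsCentroid O H.supp.ncard w ∧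
      (v = w ∨ O v w)}, fun H _ => ?_, batch, hb ▸ (List.nodup_finRange n).filter _,
      fun v => ?_, hlog⟩
    · obtain ⟨w, hw, hc⟩ := hO.exists_centroid hUO H
      have he : {v | ∃ w ∈ H.supp, IsMoral.IsCentroid O H.supp.ncard w ∧ (v = w ∨ O v w)} =
          {v | v = w ∨ O v w} := by
        ext v
        constructor
        · rintro ⟨w', hw', hc', hv⟩
          rw [hO.centroid_unique hUO hw hw' hc hc']
          exact hv
        · exact fun hv => ⟨w, hw, hc, hv⟩
      have := hO.isHalfCliqueSeparator hUO hw hc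
      rw [← he] at this
      exact this
    · rw [hmem]
      refine (hbatch v).trans ?_
      constructor
      · rintro ⟨w, ⟨⟨x, hx⟩, hc⟩, hv⟩
        refine ⟨_, ?_, w, rfl, hc, hv⟩
        refine (Set.one_lt_ncard (Set.toFinite _)).2 ⟨w, rfl, x, ?_, hx.ne⟩
        exact SimpleGraph.ConnectedComponent.sound hx.symm.reachable
      · rintro ⟨H, h2, w, hw, hc, hv⟩
        obtain rfl := (H.mem_supp_iff w).1 hw
        exact ⟨w, ⟨exists_adj_of_mem_supp h2 hw, hc⟩, hv⟩

/-- After `n` iterations the search algorithm is done. -/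
theorem denote_rep_roundCmd {σ : Arrays n × List (Fin n)} (h : Knows G σ) (hσ : σ.2 = []) :
    Knows G (roundCmd.rep.denote G σ) ∧ SearchReaches G (roundCmd.rep.denote G σ).2 ∧
      SearchDone G (roundCmd.rep.denote G σ).2 := by
  have key : ∀ i, Knows G ((roundCmd.denote G)^[i] σ) ∧
      SearchReaches G ((roundCmd.denote G)^[i] σ).2 ∧
      (SearchDone G ((roundCmd.denote G)^[i] σ).2 ∨
        ReachesIn G i ((roundCmd.denote G)^[i] σ).2) := by
    intro i
    induction i with
    | zero => exact ⟨h, by rw [Function.iterate_zero_apply, hσ]; exact .refl, Or.inr hσ⟩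
    | succ i ih =>
      obtain ⟨h1, h2, h3⟩ := ih
      rw [Function.iterate_succ_apply']
      obtain ⟨h4, h5⟩ := denote_roundCmd h1
      refine ⟨h4, ?_⟩
      rcases h5 with ⟨h5, h6⟩ | h5
      · rw [h6]
        exact ⟨h2, Or.inl h5⟩
      · exact ⟨.tail h2 h5, h3.elim (fun h3 => absurd h3 h5.1) fun h3 => Or.inr ⟨_, h3, h5⟩⟩
  obtain ⟨h1, h2, h3⟩ := key n
  refine ⟨h1, h2, ?_⟩
  by_contra hd
  have := (h3.resolve_left hd).pow_le_of_not_done hd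
  rw [Nat.card_eq_fintype_card, Fintype.card_fin] at this
  exact absurd (this.trans_lt Nat.lt_two_pow_self)
    (not_lt.2 (Nat.pow_le_pow_right two_pos (Nat.le_succ n)))

open Classical in
/-- The matrices at the start: only the input is not zero. -/
noncomputable def initialArrays (P : PDGraph (Fin n)) : Arrays n :=
  fun a u v => if a = 0 ∧ (P.arcs u v ∨ P.edges.Adj u v) then 1 else 0

theorem represents_init (P : PDGraph (Fin n)) :
    Represents (RState.init P) (initialArrays P, []) := by
  refine ⟨⟨?_, fun a i j => ?_⟩, rfl⟩
  · simp [RState.init]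
  · by_cases ha : a = 0
    · subst ha
      by_cases hP : P.arcs i j ∨ P.edges.Adj i j <;>
        simp [RState.init, code, initialArrays, hP]
    · have h0 : code a ≠ 0 := fun h => ha (code_injective (h.trans rfl))
      simp [RState.init, initialArrays, ha, h0, (code_ne a).1]

theorem knows_init (G : DAG (Fin n)) : Knows G (initialArrays (G.essential ∅), []) :=
  ⟨fun u v => by simp [On, initialArrays]; tauto, fun u v => by simp [On, initialArrays]⟩

/-- A single machine program carries out a complete run of the search algorithm, in polynomial
time, and outputs the ground truth. -/
theorem exists_search_program : ∃ (c : RProg) (q : Polynomial ℕ), ∀ (n : ℕ) (G : DAG (Fin n)),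
    ∃ (t : ℕ) (s : RState n), RExec G c (RState.init (G.essential ∅)) t s ∧ t ≤ q.eval n ∧
      SearchReaches G s.log ∧ SearchDone G s.log ∧ s.Outputs G := by
  obtain ⟨q, hq⟩ := searchCmd.halts 0 (by decide)
  refine ⟨searchCmd.compile 0, q, fun n G => ?_⟩
  obtain ⟨t, s, h1, h2, ⟨⟨-, h3⟩, h4⟩, -⟩ := hq G _ _ (represents_init (G.essential ∅))
  obtain ⟨hk, hr, hd⟩ := denote_rep_roundCmd (knows_init G) rfl
  obtain ⟨σ, hσ⟩ : ∃ σ, roundCmd.rep.denote G (initialArrays (G.essential ∅), []) = σ := ⟨_, rfl⟩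
  rw [hσ] at hk hr hd
  obtain ⟨τ, e1, l1, -, m1⟩ := hk.denote_meekCmd
  have hden : searchCmd.denote G (initialArrays (G.essential ∅), []) =
      (Cmd.assign 2 (.ind (.cell 3 0 1))).denote G τ := by
    rw [← e1, ← hσ]
    rfl
  rw [hden] at h3 h4
  have hlog : s.log = σ.2 := h4.trans l1
  refine ⟨t, s, h1, h2, by rw [hlog]; exact hr, by rw [hlog]; exact hd, fun u v => ?_⟩
  have hE : G.essential (atomicSet σ.2) = G.toPDGraph := isVerifying_iff.2 hd
  have harc : On τ 3 u v ↔ G.arc u v := by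
    rw [m1, hE]
    rfl
  refine (h3 2 u v).trans ?_
  classical
  simp only [Cmd.denote, Function.update_self, Tm.eval_ind, Tm.holds_cell]
  simp only [if_true, one_ne_zero, if_false]
  exact if_congr harc rfl rfl

end Search

theorem mainTheorem7 :
    ∃ C : ℝ,
      -- Every run of the search algorithm, whichever separators it picks, is never stuck, ends,
      -- and ends with few atomic interventions that fully orient the essential graph.
      (∀ (n : ℕ) (G : DAG (Fin n)),
        (∀ l, SearchReaches G l → ¬ SearchDone G l → ∃ l', SearchStep G l l') ∧
        (¬ ∃ f : ℕ → List (Fin n), f 0 = [] ∧ ∀ i, SearchStep G (f i) (f (i + 1))) ∧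
        (∀ l, SearchReaches G l → SearchDone G l →
          G.essential (atomicSet l) = G.toPDGraph ∧ l.Nodup ∧
            (l.length : ℝ) ≤ C * (Real.log n * G.nu1))) ∧
      -- One deterministic program, given only the essential graph and the intervention oracle,
      -- carries out such a run in polynomial time and outputs the ground truth.
      (∃ (c : RProg) (q : Polynomial ℕ), ∀ (n : ℕ) (G : DAG (Fin n)),
        ∃ (t : ℕ) (s : RState n),
          RExec G c (RState.init (G.essential ∅)) t s ∧ t ≤ q.eval n ∧
          SearchReaches G s.log ∧ SearchDone G s.log ∧
          G.essential (atomicSet s.log) = G.toPDGraph ∧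
          (s.log.length : ℝ) ≤ C * (Real.log n * G.nu1) ∧
          s.Outputs G) := by
  refine ⟨3 / Real.log 2, fun n G => ⟨fun l _ hd => exists_searchStep hd, not_exists_infinite_run,
    fun l hr hd => ⟨DAG.isVerifying_iff.2 hd, hr.nodup, hr.length_le⟩⟩, ?_⟩
  obtain ⟨c, q, h⟩ := exists_search_program
  refine ⟨c, q, fun n G => ?_⟩
  obtain ⟨t, s, h1, h2, h3, h4, h5⟩ := h n G
  exact ⟨t, s, h1, h2, h3, h4, DAG.isVerifying_iff.2 h4, h3.length_le, h5⟩
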